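/- For each $n\ge 1$ let $p_n$ be a number of covariates, let $f^{tr},f^{te}$ be training and test input densities on $\mathbb{R}^{p_n}$ with a common support, and let the conditional law of the response $y$ given the input $\boldsymbol x$ be the same in both populations (covariate shift). Put $w(\boldsymbol x)=f^{te}(\boldsymbol x)/f^{tr}(\boldsymbol x)$ (known), $y(\boldsymbol x)=E[y\mid\boldsymbol x]$, let $\alpha+\boldsymbol\beta^\top\boldsymbol x^{te}=:y^{te}(\boldsymbol x^{te})$ be the best linear predictor of $y^{te}$ in mean square (the model may be misspecified), $\varepsilon^{te}=y^{te}-y^{te}(\boldsymbol x^{te})$, $\varepsilon^{tr}=y^{tr}-y(\boldsymbol x^{tr})$, and $\boldsymbol\Sigma^{te}=\mathrm{Cov}(\boldsymbol x^{te})$. Assume: (C1) $p_n\to\infty$ and $\log p_n=O(n^\gamma)$ for some $\gamma\in(0,1)$. (C2) For some $\theta_0>0$, $\eta\in(0,2]$: $\limsup_n E e^{\theta_0|\varepsilon^{tr}|^\eta}<\infty$, $\limsup_n E e^{\theta_0|\varepsilon^{te}|^\eta}<\infty$, $\limsup_n\max_{0\le i,j\le p_n}E e^{\theta_0|x^{te}_ix^{te}_j|}<\infty$,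 where $x_0^{te}=1$. (C3) $\limsup_n E[w(\boldsymbol x^{te})^q]<\infty$ for some $q>0$. (C4) The training data $(y_t^{tr},\boldsymbol x^{tr}_t)$, $t=1,\dots,n$, are drawn from the training population and the pairs $(\varepsilon^{tr}_t,\boldsymbol x^{tr}_t)$, $\varepsilon^{tr}_t=y^{tr}_t-y(\boldsymbol x^{tr}_t)$, are i.i.d. (C5) $\sup_n(|\alpha|+\|\boldsymbol\beta\|_2)<\infty$ and, for some $\xi\ge 0$, $C_\xi>0$, $\|\boldsymbol\beta_J\|_1\le C_\xi\|\boldsymbol\beta_J\|_2^{2\xi/(2\xi+1)}$ for all nonempty $J\subset\{1,\dots,p_n\}$. (Noise) $E[(\varepsilon^{te})^2]$ is bounded away from zero for large $n$. Let $c_n=(\log p_n/n)^{1/2}$, $d_n=c_n^{2q/(1+q)}(\log n)^{1/\eta+1/2}$ if $q\le1$ and $d_n=c_n$ if $q>1$; $K_n=M_kd_n^{-1}$; and, for some $M_w>0$ and $M_\eta\ge 1/\eta+1/2$, $b_n=M_wc_n^{-2/(1+q)}$ if $q\le1$ and $b_n=M_wc_n^{-1}(\log n)^{-M_\eta}$ if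 $q>1$. Assume also, for constants $C_\Sigma,C_\lambda>0$ and all large $n$, that $\lambda_{\min}(\boldsymbol\Sigma^{te})\ge C_\lambda$ and $\|(\boldsymbol\Sigma^{te}_{J,J})^{-1}\boldsymbol\sigma^{te}_{J,j}\|_1\le C_\Sigma$ whenever $1\le\sharp J\le K_n$ and $j\notin J$, where $\boldsymbol\sigma^{te}_{J,j}=(\Sigma^{te}_{ij})_{i\in J}$. Let $v_t=\min\{w(\boldsymbol x_t^{tr}),b_n\}$ and $w_t=v_t/(n^{-1}\sum_sv_s)$. For a model $J$ let $\hat y^{te}(\cdot|J)$ be the $w_t$-weighted least squares predictor (with intercept) based on the covariates in $J$, $\hat\sigma^2(J)=n^{-1}\sum_tw_t(y_t^{tr}-\hat y^{te}(\boldsymbol x_t^{tr}|J))^2$ and $\mathrm{HDIWIC}(J)=(1+s_a(\sharp J+1)d_n^2)\hat\sigma^2(J)$. Let $\hat J_0=\emptyset$ and let $\hat J_m$ (IWOGA) be $\hat J_{m-1}$ together with a covariate $j\notin\hat J_{m-1}$ whose weighted correlation with the residuals $y^{tr}_t-\hat y^{te}(\boldsymbol x^{tr}_t|\hat J_{m-1})$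 is largest in absolute value ($\hat J_m=\hat J_{m-1}$ if no covariate is left); let $\hat k$ minimize $\mathrm{HDIWIC}(\hat J_k)$ over integers $1\le k\le K_n$. Ties are broken arbitrarily. Then there are thresholds for $M_k$ and $s_a$, which do not depend on $\xi$ or $C_\xi$, such that whenever $M_k>0$ is below its threshold and $s_a$ is above its threshold, $$E_n\bigl[(y^{te}(\boldsymbol x^{te})-\hat y^{te}(\boldsymbol x^{te}|\hat J_{\hat k}))^2\bigr]\Big/ d_n^{\frac{1+2\xi}{1+\xi}}=O_p(1),$$ where $E_n$ is conditional expectation given the training data, the test input $\boldsymbol x^{te}$ being independent of them. Moreover $d_n^{(1+2\xi)/(1+\xi)}$ is the exact order, as $n\to\infty$, of the minimum over integers $1\le m\le K_n$ of $L_n^{(\xi)}(m)=m^{-(1+2\xi)}+md_n^2$. So the rate that is optimal for this trade-off is reached without knowing $\xi$. -/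

import Mathlib

open MeasureTheory ProbabilityTheory Filter Topology
open scoped Matrix BigOperators

namespace CovShift

noncomputable section

/-! ### The population: training and test distributions under covariate shift -/

/-- A covariate-shift population with `p` covariates: two input densities `fTr`, `fTe` with respect
to a common reference measure, having the same support, and one conditional law `cond` of the
response given the input, shared by the training and the test distribution. -/
structure Population (p : ℕ) where
  ref : Measure (Fin p → ℝ)
  fTr : (Fin p → ℝ) → ℝ
  fTe : (Fin p → ℝ) → ℝ
  measurable_fTr : Measurable fTr
  measurable_fTe : Measurable fTe
  fTr_nonneg : ∀ x, 0 ≤ fTr x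
  fTe_nonneg : ∀ x, 0 ≤ fTe x
  lintegral_fTr : ∫⁻ x, ENNReal.ofReal (fTr x) ∂ref = 1
  lintegral_fTe : ∫⁻ x, ENNReal.ofReal (fTe x) ∂ref = 1
  common_support : ∀ x, 0 < fTr x ↔ 0 < fTe x
  cond : Kernel (Fin p → ℝ) ℝ
  isMarkov_cond : IsMarkovKernel cond

namespace Population

variable {p : ℕ}

/-- Law of the training input. -/
def inputTr (M : Population p) : Measure (Fin p → ℝ) :=
  M.ref.withDensity (fun x => ENNReal.ofReal (M.fTr x))

/-- Law of the test input. -/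
def inputTe (M : Population p) : Measure (Fin p → ℝ) :=
  M.ref.withDensity (fun x => ENNReal.ofReal (M.fTe x))

instance (M : Population p) : IsMarkovKernel M.cond := M.isMarkov_cond

instance (M : Population p) : IsProbabilityMeasure M.inputTr :=
  ⟨by rw [inputTr, withDensity_apply _ MeasurableSet.univ, Measure.restrict_univ, M.lintegral_fTr]⟩

instance (M : Population p) : IsProbabilityMeasure M.inputTe :=
  ⟨by rw [inputTe, withDensity_apply _ MeasurableSet.univ, Measure.restrict_univ, M.lintegral_fTe]⟩

/-- Joint law of (input, response) in the training population. -/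
def lawTr (M : Population p) : Measure ((Fin p → ℝ) × ℝ) := M.inputTr ⊗ₘ M.cond

/-- Joint law of (input, response) in the test population. -/
def lawTe (M : Population p) : Measure ((Fin p → ℝ) × ℝ) := M.inputTe ⊗ₘ M.cond

/-- The importance `w = f^te / f^tr`. -/
def importance (M : Population p) (x : Fin p → ℝ) : ℝ := M.fTe x / M.fTr x

/-- The regression function `y(x) = E[y | x]`. -/
def regression (M : Population p) (x : Fin p → ℝ) : ℝ := ∫ y, y ∂(M.cond x)

/-- Covariance matrix of the test input. -/
def SigmaTe (M : Population p) : Matrix (Fin p) (Fin p) ℝ :=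
  Matrix.of fun i j => covariance (fun x => x i) (fun x => x j) M.inputTe

end Population

/-- The linear function `α + βᵀ x`. -/
def linPred {p : ℕ} (α : ℝ) (β : Fin p → ℝ) (x : Fin p → ℝ) : ℝ := α + β ⬝ᵥ x

/-- `(α, β)` are the coefficients of the best linear predictor of the test response: they minimize
the mean squared error among all linear predictors. -/
def IsBestLinearPredictor {p : ℕ} (M : Population p) (α : ℝ) (β : Fin p → ℝ) : Prop :=
  ∀ (a : ℝ) (b : Fin p → ℝ),
    ∫⁻ z, ENNReal.ofReal ((z.2 - linPred α β z.1) ^ 2) ∂M.lawTe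
      ≤ ∫⁻ z, ENNReal.ofReal ((z.2 - linPred a b z.1) ^ 2) ∂M.lawTe

/-! ### Rates and tuning sequences -/

/-- `c_n = (log p_n / n)^{1/2}`. -/
def cRate (p : ℕ → ℕ) (n : ℕ) : ℝ := Real.sqrt (Real.log (p n) / n)

/-- `d_n = d_n(q)`. -/
def dRate (p : ℕ → ℕ) (q η : ℝ) (n : ℕ) : ℝ :=
  if q ≤ 1 then cRate p n ^ (2 * q / (1 + q)) * Real.log n ^ (1 / η + 1 / 2)
  else cRate p n

/-- The trimming level `b_n = b_n(q)`. -/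
def trimLevel (p : ℕ → ℕ) (q Mw Mη : ℝ) (n : ℕ) : ℝ :=
  if q ≤ 1 then Mw * cRate p n ^ (-(2 / (1 + q)))
  else Mw * (cRate p n)⁻¹ * Real.log n ^ (-Mη)

/-- The bound `K_n = M_k d_n⁻¹` on the number of iterations. -/
def iterBound (p : ℕ → ℕ) (q η Mk : ℝ) (n : ℕ) : ℝ := Mk * (dRate p q η n)⁻¹

/-! ### Assumptions on a sequence of populations -/

/-- (C1) -/
def CondC1 (p : ℕ → ℕ) : Prop :=
  (∃ γ : ℝ, 0 < γ ∧ γ < 1 ∧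
    (fun n : ℕ => Real.log (p n)) =O[atTop] (fun n : ℕ => (n : ℝ) ^ γ)) ∧
  Tendsto p atTop atTop

/-- (C2): exponential moments of `ε^tr = y^tr - y(x^tr)`, of `ε^te = y^te - α - βᵀ x^te`, and of the
products `x_i^te x_j^te`, `0 ≤ i, j ≤ p_n`, where `x_0 = 1`. -/
def CondC2 {p : ℕ → ℕ} (M : ∀ n, Population (p n)) (α : ℕ → ℝ) (β : ∀ n, Fin (p n) → ℝ)
    (θ₀ η : ℝ) : Prop :=
  limsup (fun n => ∫⁻ z, ENNReal.ofReal
    (Real.exp (θ₀ * |z.2 - (M n).regression z.1| ^ η)) ∂(M n).lawTr) atTop < ⊤ ∧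
  limsup (fun n => ∫⁻ z, ENNReal.ofReal
    (Real.exp (θ₀ * |z.2 - linPred (α n) (β n) z.1| ^ η)) ∂(M n).lawTe) atTop < ⊤ ∧
  limsup (fun n => ⨆ (i : Fin (p n + 1)) (j : Fin (p n + 1)),
    ∫⁻ x : Fin (p n) → ℝ, ENNReal.ofReal
      (Real.exp (θ₀ * |(Fin.cons 1 x : Fin (p n + 1) → ℝ) i * (Fin.cons 1 x : Fin (p n + 1) → ℝ) j|))
      ∂(M n).inputTe) atTop < ⊤

/-- (C3) -/
def CondC3 {p : ℕ → ℕ} (M : ∀ n, Population (p n)) (q : ℝ) : Prop :=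
  limsup (fun n => ∫⁻ x, ENNReal.ofReal ((M n).importance x ^ q) ∂(M n).inputTe) atTop < ⊤

/-- (C4): for every `n`, the training data `(X n t, Y n t)`, `t = 1, …, n`, follow the training
distribution, and the pairs (error, input) are independent (hence independent and identically
distributed). -/
def CondC4 {p : ℕ → ℕ} (M : ∀ n, Population (p n)) {Ω : ℕ → Type*} [∀ n, MeasurableSpace (Ω n)]
    (P : ∀ n, Measure (Ω n)) (X : ∀ n, Fin n → Ω n → (Fin (p n) → ℝ)) (Y : ∀ n, Fin n → Ω n → ℝ) :
    Prop :=
  ∀ n, (∀ t, Measurable (X n t)) ∧ (∀ t, Measurable (Y n t)) ∧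
    (∀ t, (P n).map (fun ω => (X n t ω, Y n t ω)) = (M n).lawTr) ∧
    iIndepFun (fun t ω => (Y n t ω - (M n).regression (X n t ω), X n t ω)) (P n)

/-- (C5) with sparsity index `ξ` and constant `Cξ`. -/
def CondC5 {p : ℕ → ℕ} (α : ℕ → ℝ) (β : ∀ n, Fin (p n) → ℝ) (ξ Cξ : ℝ) : Prop :=
  (∃ B : ℝ, ∀ n, 1 ≤ n → |α n| + Real.sqrt (∑ j, β n j ^ 2) ≤ B) ∧
  ∀ n, 1 ≤ n → ∀ J : Finset (Fin (p n)), J.Nonempty →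
    ∑ j ∈ J, |β n j| ≤ Cξ * Real.sqrt (∑ j ∈ J, β n j ^ 2) ^ (2 * ξ / (2 * ξ + 1))

/-- For a `p × p` matrix `S`: `max ‖S_{J,J}⁻¹ s_{J,j}‖₁ ≤ C` over `1 ≤ #J ≤ K` and `j ∉ J`. -/
def RegressionBound {p : ℕ} (S : Matrix (Fin p) (Fin p) ℝ) (K C : ℝ) : Prop :=
  ∀ J : Finset (Fin p), 1 ≤ J.card → (J.card : ℝ) ≤ K → ∀ j ∉ J,
    ∑ i : J, |((S.submatrix (fun a : J => (a : Fin p)) (fun a : J => (a : Fin p)))⁻¹ *ᵥ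
      (fun a : J => S a j)) i| ≤ C

/-- `λ_min(S) ≥ c` for a symmetric matrix `S`. -/
def MinEigenvalueGE {p : ℕ} (S : Matrix (Fin p) (Fin p) ℝ) (c : ℝ) : Prop :=
  ∀ lam : ℝ, Module.End.HasEigenvalue (Matrix.toLin' S) lam → c ≤ lam

/-- The variance of the test error `ε^te` is bounded away from zero. -/
def NoiseNondegenerate {p : ℕ → ℕ} (M : ∀ n, Population (p n)) (α : ℕ → ℝ)
    (β : ∀ n, Fin (p n) → ℝ) : Prop :=
  ∃ s : ℝ, 0 < s ∧ ∀ᶠ n in atTop,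
    ENNReal.ofReal s ≤ ∫⁻ z, ENNReal.ofReal ((z.2 - linPred (α n) (β n) z.1) ^ 2) ∂(M n).lawTe

/-! ### Weighted least squares, IWOGA and HDIWIC, for a given training sample

`x t` is the `t`-th training input, `y t` the `t`-th training response, `w t` the `t`-th weight. -/

section Sample

variable {n p : ℕ}

/-- The weights `w_t = v_t / (n⁻¹ ∑ v_s)` with `v_t = min (w(x_t)) b`. -/
def sampleWeight (M : Population p) (b : ℝ) (x : Fin n → Fin p → ℝ) (t : Fin n) : ℝ :=
  min (M.importance (x t)) b / ((n : ℝ)⁻¹ * ∑ s, min (M.importance (x s)) b)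

/-- `W^{1/2}`. -/
def sqrtW (w : Fin n → ℝ) : Matrix (Fin n) (Fin n) ℝ := Matrix.diagonal fun t => Real.sqrt (w t)

/-- `P_W = n⁻¹ W^{1/2} 1 1ᵀ W^{1/2}`. -/
def projW (w : Fin n → ℝ) : Matrix (Fin n) (Fin n) ℝ :=
  (n : ℝ)⁻¹ • (sqrtW w * Matrix.vecMulVec (fun _ => 1) (fun _ => 1) * sqrtW w)

/-- `W^{1/2} P_W^⊥ W^{1/2}`, where `P_W^⊥ = I - P_W`. -/
def centerW (w : Fin n → ℝ) : Matrix (Fin n) (Fin n) ℝ := sqrtW w * (1 - projW w) * sqrtW w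

/-- Weighted mean of the responses. -/
def muYHat (w y : Fin n → ℝ) : ℝ := (n : ℝ)⁻¹ * ∑ t, w t * y t

/-- Weighted mean of the inputs. -/
def muHat (w : Fin n → ℝ) (x : Fin n → Fin p → ℝ) (i : Fin p) : ℝ :=
  (n : ℝ)⁻¹ * ∑ t, w t * x t i

/-- Weighted covariance matrix of the inputs. -/
def SigmaHat (w : Fin n → ℝ) (x : Fin n → Fin p → ℝ) : Matrix (Fin p) (Fin p) ℝ :=
  (n : ℝ)⁻¹ • ((Matrix.of x)ᵀ * centerW w * Matrix.of x)

/-- Weighted covariance vector of inputs and response. -/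
def sHat (w : Fin n → ℝ) (x : Fin n → Fin p → ℝ) (y : Fin n → ℝ) : Fin p → ℝ :=
  (n : ℝ)⁻¹ • (((Matrix.of x)ᵀ * centerW w) *ᵥ y)

/-- Weighted least squares slope for model `J`. -/
def betaHat (w : Fin n → ℝ) (x : Fin n → Fin p → ℝ) (y : Fin n → ℝ) (J : Finset (Fin p)) : J → ℝ :=
  ((SigmaHat w x).submatrix (fun a : J => (a : Fin p)) (fun a : J => (a : Fin p)))⁻¹ *ᵥ
    (fun a : J => sHat w x y a)

/-- Weighted least squares intercept for model `J`. -/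
def alphaHat (w : Fin n → ℝ) (x : Fin n → Fin p → ℝ) (y : Fin n → ℝ) (J : Finset (Fin p)) : ℝ :=
  muYHat w y - ∑ a : J, betaHat w x y J a * muHat w x a

/-- Weighted least squares predictor based on model `J`, at the input `z`. -/
def yHat (w : Fin n → ℝ) (x : Fin n → Fin p → ℝ) (y : Fin n → ℝ) (J : Finset (Fin p))
    (z : Fin p → ℝ) : ℝ :=
  alphaHat w x y J + ∑ a : J, betaHat w x y J a * z a

/-- Weighted residual mean square of model `J`. -/
def sigmaSqHat (w : Fin n → ℝ) (x : Fin n → Fin p → ℝ) (y : Fin n → ℝ) (J : Finset (Fin p)) : ℝ :=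
  (n : ℝ)⁻¹ * ∑ t, w t * (y t - yHat w x y J (x t)) ^ 2

/-- The criterion `HDIWIC(J) = (1 + s_a (#J + 1) d²) σ̂²(J)`. -/
def HDIWIC (w : Fin n → ℝ) (x : Fin n → Fin p → ℝ) (y : Fin n → ℝ) (sa d : ℝ)
    (J : Finset (Fin p)) : ℝ :=
  (1 + sa * ((J.card : ℝ) + 1) * d ^ 2) * sigmaSqHat w x y J

/-- Absolute weighted correlation (up to a factor not depending on `i`) between the residuals of the
weighted least squares fit on `J` and the covariate `i`. The weighted residuals sum to zero, so that
the covariate need not be centred in the numerator. -/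
def greedyScore (w : Fin n → ℝ) (x : Fin n → Fin p → ℝ) (y : Fin n → ℝ) (J : Finset (Fin p))
    (i : Fin p) : ℝ :=
  |(n : ℝ)⁻¹ * ∑ t, w t * (y t - yHat w x y J (x t)) * x t i| / Real.sqrt (SigmaHat w x i i)

/-- `J 0, J 1, J 2, …` is a run of the importance-weighted orthogonal greedy algorithm: it starts
from the empty model, each iteration adds a covariate outside the current model whose score is
largest (ties are broken arbitrarily) and refits, and the model is kept once it is full. -/
def IsIWOGA (w : Fin n → ℝ) (x : Fin n → Fin p → ℝ) (y : Fin n → ℝ) (J : ℕ → Finset (Fin p)) :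
    Prop :=
  J 0 = ∅ ∧ ∀ m,
    (J m ≠ Finset.univ → ∃ i ∉ J m,
      (∀ j ∉ J m, greedyScore w x y (J m) j ≤ greedyScore w x y (J m) i) ∧
      J (m + 1) = insert i (J m)) ∧
    (J m = Finset.univ → J (m + 1) = Finset.univ)

/-- `k` minimizes `HDIWIC (J k)` over the integers `1 ≤ k ≤ K`. -/
def IsHDIWICMin (w : Fin n → ℝ) (x : Fin n → Fin p → ℝ) (y : Fin n → ℝ) (sa d K : ℝ)
    (J : ℕ → Finset (Fin p)) (k : ℕ) : Prop :=
  1 ≤ k ∧ (k : ℝ) ≤ K ∧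
    ∀ l : ℕ, 1 ≤ l → (l : ℝ) ≤ K → HDIWIC w x y sa d (J k) ≤ HDIWIC w x y sa d (J l)

/-- Modified conditional prediction error of model `J`: the test input is independent of the training
sample, so that conditioning on the training sample means integrating over the law of the test input
with the sample (and hence the fitted predictor) held fixed. -/
def MCPE (M : Population p) (α : ℝ) (β : Fin p → ℝ) (w : Fin n → ℝ) (x : Fin n → Fin p → ℝ)
    (y : Fin n → ℝ) (J : Finset (Fin p)) : ℝ :=
  ∫ z, (linPred α β z - yHat w x y J z) ^ 2 ∂M.inputTe

end Sample

/-- `Z_n = O_p(1)`. -/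
def IsBigOpOne {Ω : ℕ → Type*} [∀ n, MeasurableSpace (Ω n)] (P : ∀ n, Measure (Ω n))
    (Z : ∀ n, Ω n → ℝ) : Prop :=
  ∀ ε : ℝ, 0 < ε → ∃ B : ℝ, ∀ᶠ n in atTop, P n {ω | B < |Z n ω|} ≤ ENNReal.ofReal ε

/-- The bound `L_n(m) = m^{-(1+2ξ)} + m d²` on the prediction error after `m` iterations. -/
def iterRate (ξ d : ℝ) (m : ℕ) : ℝ := (m : ℝ) ^ (-(1 + 2 * ξ)) + (m : ℝ) * d ^ 2

end

end CovShift

/-! The proof has a probabilistic half, which shows that a sample is good with probability tending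
to one, and a deterministic half, which bounds the prediction error on every good sample. A sample
is good (`GoodSample`) if the truncated importance-weighted averages of `x_i x_j` and `x_i e` (with
`x_0 = 1` and `e = y - α - βᵀx`) are within `D d_n` of their test expectations and the weighted
average of `e²` stays between two positive constants.

Deterministic half. Let `T` be the weighted sample covariance matrix, `S` its test counterpart, `g`
the weighted covariances of inputs and `e`, and `r = β - β̂_J`. Up to a term free of `J`, the
residual variance is `Q = rᵀTr + 2gᵀr`; the greedy score is `|(Tr + g)_i| / √T_ii`; the prediction
error is `rᵀSr` plus a squared intercept error. Write `r = v - k`, where `v` solves the normal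
equations without noise and `k` is the fitted noise. Since `v` is linear in the coefficients outside
`J`, the bound on the regression coefficients gives `‖v‖₁ ≲ ∑_{j∉J} |β_j|`, while coercivity gives
`kᵀTk ≲ #J d²`. The bias is `a = vᵀTv`. Put `θ = ξ/(2ξ+1)` and `δ = d^{(1+2ξ)/(1+ξ)}`, so that `d =
δ^{1-θ}`. Sparsity and Young's inequality then turn each error of the form `d ∑_{j∉J} |β_j|` into a
fraction of `a` plus `O(δ)` (`exists_sparseFitBounds`).

As long as `a` is large compared with `δ`, `a/4 ≤ ∑_{j∉J} β_j (Tr + g)_j ≲ score · ∑_{j∉J} |β_j| ≲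
score · a^θ`, and a greedy step lowers `Q` by at least `score²`. Hence `Q_{m+1} ≤ Q_m - c Q_m^{1+s}`
with `s = 1 - 2θ = 1/(2ξ+1)`, which forces `Q_m ≲ m^{-(1+2ξ)}` (`recursion_bound`). About `δ^{-s}`
steps make both the bias and the variance `m d²` of order `δ` (`exists_greedy_bias_le`). Comparing
the selected model with this one in HDIWIC finishes the argument (`exists_selection_bound`): the
residual variance is bounded below, so the penalty exceeds what fitting noise can gain. `M_k` only
has to keep `T` coercive on models of size `K_n`, and `s_a` only has to beat the constant of the
fitted noise; neither involves `ξ`.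

Probabilistic half. A Chernoff bound with parameter `l = κ c_n²/d_n` is applied to `min(w, b_n) h`.
In the second-order term one factor `min(w, b_n)` is replaced by `w`, which turns a training
expectation into a test expectation, where the exponential moments are available; the choice of
`b_n` balances the bias of truncation, this variance and the range. The failure probability `2
p_n^{-4}` survives a union over all pairs of covariates. Products `x_i e` are first truncated, as
`e` may have heavier tails (`exists_goodSample_bound`). -/

namespace CovShift

/-! ### Residuals of quadratic least squares problems -/

section Quadratic

variable {p : ℕ}

/-- The `ℓ¹` norm of a vector. -/
def l1 (v : Fin p → ℝ) : ℝ := ∑ i, |v i|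

/-- The residual coefficient vector `β - b`, where `b` is supported on `J` and solves the normal
equations with Gram matrix `T` and noise vector `g`. -/
structure IsResidual (T : Matrix (Fin p) (Fin p) ℝ) (g β : Fin p → ℝ) (J : Finset (Fin p))
    (r : Fin p → ℝ) : Prop where
  eq_off : ∀ i ∉ J, r i = β i
  normal : ∀ i ∈ J, (T *ᵥ r) i + g i = 0

/-- The quadratic criterion `rᵀ T r + 2 gᵀ r`. -/
def quadCrit (T : Matrix (Fin p) (Fin p) ℝ) (g r : Fin p → ℝ) : ℝ :=
  r ⬝ᵥ T *ᵥ r + 2 * (g ⬝ᵥ r)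

lemma l1_nonneg (v : Fin p → ℝ) : 0 ≤ l1 v := Finset.sum_nonneg fun _ _ => abs_nonneg _

lemma l1_add_le (u v : Fin p → ℝ) : l1 (u + v) ≤ l1 u + l1 v := by
  unfold l1
  rw [← Finset.sum_add_distrib]
  exact Finset.sum_le_sum fun i _ => abs_add_le _ _

lemma l1_sub_le (u v : Fin p → ℝ) : l1 (u - v) ≤ l1 u + l1 v := by
  unfold l1
  rw [← Finset.sum_add_distrib]
  exact Finset.sum_le_sum fun i _ => abs_sub _ _

lemma l1_smul (c : ℝ) (v : Fin p → ℝ) : l1 (c • v) = |c| * l1 v := by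
  simp [l1, Finset.mul_sum, abs_mul]

lemma l1_sum_le {ι : Type*} (s : Finset ι) (f : ι → Fin p → ℝ) :
    l1 (∑ j ∈ s, f j) ≤ ∑ j ∈ s, l1 (f j) := by
  classical
  induction s using Finset.induction_on with
  | empty => simp [l1]
  | insert a s ha ih =>
    rw [Finset.sum_insert ha, Finset.sum_insert ha]
    exact (l1_add_le _ _).trans (by gcongr)

lemma abs_dotProduct_le {v g : Fin p → ℝ} {G : ℝ} (h : ∀ i, v i ≠ 0 → |g i| ≤ G) :
    |v ⬝ᵥ g| ≤ G * l1 v := by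
  unfold dotProduct l1
  rw [Finset.mul_sum]
  refine (Finset.abs_sum_le_sum_abs _ _).trans (Finset.sum_le_sum fun i _ => ?_)
  rw [abs_mul]
  by_cases hv : v i = 0
  · simp [hv]
  · rw [mul_comm]
    exact mul_le_mul_of_nonneg_right (h i hv) (abs_nonneg _)

lemma abs_mulVec_le {T : Matrix (Fin p) (Fin p) ℝ} {ε : ℝ} (h : ∀ i j, |T i j| ≤ ε)
    (v : Fin p → ℝ) (i : Fin p) : |(T *ᵥ v) i| ≤ ε * l1 v := by
  have : (T *ᵥ v) i = v ⬝ᵥ T i := by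
    simp [Matrix.mulVec, dotProduct_comm]
  rw [this]
  exact abs_dotProduct_le fun j _ => h i j

lemma abs_quadForm_sub_le {S T : Matrix (Fin p) (Fin p) ℝ} {ε : ℝ}
    (h : ∀ i j, |T i j - S i j| ≤ ε) (v : Fin p → ℝ) :
    |v ⬝ᵥ T *ᵥ v - v ⬝ᵥ S *ᵥ v| ≤ ε * l1 v ^ 2 := by
  rw [← dotProduct_sub, ← Matrix.sub_mulVec]
  have := abs_dotProduct_le (v := v) (g := (T - S) *ᵥ v) (G := ε * l1 v)
    fun i _ => abs_mulVec_le (fun i j => by simpa using h i j) v i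
  calc _ ≤ _ := this
    _ = _ := by ring

lemma l1_sq_le_card {v : Fin p → ℝ} {J : Finset (Fin p)} (hv : ∀ i ∉ J, v i = 0) :
    l1 v ^ 2 ≤ J.card * (v ⬝ᵥ v) := by
  have h1 : l1 v = ∑ i ∈ J, |v i| :=
    (Finset.sum_subset (Finset.subset_univ _) fun i _ hi => by simp [hv i hi]).symm
  have h2 : v ⬝ᵥ v = ∑ i ∈ J, |v i| ^ 2 := by
    rw [dotProduct, ← Finset.sum_subset (Finset.subset_univ J) fun i _ hi => by simp [hv i hi]]
    simp [sq]
  rw [h1, h2]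
  exact sq_sum_le_card_mul_sum_sq

/-- An entrywise error `ε` changes the form at `v` by at most `ε ‖v‖₁² ≤ ε #J ‖v‖₂²`. This is the
reason for the cap `K_n ~ 1/d_n` on the model size. -/
lemma coercive_of_close {S T : Matrix (Fin p) (Fin p) ℝ} {ε lam : ℝ} {J : Finset (Fin p)}
    (hS : ∀ v : Fin p → ℝ, lam * (v ⬝ᵥ v) ≤ v ⬝ᵥ S *ᵥ v)
    (h : ∀ i j, |T i j - S i j| ≤ ε) (hε : 0 ≤ ε) (hJ : J.card * ε ≤ lam / 2)
    {v : Fin p → ℝ} (hv : ∀ i ∉ J, v i = 0) :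
    lam / 2 * (v ⬝ᵥ v) ≤ v ⬝ᵥ T *ᵥ v := by
  have h1 := abs_le.1 (abs_quadForm_sub_le h v)
  have h2 := mul_le_mul_of_nonneg_left (l1_sq_le_card hv) hε
  have h3 : 0 ≤ v ⬝ᵥ v := Finset.sum_nonneg fun i _ => mul_self_nonneg _
  have h4 := mul_le_mul_of_nonneg_right hJ h3
  have := hS v
  nlinarith

lemma dotProduct_eq_sum_of_support {v u : Fin p → ℝ} {J : Finset (Fin p)}
    (hv : ∀ i ∉ J, v i = 0) : v ⬝ᵥ u = ∑ i ∈ J, v i * u i :=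
  (Finset.sum_subset (Finset.subset_univ _) fun i _ hi => by simp [hv i hi]).symm

lemma dotProduct_eq_of_support {v u u' : Fin p → ℝ} {J : Finset (Fin p)}
    (hv : ∀ i ∉ J, v i = 0) (hu : ∀ i ∈ J, u i = u' i) : v ⬝ᵥ u = v ⬝ᵥ u' := by
  rw [dotProduct_eq_sum_of_support hv, dotProduct_eq_sum_of_support hv]
  exact Finset.sum_congr rfl fun i hi => by rw [hu i hi]

/-- Solutions of the normal equations supported on `J` are small if the right-hand side is. -/
lemma solution_bounds {T : Matrix (Fin p) (Fin p) ℝ} {g k : Fin p → ℝ} {J : Finset (Fin p)}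
    {lam G : ℝ} (hlam : 0 < lam) (hG : 0 ≤ G) (hk : ∀ i ∉ J, k i = 0)
    (hT : lam * (k ⬝ᵥ k) ≤ k ⬝ᵥ T *ᵥ k) (hsol : ∀ i ∈ J, (T *ᵥ k) i = g i)
    (hg : ∀ i ∈ J, |g i| ≤ G) :
    l1 k ≤ J.card * G / lam ∧ k ⬝ᵥ T *ᵥ k ≤ J.card * G ^ 2 / lam := by
  have h1 : k ⬝ᵥ T *ᵥ k ≤ G * l1 k := by
    rw [dotProduct_eq_of_support hk hsol]
    refine (le_abs_self _).trans (abs_dotProduct_le fun i hi => hg i ?_)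
    by_contra h
    exact hi (hk i h)
  have h2 := l1_sq_le_card hk
  have h0 := l1_nonneg k
  have hc : (0 : ℝ) ≤ J.card := Nat.cast_nonneg _
  -- `lam ‖k‖₁² ≤ #J · lam ‖k‖₂² ≤ #J · G ‖k‖₁`, and one factor `‖k‖₁` cancels unless it is zero.
  have h3 : l1 k ≤ J.card * G / lam := by
    rw [le_div_iff₀ hlam]
    rcases h0.eq_or_lt with h | h
    · rw [← h, zero_mul]; positivity
    · refine le_of_mul_le_mul_left ?_ h
      have := mul_le_mul_of_nonneg_left (hT.trans h1) hc
      nlinarith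
  refine ⟨h3, h1.trans ?_⟩
  calc G * l1 k ≤ G * (J.card * G / lam) := by gcongr
    _ = _ := by ring

/-- The normal equations on `J` can be solved if the Gram matrix is coercive on `J`. -/
lemma exists_solution {T : Matrix (Fin p) (Fin p) ℝ} {J : Finset (Fin p)} {lam : ℝ}
    (hlam : 0 < lam)
    (hT : ∀ v : Fin p → ℝ, (∀ i ∉ J, v i = 0) → lam * (v ⬝ᵥ v) ≤ v ⬝ᵥ T *ᵥ v)
    (g : Fin p → ℝ) : ∃ k : Fin p → ℝ, (∀ i ∉ J, k i = 0) ∧ ∀ i ∈ J, (T *ᵥ k) i = g i := by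
  classical
  let ext : (J → ℝ) →ₗ[ℝ] (Fin p → ℝ) :=
    { toFun := fun u i => if h : i ∈ J then u ⟨i, h⟩ else 0
      map_add' := fun u v => by ext i; by_cases h : i ∈ J <;> simp [h]
      map_smul' := fun c v => by ext i; by_cases h : i ∈ J <;> simp [h] }
  -- The principal block of `T` on `J`: coercivity makes it injective, finite dimension then makes
  -- it surjective.
  let A : (J → ℝ) →ₗ[ℝ] (J → ℝ) :=
    (LinearMap.funLeft ℝ ℝ (fun a : J => (a : Fin p))) ∘ₗ T.mulVecLin ∘ₗ ext
  have hext : ∀ u, ∀ i ∉ J, ext u i = 0 := fun u i hi => by simp [ext, hi]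
  have hinj : Function.Injective A := by
    rw [injective_iff_map_eq_zero]
    intro u hu
    have h1 : ∀ i ∈ J, (T *ᵥ ext u) i = (0 : Fin p → ℝ) i := fun i hi => by
      have := congrFun hu ⟨i, hi⟩
      simpa [A] using this
    have h2 := hT (ext u) (hext u)
    rw [dotProduct_eq_of_support (hext u) h1, dotProduct_zero] at h2
    have h3 : ext u ⬝ᵥ ext u = 0 := by
      have : 0 ≤ ext u ⬝ᵥ ext u := Finset.sum_nonneg fun i _ => mul_self_nonneg _
      nlinarith
    rw [dotProduct_self_eq_zero] at h3
    ext ⟨i, hi⟩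
    have := congrFun h3 i
    simpa [ext, hi] using this
  obtain ⟨u, hu⟩ := (LinearMap.injective_iff_surjective.1 hinj) (fun a => g a)
  refine ⟨ext u, hext u, fun i hi => ?_⟩
  have := congrFun hu ⟨i, hi⟩
  simpa [A] using this

lemma symm_dotProduct {T : Matrix (Fin p) (Fin p) ℝ} (hT : Tᵀ = T) (u v : Fin p → ℝ) :
    u ⬝ᵥ T *ᵥ v = v ⬝ᵥ T *ᵥ u := by
  rw [Matrix.dotProduct_mulVec, ← Matrix.mulVec_transpose, hT, dotProduct_comm]

lemma quadForm_add {T : Matrix (Fin p) (Fin p) ℝ} (hT : Tᵀ = T) (u v : Fin p → ℝ) :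
    (u + v) ⬝ᵥ T *ᵥ (u + v) = u ⬝ᵥ T *ᵥ u + 2 * (v ⬝ᵥ T *ᵥ u) + v ⬝ᵥ T *ᵥ v := by
  rw [Matrix.mulVec_add, add_dotProduct, dotProduct_add, dotProduct_add, symm_dotProduct hT u v]
  ring

lemma quadForm_sub {T : Matrix (Fin p) (Fin p) ℝ} (hT : Tᵀ = T) (u v : Fin p → ℝ) :
    (u - v) ⬝ᵥ T *ᵥ (u - v) = u ⬝ᵥ T *ᵥ u - 2 * (v ⬝ᵥ T *ᵥ u) + v ⬝ᵥ T *ᵥ v := by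
  rw [Matrix.mulVec_sub, sub_dotProduct, dotProduct_sub, dotProduct_sub, symm_dotProduct hT u v]
  ring

/-- The residual minimizes the criterion among the vectors with the same entries off `J`. -/
lemma IsResidual.quadCrit_le {T : Matrix (Fin p) (Fin p) ℝ} (hT : Tᵀ = T)
    (hpos : ∀ v : Fin p → ℝ, 0 ≤ v ⬝ᵥ T *ᵥ v) {g β r u : Fin p → ℝ} {J : Finset (Fin p)}
    (hr : IsResidual T g β J r) (hu : ∀ i ∉ J, u i = β i) :
    quadCrit T g r ≤ quadCrit T g u := by
  have hd : ∀ i ∉ J, (u - r) i = 0 := fun i hi => by simp [hu i hi, hr.eq_off i hi]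
  have h1 : u = r + (u - r) := by simp
  -- First-order condition: the half-gradient `T r + g` vanishes on `J`, and `u - r` lives on `J`.
  have h2 : (u - r) ⬝ᵥ (T *ᵥ r + g) = 0 := by
    rw [dotProduct_eq_of_support hd (u' := 0) fun i hi => by simpa using hr.normal i hi]
    simp
  have h3 := hpos (u - r)
  rw [dotProduct_add] at h2
  unfold quadCrit
  rw [h1, quadForm_add hT, dotProduct_add, dotProduct_comm g (u - r)]
  nlinarith

/-- Adding the covariate `i` to the model decreases the criterion at least by the squared score. -/
lemma IsResidual.quadCrit_insert_le {T : Matrix (Fin p) (Fin p) ℝ} (hT : Tᵀ = T)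
    (hpos : ∀ v : Fin p → ℝ, 0 ≤ v ⬝ᵥ T *ᵥ v) {g β r r' : Fin p → ℝ} {J : Finset (Fin p)}
    {i : Fin p} (hi : 0 < T i i)
    (hr : IsResidual T g β J r) (hr' : IsResidual T g β (insert i J) r') :
    quadCrit T g r' ≤ quadCrit T g r - ((T *ᵥ r) i + g i) ^ 2 / T i i := by
  classical
  -- The exact line search along coordinate `i`; refitting on the enlarged model can only do better.
  set τ : ℝ := ((T *ᵥ r) i + g i) / T i i with hτ
  have h1 : quadCrit T g r' ≤ quadCrit T g (r - Pi.single i τ) := by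
    refine hr'.quadCrit_le hT hpos fun j hj => ?_
    rw [Finset.mem_insert, not_or] at hj
    simp [hj.1, hr.eq_off j hj.2]
  refine h1.trans (le_of_eq ?_)
  unfold quadCrit
  rw [quadForm_sub hT, dotProduct_sub]
  have h2 : Pi.single i τ ⬝ᵥ T *ᵥ Pi.single i τ = τ ^ 2 * T i i := by
    simp; ring
  rw [h2, single_dotProduct, dotProduct_single, hτ]
  field_simp
  ring

/-- A bound on the `ℓ¹` norms of the noiseless residuals of the coordinates outside `J` passes from
a Gram matrix to a nearby one. -/
lemma exists_noiseless_residual {S T : Matrix (Fin p) (Fin p) ℝ} {ε lam C : ℝ}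
    {J : Finset (Fin p)} (hlam : 0 < lam) (hε : 0 ≤ ε) (hC : 0 ≤ C)
    (hS : ∀ v : Fin p → ℝ, lam * (v ⬝ᵥ v) ≤ v ⬝ᵥ S *ᵥ v)
    (h : ∀ i j, |T i j - S i j| ≤ ε) (hJ : J.card * ε ≤ lam / 2)
    (hreg : ∀ j ∉ J, ∃ u, IsResidual S 0 (Pi.single j 1) J u ∧ l1 u ≤ C) (β : Fin p → ℝ) :
    ∃ v, IsResidual T 0 β J v ∧ l1 v ≤ 2 * C * ∑ j ∈ Jᶜ, |β j| := by
  -- By linearity one unit coordinate outside `J` is treated at a time. The `S`-residual `u`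
  -- violates the `T`-equations on `J` by at most `ε C` per entry, and the correction `k` has `ℓ¹`
  -- norm at most `#J ε C / (lam/2) ≤ C`; hence the factor 2.
  have key : ∀ j, ∃ v, j ∉ J → (IsResidual T 0 (Pi.single j 1) J v ∧ l1 v ≤ 2 * C) := by
    intro j
    by_cases hj : j ∈ J
    · exact ⟨0, fun h => absurd hj h⟩
    obtain ⟨u, hu, huC⟩ := hreg j hj
    have hTc : ∀ v : Fin p → ℝ, (∀ i ∉ J, v i = 0) → lam / 2 * (v ⬝ᵥ v) ≤ v ⬝ᵥ T *ᵥ v :=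
      fun v hv => coercive_of_close hS h hε hJ hv
    obtain ⟨k, hk, hks⟩ := exists_solution (half_pos hlam) hTc (-(T *ᵥ u))
    have hbd : ∀ i ∈ J, |(-(T *ᵥ u)) i| ≤ ε * C := by
      intro i hi
      have h1 : (S *ᵥ u) i = 0 := by simpa using hu.normal i hi
      have h2 : (-(T *ᵥ u)) i = -(((T - S) *ᵥ u) i) := by simp [Matrix.sub_mulVec, h1]
      rw [h2, abs_neg]
      refine (abs_mulVec_le (fun i j => by simpa using h i j) u i).trans ?_
      gcongr
    have h3 := (solution_bounds (half_pos hlam) (by positivity) hk (hTc k hk) hks hbd).1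
    refine ⟨u + k, fun _ => ⟨⟨fun i hi => by simp [hu.eq_off i hi, hk i hi], fun i hi => ?_⟩, ?_⟩⟩
    · simp [Matrix.mulVec_add, hks i hi]
    · refine (l1_add_le _ _).trans ?_
      have h4 : J.card * (ε * C) / (lam / 2) ≤ C := by
        rw [div_le_iff₀ (half_pos hlam)]
        nlinarith
      linarith
  choose v hv using key
  refine ⟨∑ j ∈ Jᶜ, β j • v j, ⟨fun i hi => ?_, fun i hi => ?_⟩, ?_⟩
  · rw [Finset.sum_apply, Finset.sum_eq_single i]
    · simp [(hv i hi).1.eq_off i hi]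
    · intro j hj hji
      rw [Finset.mem_compl] at hj
      simp [(hv j hj).1.eq_off i hi, hji.symm]
    · intro h; exact absurd (Finset.mem_compl.2 hi) h
  · rw [Matrix.mulVec_sum, Finset.sum_apply]
    simp only [Pi.zero_apply, add_zero]
    refine Finset.sum_eq_zero fun j hj => ?_
    rw [Finset.mem_compl] at hj
    have := (hv j hj).1.normal i hi
    rw [Matrix.mulVec_smul]
    simp only [Pi.zero_apply, add_zero] at this
    simp [this]
  · refine (l1_sum_le _ _).trans ?_
    rw [Finset.mul_sum]
    refine Finset.sum_le_sum fun j hj => ?_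
    rw [Finset.mem_compl] at hj
    rw [l1_smul, mul_comm]
    exact mul_le_mul_of_nonneg_right (hv j hj).2 (abs_nonneg _)

/-- Bounds on the residual `r` of a sample least squares problem, in terms of the size `a` of its
bias. -/
structure FitBounds (S T : Matrix (Fin p) (Fin p) ℝ) (g β : Fin p → ℝ) (J : Finset (Fin p))
    (ε lam C : ℝ) (r : Fin p → ℝ) (a : ℝ) : Prop where
  nonneg : 0 ≤ a
  univ : J = Finset.univ → a = 0
  coef : lam * ∑ j ∈ Jᶜ, β j ^ 2 ≤ a + C ^ 2 * ε * (∑ j ∈ Jᶜ, |β j|) ^ 2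
  lower : a - 2 * C * ε * ∑ j ∈ Jᶜ, |β j| - 2 / lam * (J.card * ε ^ 2) ≤ quadCrit T g r
  upper : quadCrit T g r ≤ a + 2 * C * ε * ∑ j ∈ Jᶜ, |β j|
  risk : r ⬝ᵥ S *ᵥ r ≤ 2 * (a + C ^ 2 * ε * (∑ j ∈ Jᶜ, |β j|) ^ 2)
    + 8 / lam * (J.card * ε ^ 2)
  norm : l1 r ≤ C * ∑ j ∈ Jᶜ, |β j| + 1
  corr : a - C * ε * ∑ j ∈ Jᶜ, |β j| ≤ ∑ j ∈ Jᶜ, β j * ((T *ᵥ r) j + g j)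

/-- The residual is `v - k` with `v` noiseless and `k` the fitted noise. These are `T`-orthogonal,
since `k` lives on `J` where `T v` vanishes, so the criterion splits into the bias `a = vᵀTv`, a
cross term `2 gᵀv` of size `ε ‖v‖₁`, and the gain `kᵀTk` from fitting noise, of order `#J ε²`.
Pairing `v` with `T r + g` recovers `a` from the correlations outside `J`. -/
lemma exists_fitBounds {S T : Matrix (Fin p) (Fin p) ℝ} {ε lam C : ℝ} {g β r : Fin p → ℝ}
    {J : Finset (Fin p)} (hlam : 0 < lam) (hε : 0 ≤ ε) (hC : 0 ≤ C)
    (hSs : Sᵀ = S) (hTs : Tᵀ = T)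
    (hS : ∀ v : Fin p → ℝ, lam * (v ⬝ᵥ v) ≤ v ⬝ᵥ S *ᵥ v)
    (hTpos : ∀ v : Fin p → ℝ, 0 ≤ v ⬝ᵥ T *ᵥ v)
    (h : ∀ i j, |T i j - S i j| ≤ ε) (hg : ∀ i, |g i| ≤ ε) (hJ : J.card * ε ≤ lam / 2)
    (hreg : ∀ j ∉ J, ∃ u, IsResidual S 0 (Pi.single j 1) J u ∧ l1 u ≤ C)
    (hr : IsResidual T g β J r) : ∃ a, FitBounds S T g β J ε lam (2 * C) r a := by
  obtain ⟨v, hv, hvC⟩ := exists_noiseless_residual hlam hε hC hS h hJ hreg β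
  set N := ∑ j ∈ Jᶜ, |β j| with hN
  have hvn : ∀ i ∈ J, (T *ᵥ v) i = 0 := fun i hi => by simpa using hv.normal i hi
  set k := v - r with hk
  have hrk : r = v - k := by simp [hk]
  have hk0 : ∀ i ∉ J, k i = 0 := fun i hi => by simp [hk, hv.eq_off i hi, hr.eq_off i hi]
  have hkg : ∀ i ∈ J, (T *ᵥ k) i = g i := fun i hi => by
    rw [hk, Matrix.mulVec_sub, Pi.sub_apply, hvn i hi]
    linarith [hr.normal i hi]
  have hTk : lam / 2 * (k ⬝ᵥ k) ≤ k ⬝ᵥ T *ᵥ k := coercive_of_close hS h hε hJ hk0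
  obtain ⟨hk1, hk2⟩ := solution_bounds (half_pos hlam) hε hk0 hTk hkg fun i _ => hg i
  have hk1' : l1 k ≤ 1 := hk1.trans ((div_le_one (half_pos hlam)).2 hJ)
  have hkTv : k ⬝ᵥ T *ᵥ v = 0 := by
    rw [dotProduct_eq_of_support hk0 (u' := 0) fun i hi => by simp [hvn i hi], dotProduct_zero]
  have hkgT : k ⬝ᵥ T *ᵥ k = k ⬝ᵥ g := dotProduct_eq_of_support hk0 hkg
  have hN0 : 0 ≤ N := Finset.sum_nonneg fun _ _ => abs_nonneg _
  have hgv := abs_le.1 (abs_dotProduct_le (v := v) (g := g) (G := ε) fun i _ => hg i)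
  have hgv' : ε * l1 v ≤ 2 * C * ε * N := by
    calc ε * l1 v ≤ ε * (2 * C * N) := by gcongr
      _ = _ := by ring
  have hq : quadCrit T g r = v ⬝ᵥ T *ᵥ v + 2 * (v ⬝ᵥ g) - k ⬝ᵥ T *ᵥ k := by
    rw [quadCrit, hrk, quadForm_sub hTs, dotProduct_sub, hkTv, dotProduct_comm g v,
      dotProduct_comm g k, ← hkgT]
    ring
  have hvS := abs_le.1 (abs_quadForm_sub_le h v)
  have hl1v := l1_nonneg v
  have hl1 : ε * l1 v ^ 2 ≤ (2 * C) ^ 2 * ε * N ^ 2 := by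
    calc ε * l1 v ^ 2 ≤ ε * (2 * C * N) ^ 2 := by gcongr
      _ = _ := by ring
  have hsq : ∑ j ∈ Jᶜ, β j ^ 2 ≤ v ⬝ᵥ v := by
    unfold dotProduct
    rw [← Finset.sum_add_sum_compl J]
    have h1 : ∑ i ∈ Jᶜ, v i * v i = ∑ j ∈ Jᶜ, β j ^ 2 := Finset.sum_congr rfl fun i hi => by
      rw [hv.eq_off i (Finset.mem_compl.1 hi), sq]
    have h2 : 0 ≤ ∑ i ∈ J, v i * v i := Finset.sum_nonneg fun i _ => mul_self_nonneg _
    linarith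
  have hdiv : J.card * ε ^ 2 / (lam / 2) = 2 / lam * (J.card * ε ^ 2) := by
    rw [div_div_eq_mul_div]; ring
  have hnn : 0 ≤ J.card * ε / (lam / 2) :=
    div_nonneg (mul_nonneg (Nat.cast_nonneg _) hε) (half_pos hlam).le
  refine ⟨v ⬝ᵥ T *ᵥ v, hTpos v, ?_, ?_, ?_, ?_, ?_, ?_, ?_⟩
  · intro hu
    have : ∀ i, (T *ᵥ v) i = (0 : Fin p → ℝ) i := fun i => hvn i (by simp [hu])
    rw [funext this, dotProduct_zero]
  · have h1 := mul_le_mul_of_nonneg_left hsq hlam.le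
    have := hS v
    linarith
  · rw [hq]
    linarith
  · rw [hq]
    have := hTpos k
    linarith
  · have h1 : r ⬝ᵥ S *ᵥ r ≤ 2 * (v ⬝ᵥ S *ᵥ v) + 2 * (k ⬝ᵥ S *ᵥ k) := by
      have h2 := hS (v + k)
      have h3 : 0 ≤ (v + k) ⬝ᵥ (v + k) := Finset.sum_nonneg fun i _ => mul_self_nonneg _
      rw [quadForm_add hSs] at h2
      rw [hrk, quadForm_sub hSs]
      nlinarith
    have hkS := abs_le.1 (abs_quadForm_sub_le h k)
    -- One factor `‖k‖₁` is bounded by 1 and the other by `#J ε / (lam/2)`, which keeps the term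
    -- linear in `#J`.
    have h5 : ε * l1 k ^ 2 ≤ J.card * ε ^ 2 / (lam / 2) := by
      calc ε * l1 k ^ 2 = ε * (l1 k * l1 k) := by ring
        _ ≤ ε * (J.card * ε / (lam / 2) * 1) :=
          mul_le_mul_of_nonneg_left (mul_le_mul hk1 hk1' (l1_nonneg k) hnn) hε
        _ = _ := by ring
    have h6 : 8 / lam * (J.card * ε ^ 2) = 4 * (2 / lam * (J.card * ε ^ 2)) := by ring
    linarith
  · rw [hrk]
    refine (l1_sub_le _ _).trans ?_
    linarith
  · have h1 : v ⬝ᵥ (T *ᵥ r + g) = v ⬝ᵥ T *ᵥ v + v ⬝ᵥ g := by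
      rw [dotProduct_add, hrk, Matrix.mulVec_sub, dotProduct_sub, symm_dotProduct hTs v k, hkTv,
        sub_zero]
    have h2 : v ⬝ᵥ (T *ᵥ r + g) = ∑ j ∈ Jᶜ, β j * ((T *ᵥ r) j + g j) := by
      unfold dotProduct
      rw [← Finset.sum_add_sum_compl J, Finset.sum_eq_zero, zero_add]
      · exact Finset.sum_congr rfl fun i hi => by
          rw [hv.eq_off i (Finset.mem_compl.1 hi), Pi.add_apply]
      · intro i hi
        rw [Pi.add_apply, hr.normal i hi, mul_zero]
    rw [← h2, h1]
    linarith

lemma submatrix_mulVec_apply (S : Matrix (Fin p) (Fin p) ℝ) {J : Finset (Fin p)} {x : Fin p → ℝ}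
    (hx : ∀ i ∉ J, x i = 0) (a : J) :
    (S.submatrix (fun a : J => (a : Fin p)) (fun a : J => (a : Fin p)) *ᵥ fun a : J => x a) a =
      (S *ᵥ x) a := by
  simp only [Matrix.mulVec, dotProduct, Matrix.submatrix_apply]
  rw [Finset.sum_coe_sort J (fun i => S a i * x i)]
  exact Finset.sum_subset (Finset.subset_univ _) fun i _ hi => by simp [hx i hi]

lemma isUnit_det_submatrix_of_coercive {S : Matrix (Fin p) (Fin p) ℝ} {lam : ℝ}
    {J : Finset (Fin p)} (hlam : 0 < lam)
    (hS : ∀ v : Fin p → ℝ, (∀ i ∉ J, v i = 0) → lam * (v ⬝ᵥ v) ≤ v ⬝ᵥ S *ᵥ v) :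
    IsUnit (S.submatrix (fun a : J => (a : Fin p)) (fun a : J => (a : Fin p))).det := by
  classical
  rw [← Matrix.isUnit_iff_isUnit_det, ← Matrix.mulVec_injective_iff_isUnit]
  rw [← Matrix.coe_mulVecLin, injective_iff_map_eq_zero]
  intro u hu
  let x : Fin p → ℝ := fun i => if h : i ∈ J then u ⟨i, h⟩ else 0
  have hx : ∀ i ∉ J, x i = 0 := fun i hi => by simp [x, hi]
  have hxu : (fun a : J => x a) = u := by ext ⟨i, hi⟩; simp [x, hi]
  have h1 : ∀ i ∈ J, (S *ᵥ x) i = (0 : Fin p → ℝ) i := fun i hi => by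
    rw [← submatrix_mulVec_apply S hx ⟨i, hi⟩, hxu]
    exact congrFun hu ⟨i, hi⟩
  have h2 := hS x hx
  rw [dotProduct_eq_of_support hx h1, dotProduct_zero] at h2
  have h3 : x ⬝ᵥ x = 0 := by
    have : 0 ≤ x ⬝ᵥ x := Finset.sum_nonneg fun i _ => mul_self_nonneg _
    nlinarith
  rw [dotProduct_self_eq_zero] at h3
  rw [← hxu, h3]; rfl

/-- The bound on the population regression coefficients in terms of residuals. -/
lemma RegressionBound.exists_residual {S : Matrix (Fin p) (Fin p) ℝ} {K C lam : ℝ} (hC : 0 ≤ C)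
    (hlam : 0 < lam) (hS : ∀ v : Fin p → ℝ, lam * (v ⬝ᵥ v) ≤ v ⬝ᵥ S *ᵥ v)
    (hreg : RegressionBound S K C) {J : Finset (Fin p)} (hJ : (J.card : ℝ) ≤ K) {j : Fin p}
    (hj : j ∉ J) : ∃ u, IsResidual S 0 (Pi.single j 1) J u ∧ l1 u ≤ 1 + C := by
  classical
  have hsingle : l1 (Pi.single j 1 : Fin p → ℝ) = 1 := by
    unfold l1
    rw [Finset.sum_eq_single j] <;> simp +contextual
  rcases J.eq_empty_or_nonempty with rfl | hne
  · exact ⟨Pi.single j 1, ⟨fun _ _ => rfl, by simp⟩, by rw [hsingle]; linarith⟩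
  obtain ⟨k, hk, hks⟩ := exists_solution hlam (J := J) (fun v _ => hS v) (fun i => S i j)
  set A := S.submatrix (fun a : J => (a : Fin p)) (fun a : J => (a : Fin p)) with hA
  have hunit : IsUnit A.det := isUnit_det_submatrix_of_coercive hlam (fun v _ => hS v)
  have hinv : A⁻¹ *ᵥ (fun a : J => S a j) = fun a : J => k a := by
    have : (fun a : J => S a j) = A *ᵥ fun a : J => k a := by
      ext a
      rw [hA, submatrix_mulVec_apply S hk a, hks a a.2]
    rw [this, Matrix.mulVec_mulVec, Matrix.nonsing_inv_mul _ hunit, Matrix.one_mulVec]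
  have hb := hreg J hne.card_pos hJ j hj
  rw [hinv] at hb
  refine ⟨Pi.single j 1 - k, ⟨fun i hi => by simp [hk i hi], fun i hi => ?_⟩, ?_⟩
  · simp [Matrix.mulVec_sub, hks i hi]
  · refine (l1_sub_le _ _).trans ?_
    rw [hsingle]
    gcongr
    refine le_trans (le_of_eq ?_) hb
    rw [Finset.sum_coe_sort J (fun i => |k i|)]
    exact (Finset.sum_subset (Finset.subset_univ _) fun i _ hi => by simp [hk i hi]).symm

/-- A lower bound on the eigenvalues of a symmetric matrix bounds its quadratic form. -/
lemma MinEigenvalueGE.quadForm_ge {S : Matrix (Fin p) (Fin p) ℝ} {c : ℝ} (hSs : Sᵀ = S)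
    (h : MinEigenvalueGE S c) (v : Fin p → ℝ) : c * (v ⬝ᵥ v) ≤ v ⬝ᵥ S *ᵥ v := by
  have hH : (S - c • (1 : Matrix (Fin p) (Fin p) ℝ)).IsHermitian := by
    rw [Matrix.IsHermitian, Matrix.conjTranspose_eq_transpose_of_trivial]
    simp [hSs]
  have hps : (S - c • (1 : Matrix (Fin p) (Fin p) ℝ)).PosSemidef := by
    rw [hH.posSemidef_iff_eigenvalues_nonneg]
    intro i
    have h1 := hH.mulVec_eigenvectorBasis i
    -- Eigenvalues of `S - c I` are those of `S` shifted by `c`, so all of them are nonnegative.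
    have h2 : Module.End.HasEigenvalue (Matrix.toLin' S) (hH.eigenvalues i + c) := by
      refine Module.End.hasEigenvalue_of_hasEigenvector
        (x := (hH.eigenvectorBasis i).ofLp) ⟨?_, ?_⟩
      · rw [Module.End.mem_eigenspace_iff, Matrix.toLin'_apply]
        rw [Matrix.sub_mulVec, Matrix.smul_mulVec, Matrix.one_mulVec] at h1
        rw [add_smul, ← h1]
        simp
      · intro h0
        have := hH.eigenvectorBasis.orthonormal.ne_zero i
        exact this (by ext j; exact congrFun h0 j)
    have := h _ h2
    simp only [Pi.zero_apply]
    linarith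
  have := hps.dotProduct_mulVec_nonneg v
  rw [Matrix.sub_mulVec, Matrix.smul_mulVec, Matrix.one_mulVec, dotProduct_sub,
    dotProduct_smul] at this
  simpa using this

end Quadratic

/-! ### Rate calculations -/

section Rates

/-- A weighted Young inequality. -/
lemma exists_young_const {θ : ℝ} (hθ0 : 0 ≤ θ) (hθ1 : θ < 1) {e : ℝ} (he : 0 < e) :
    ∃ C : ℝ, 0 ≤ C ∧ ∀ δ T : ℝ, 0 ≤ δ → 0 ≤ T → δ ^ (1 - θ) * T ^ θ ≤ e * T + C * δ := by
  have h1 : 0 < 1 - θ := by linarith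
  -- This exponent makes `C ^ (1 - θ) * e ^ θ = 1`, so the constants cancel in the weighted AM–GM
  -- inequality.
  refine ⟨e ^ (-(θ / (1 - θ))), by positivity, fun δ T hδ hT => ?_⟩
  set C := e ^ (-(θ / (1 - θ))) with hC
  have hC0 : 0 < C := by positivity
  have h2 := Real.geom_mean_le_arith_mean2_weighted h1.le hθ0 (p₁ := C * δ) (p₂ := e * T)
    (by positivity) (by positivity) (by ring)
  rw [Real.mul_rpow hC0.le hδ, Real.mul_rpow he.le hT] at h2
  have h3 : C ^ (1 - θ) * e ^ θ = 1 := by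
    rw [hC, ← Real.rpow_mul he.le, ← Real.rpow_add he]
    have : -(θ / (1 - θ)) * (1 - θ) + θ = 0 := by field_simp; ring
    rw [this, Real.rpow_zero]
  have h4 : C ^ (1 - θ) * δ ^ (1 - θ) * (e ^ θ * T ^ θ) = δ ^ (1 - θ) * T ^ θ := by
    calc _ = C ^ (1 - θ) * e ^ θ * (δ ^ (1 - θ) * T ^ θ) := by ring
      _ = _ := by rw [h3, one_mul]
  rw [h4] at h2
  have h5 : (1 - θ) * (C * δ) ≤ 1 * (C * δ) := by gcongr; linarith
  have h6 : θ * (e * T) ≤ 1 * (e * T) := by gcongr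
  linarith

/-- The bounds on a fit, for coefficients with sparsity index `ξ`, where `θ = ξ / (2 ξ + 1)`. -/
structure SparseFitBounds (E c₂ θ δ d : ℝ) (k : ℝ) (Q risk nrm N R a : ℝ) : Prop where
  nonneg : 0 ≤ a
  upper : Q ≤ 2 * a + E * δ
  lower : a / 2 - E * δ - c₂ * (k * d ^ 2) ≤ Q
  risk_le : risk ≤ E * (a + δ + k * d ^ 2)
  norm_le : nrm ≤ E
  corr : a / 2 - E * δ ≤ R
  coef_le : N ≤ E * (a + δ) ^ θ

set_option maxHeartbeats 1000000 in
-- With `t = ∑_{j∉J} β_j²`, sparsity bounds every error term by a multiple of `δ^{1-θ} t^θ`. Young's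
-- inequality splits this into a small multiple of `t`, absorbed by `a` through the lower bound on
-- the eigenvalues, and a multiple of `δ`. The sparsity constants enter only `E`; the coefficient `2
-- D² / lam` of the fitted noise is free of them, and this is why the threshold for `s_a` does not
-- depend on `ξ`.
lemma exists_sparseFitBounds {θ : ℝ} (hθ0 : 0 ≤ θ) (hθ1 : θ < 1) {lam C D Cξ B : ℝ}
    (hlam : 0 < lam) (hC : 0 ≤ C) (hD : 0 ≤ D) (hCξ : 0 ≤ Cξ) (hB : 0 ≤ B) :
    ∃ E : ℝ, 1 ≤ E ∧ ∀ {p : ℕ} (S T : Matrix (Fin p) (Fin p) ℝ) (g β r : Fin p → ℝ)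
      (J : Finset (Fin p)) (a δ : ℝ), 0 ≤ δ →
      FitBounds S T g β J (D * δ ^ (1 - θ)) lam C r a →
      ∑ j ∈ Jᶜ, |β j| ≤ Cξ * (∑ j ∈ Jᶜ, β j ^ 2) ^ θ → ∑ j ∈ Jᶜ, β j ^ 2 ≤ B →
      SparseFitBounds E (2 * D ^ 2 / lam) θ δ (δ ^ (1 - θ)) J.card (quadCrit T g r)
        (r ⬝ᵥ S *ᵥ r) (l1 r) (∑ j ∈ Jᶜ, |β j|) (∑ j ∈ Jᶜ, β j * ((T *ᵥ r) j + g j)) a := by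
  -- `Λ` dominates the coefficients of `d t^θ` in the linear and the quadratic error terms; the
  -- summand 1 allows division by it.
  obtain ⟨Λ, hΛ⟩ : ∃ Λ : ℝ, Λ = 2 * C * D * Cξ + C ^ 2 * D * Cξ ^ 2 * B ^ θ + 1 := ⟨_, rfl⟩
  have hBθ : 0 ≤ B ^ θ := Real.rpow_nonneg hB _
  have hΛ0 : 0 < Λ := by rw [hΛ]; positivity
  obtain ⟨Y, hY0, hY⟩ := exists_young_const hθ0 hθ1 (e := lam / (4 * Λ)) (by positivity)
  obtain ⟨M, hM⟩ : ∃ M : ℝ, M = 2 / lam * (1 + Λ * Y) := ⟨_, rfl⟩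
  have hM0 : 0 ≤ M := by rw [hM]; positivity
  obtain ⟨E, hE⟩ : ∃ E : ℝ, E = 1 + 4 * Λ * Y + Cξ * M ^ θ + (C * Cξ * B ^ θ + 1) + (4 + 8 * D ^ 2 / lam) :=
    ⟨_, rfl⟩
  refine ⟨E, ?_, ?_⟩
  · have : 0 ≤ M ^ θ := Real.rpow_nonneg hM0 _
    have h1 : 0 ≤ 4 * Λ * Y := by positivity
    have h2 : 0 ≤ Cξ * M ^ θ := by positivity
    have h3 : 0 ≤ C * Cξ * B ^ θ + 1 := by positivity
    have h4 : 0 ≤ 4 + 8 * D ^ 2 / lam := by positivity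
    linarith
  intro p S T g β r J a δ hδ hf hN hT
  set N := ∑ j ∈ Jᶜ, |β j| with hNdef
  set t := ∑ j ∈ Jᶜ, β j ^ 2 with ht
  have hMθ : 0 ≤ M ^ θ := Real.rpow_nonneg hM0 _
  have hN0 : 0 ≤ N := Finset.sum_nonneg fun _ _ => abs_nonneg _
  have ht0 : 0 ≤ t := Finset.sum_nonneg fun _ _ => sq_nonneg _
  set d := δ ^ (1 - θ) with hd
  have hd0 : 0 ≤ d := Real.rpow_nonneg hδ _
  have hcoef := hf.coef
  have hlower := hf.lower
  have hupper := hf.upper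
  have hrisk := hf.risk
  have hnorm := hf.norm
  have hcorr := hf.corr
  rw [← hNdef, ← ht] at hcoef
  rw [← hNdef] at hlower hupper hrisk hnorm hcorr
  clear_value d N t
  have htB : t ^ θ ≤ B ^ θ := Real.rpow_le_rpow ht0 hT hθ0
  have htθ : 0 ≤ t ^ θ := Real.rpow_nonneg ht0 _
  have hyoung := hY δ t hδ ht0
  obtain ⟨X, hX⟩ : ∃ X : ℝ, X = d * t ^ θ := ⟨_, rfl⟩
  rw [← hd, ← hX] at hyoung
  have hX0 : 0 ≤ X := by rw [hX]; positivity
  have hΛX : Λ * X ≤ lam / 4 * t + Λ * Y * δ := by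
    calc Λ * X ≤ Λ * (lam / (4 * Λ) * t + Y * δ) := by gcongr
      _ = _ := by field_simp
  have hdN : d * N ≤ Cξ * X := by
    calc d * N ≤ d * (Cξ * t ^ θ) := by gcongr
      _ = _ := by rw [hX]; ring
  -- Of the two factors `t ^ θ` one is kept for Young's inequality and the other is bounded by `B ^
  -- θ`.
  have hdN2 : d * N ^ 2 ≤ Cξ ^ 2 * B ^ θ * X := by
    calc d * N ^ 2 ≤ d * (Cξ * t ^ θ) ^ 2 := by gcongr
      _ = d * t ^ θ * Cξ ^ 2 * t ^ θ := by ring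
      _ ≤ d * t ^ θ * Cξ ^ 2 * B ^ θ := by gcongr
      _ = _ := by rw [hX]; ring
  have h1 : 2 * C * (D * d) * N ≤ Λ * X := by
    have h2 : 2 * C * D * (d * N) ≤ 2 * C * D * (Cξ * X) := by gcongr
    have h3 : 0 ≤ (C ^ 2 * D * Cξ ^ 2 * B ^ θ + 1) * X := by positivity
    calc _ = 2 * C * D * (d * N) := by ring
      _ ≤ 2 * C * D * (Cξ * X) := h2
      _ ≤ 2 * C * D * (Cξ * X) + (C ^ 2 * D * Cξ ^ 2 * B ^ θ + 1) * X := by linarith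
      _ = _ := by rw [hΛ]; ring
  have h2 : C ^ 2 * (D * d) * N ^ 2 ≤ Λ * X := by
    have h2 : C ^ 2 * D * (d * N ^ 2) ≤ C ^ 2 * D * (Cξ ^ 2 * B ^ θ * X) := by gcongr
    have h3 : 0 ≤ (2 * C * D * Cξ + 1) * X := by positivity
    calc _ = C ^ 2 * D * (d * N ^ 2) := by ring
      _ ≤ C ^ 2 * D * (Cξ ^ 2 * B ^ θ * X) := h2
      _ ≤ C ^ 2 * D * (Cξ ^ 2 * B ^ θ * X) + (2 * C * D * Cξ + 1) * X := by linarith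
      _ = _ := by rw [hΛ]; ring
  have h3 : 0 ≤ C * (D * d) * N := by positivity
  have hYδ : 0 ≤ Λ * Y * δ := by positivity
  -- Absorption: Young's inequality was tuned to cost only `lam t / 4`. Reinserting this bound
  -- controls `Λ X` by `a / 2` and `δ`.
  have hT1 : 3 / 4 * (lam * t) ≤ a + Λ * Y * δ := by linarith
  have hX1 : Λ * X ≤ a / 2 + 2 * (Λ * Y * δ) := by linarith [hf.nonneg]
  have ha := hf.nonneg
  have e1 : 0 ≤ 4 * Λ * Y := by positivity
  have e2 : 0 ≤ Cξ * M ^ θ := by positivity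
  have e3 : 0 ≤ C * Cξ * B ^ θ + 1 := by positivity
  have e4 : 0 ≤ 8 * D ^ 2 / lam := by positivity
  have hEY : 4 * (Λ * Y * δ) ≤ E * δ := by
    rw [← mul_assoc, ← mul_assoc]
    gcongr
    linarith
  refine ⟨ha, ?_, ?_, ?_, ?_, ?_, ?_⟩
  · linarith
  · have := hlower
    have h4 : 2 * D ^ 2 / lam * (J.card * d ^ 2) = 2 / lam * (J.card * (D * d) ^ 2) := by ring
    rw [h4]
    linarith
  · have h5 := hrisk
    have h6 : (8 / lam) * (J.card * (D * d) ^ 2) = 8 * D ^ 2 / lam * (J.card * d ^ 2) := by ring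
    have h7 : (0 : ℝ) ≤ J.card * d ^ 2 := by positivity
    have h8 : 4 * a ≤ E * a := by gcongr; linarith
    have h9 : 8 * D ^ 2 / lam * (J.card * d ^ 2) ≤ E * (J.card * d ^ 2) := by gcongr; linarith
    rw [h6] at h5
    have h10 : 4 * (Λ * Y * δ) + 0 ≤ E * δ := by linarith
    calc _ ≤ _ := h5
      _ ≤ 4 * a + E * δ + 8 * D ^ 2 / lam * (J.card * d ^ 2) := by linarith
      _ ≤ E * a + E * δ + E * (J.card * d ^ 2) := by linarith
      _ = _ := by ring
  · have h5 := hnorm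
    have h6 : C * N ≤ C * Cξ * B ^ θ := by
      calc C * N ≤ C * (Cξ * B ^ θ) := by
            gcongr
            exact hN.trans (by gcongr)
        _ = _ := by ring
    linarith
  · have h5 := hcorr
    have : 0 ≤ E * δ := by linarith
    linarith
  · refine hN.trans ?_
    have h5 : t ≤ M * (a + δ) := by
      have h6 : t ≤ 2 / lam * (a + Λ * Y * δ) := by
        rw [div_mul_eq_mul_div, le_div_iff₀ hlam]
        linarith
      refine h6.trans ?_
      rw [hM, mul_assoc (2 / lam)]
      refine mul_le_mul_of_nonneg_left ?_ (show 0 ≤ 2 / lam by positivity)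
      have : 0 ≤ Λ * Y * a := by positivity
      linarith
    have h6 : t ^ θ ≤ M ^ θ * (a + δ) ^ θ := by
      rw [← Real.mul_rpow hM0 (by positivity)]
      exact Real.rpow_le_rpow ht0 h5 hθ0
    calc Cξ * t ^ θ ≤ Cξ * (M ^ θ * (a + δ) ^ θ) := by gcongr
      _ = Cξ * M ^ θ * (a + δ) ^ θ := by ring
      _ ≤ E * (a + δ) ^ θ := by
        gcongr
        linarith

/-- Sequences with `A (m + 1) ≤ A m - c (A m) ^ (1 + s)` decrease like `m ^ (-1 / s)`. -/
lemma recursion_bound {s c : ℝ} (hs : 0 < s) (hs1 : s ≤ 1) (hc : 0 < c) (A : ℕ → ℝ) (N : ℕ)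
    (hpos : ∀ m, 1 ≤ m → m ≤ N → 0 < A m)
    (hrec : ∀ m, 1 ≤ m → m < N → A (m + 1) ≤ A m - c * A m ^ (1 + s)) :
    ∀ m : ℕ, 1 ≤ m → m ≤ N → c * s * ((m : ℝ) - 1) * A m ^ s ≤ 1 := by
  intro m hm
  induction m, hm using Nat.le_induction with
  | base => intro _; simp
  | succ m hm ih =>
    intro hmN
    have ih := ih (by omega)
    have h0 := hpos m hm (by omega)
    have h1 := hpos (m + 1) (by omega) hmN
    have h2 := hrec m hm (by omega)
    set b := A m ^ s with hb
    have hb0 : 0 < b := Real.rpow_pos_of_pos h0 _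
    have h3 : A m ^ (1 + s) = A m * b := by rw [Real.rpow_add h0, Real.rpow_one]
    rw [h3] at h2
    have h4 : A (m + 1) ≤ A m * (1 - c * b) := by linarith
    -- Otherwise `A (m + 1)` would not be positive. This allows Bernoulli's inequality for the
    -- exponent `s ≤ 1` below.
    have h5 : 0 < 1 - c * b := by
      by_contra h
      push Not at h
      nlinarith
    have h6 : A (m + 1) ^ s ≤ b * (1 - s * (c * b)) := by
      calc A (m + 1) ^ s ≤ (A m * (1 - c * b)) ^ s := Real.rpow_le_rpow h1.le h4 hs.le
        _ = b * (1 + -(c * b)) ^ s := by rw [Real.mul_rpow h0.le h5.le, hb]; ring_nf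
        _ ≤ b * (1 + s * -(c * b)) := by
          gcongr
          exact rpow_one_add_le_one_add_mul_self (by linarith) hs.le hs1
        _ = _ := by ring
    have h7 : s * (c * b) ≤ c * b := by
      have : 0 < c * b := by positivity
      nlinarith
    -- The induction hypothesis is `(m - 1) y ≤ 1`, so the new quantity is at most `m y (1 - y) ≤ (1
    -- + y)(1 - y) ≤ 1`.
    set y := c * s * b with hy
    have hy0 : 0 < y := by positivity
    have h8 : ((m : ℝ) - 1) * y ≤ 1 := by rw [hy]; linarith
    have hm1 : (1 : ℝ) ≤ m := by exact_mod_cast hm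
    push_cast
    calc c * s * ((m : ℝ) + 1 - 1) * A (m + 1) ^ s
        ≤ c * s * ((m : ℝ) + 1 - 1) * (b * (1 - s * (c * b))) := by
          have : 0 ≤ c * s * ((m : ℝ) + 1 - 1) := by
            have : (0 : ℝ) ≤ (m : ℝ) + 1 - 1 := by linarith
            positivity
          gcongr
      _ = ((m : ℝ) * y) * (1 - y) := by rw [hy]; ring
      _ ≤ (1 + y) * (1 - y) := by
        have : 0 ≤ 1 - y := by rw [hy]; linarith
        gcongr
        linarith
      _ ≤ 1 := by nlinarith

/-- A number of iterations that balances bias and variance. -/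
lemma exists_iteration_number {θ Mk : ℝ} (hθ0 : 0 ≤ θ) (hθ1 : θ < 1 / 2) (hMk : 0 < Mk) :
    ∀ᶠ δ in 𝓝[>] (0 : ℝ), ∃ N : ℕ, 2 ≤ N ∧ (N : ℝ) ≤ Mk * (δ ^ (1 - θ))⁻¹ ∧
      (N : ℝ) * (δ ^ (1 - θ)) ^ 2 ≤ δ ∧ min 1 Mk / 2 * δ ^ (-(1 - 2 * θ)) ≤ (N : ℝ) - 1 := by
  set M := min 1 Mk with hM
  have hM0 : 0 < M := lt_min one_pos hMk
  have h1 : Tendsto (fun δ : ℝ => M * δ ^ (-(1 - 2 * θ))) (𝓝[>] 0) atTop :=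
    (tendsto_rpow_neg_nhdsGT_zero (by linarith)).const_mul_atTop hM0
  filter_upwards [h1.eventually_ge_atTop 4, self_mem_nhdsWithin,
    eventually_nhdsWithin_of_eventually_nhds (eventually_le_nhds one_pos)] with δ h4 hδ hδ1
  replace hδ : 0 < δ := hδ
  set x := M * δ ^ (-(1 - 2 * θ)) with hx
  have hx0 : 0 ≤ x := by linarith
  have hfl := Nat.floor_le hx0
  have hfl' := Nat.lt_floor_add_one x
  -- `x ≥ 4` gives both `⌊x⌋ ≥ 2` and `⌊x⌋ - 1 ≥ x / 2`. In `M = min 1 Mk` the bound by `Mk`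
  -- respects the cap on the iterations and the bound by 1 controls the variance.
  refine ⟨⌊x⌋₊, Nat.le_floor (by norm_num; linarith), hfl.trans ?_, ?_, by linarith⟩
  · rw [hx, ← Real.rpow_neg hδ.le]
    refine mul_le_mul (min_le_right _ _) ?_ (by positivity) hMk.le
    exact Real.rpow_le_rpow_of_exponent_ge hδ hδ1 (by linarith)
  · calc (⌊x⌋₊ : ℝ) * (δ ^ (1 - θ)) ^ 2 ≤ 1 * δ ^ (-(1 - 2 * θ)) * (δ ^ (1 - θ)) ^ 2 := by
          gcongr
          refine hfl.trans ?_
          rw [hx]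
          gcongr
          exact min_le_left _ _
      _ = δ := by
        rw [one_mul, ← Real.rpow_natCast, ← Real.rpow_mul hδ.le, ← Real.rpow_add hδ]
        have : -(1 - 2 * θ) + (1 - θ) * ((2 : ℕ) : ℝ) = 1 := by push_cast; ring
        rw [this, Real.rpow_one]

/-- The greedy algorithm reaches a bias of order `δ` within a number of iterations for which the
variance is of order `δ`. -/
lemma exists_greedy_bias_le {θ Mk E c₂ G : ℝ} (hθ0 : 0 ≤ θ) (hθ1 : θ < 1 / 2) (hMk : 0 < Mk)
    (hE : 1 ≤ E) (hc₂ : 0 ≤ c₂) (hG : 0 < G) :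
    ∃ B : ℝ, 0 ≤ B ∧ ∀ᶠ δ in 𝓝[>] (0 : ℝ), ∀ (a Q risk nrm N R sc : ℕ → ℝ) (k : ℕ → ℕ),
      (∀ m : ℕ, (m : ℝ) ≤ Mk * (δ ^ (1 - θ))⁻¹ → SparseFitBounds E c₂ θ δ (δ ^ (1 - θ)) (k m) (Q m)
        (risk m) (nrm m) (N m) (R m) (a m)) →
      (∀ m, k m ≤ m) → (∀ m, 0 ≤ sc m) → (∀ m, 0 ≤ N m) →
      (∀ m : ℕ, ((m + 1 : ℕ) : ℝ) ≤ Mk * (δ ^ (1 - θ))⁻¹ →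
        a m ≤ 0 ∨ (R m ≤ N m * sc m * G ∧ Q (m + 1) ≤ Q m - sc m ^ 2)) →
      ∃ m : ℕ, 1 ≤ m ∧ (m : ℝ) ≤ Mk * (δ ^ (1 - θ))⁻¹ ∧ (m : ℝ) * (δ ^ (1 - θ)) ^ 2 ≤ δ ∧
        a m ≤ B * δ := by
  set s : ℝ := 1 - 2 * θ with hs
  have hs0 : 0 < s := by linarith
  -- `576 = 9 · 64`: the score satisfies `a^{1-θ} ≤ 8 E G sc`, and `Q ≤ 3 a` costs at most `3²`
  -- since `1 + s ≤ 2`.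
  set c : ℝ := 1 / (576 * E ^ 2 * G ^ 2) with hc
  have hE0 : 0 < E := by linarith
  have hc0 : 0 < c := by positivity
  set M := min 1 Mk with hM
  have hM0 : 0 < M := lt_min one_pos hMk
  -- Chosen so that `c s (M/2) δ^{-s} · U δ^s = 1`, the value that `recursion_bound` does not allow
  -- to be exceeded.
  set U : ℝ := 2 / (c * s * M) with hU
  have hU0 : 0 < U := by positivity
  set B : ℝ := 4 * (E + c₂) + 4 * U ^ (1 / s) with hB
  have hUs : 0 < U ^ (1 / s) := by positivity
  have hB1 : 4 * (E + c₂) ≤ B := by linarith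
  refine ⟨B, by positivity, ?_⟩
  filter_upwards [exists_iteration_number hθ0 hθ1 hMk, self_mem_nhdsWithin] with δ hex hδ
  replace hδ : 0 < δ := hδ
  obtain ⟨n, hn2, hnK, hnd, hn1⟩ := hex
  intro a Q risk nrm N R sc k hfit hk hsc hN hstep
  -- If the bias stayed above `B δ` at each of the steps `1, …, n`, the recursion would hold
  -- throughout and push `Q n` below a multiple of `δ`, although `Q n ≥ a n / 4`. The recursion
  -- starts at 1, not 0, because the compared models have at least one iteration.
  by_contra hcon
  push Not at hcon
  have hmn : ∀ m : ℕ, m ≤ n → (m : ℝ) ≤ Mk * (δ ^ (1 - θ))⁻¹ := fun m hm =>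
    le_trans (by exact_mod_cast hm) hnK
  have hmd : ∀ m : ℕ, m ≤ n → (m : ℝ) * (δ ^ (1 - θ)) ^ 2 ≤ δ := fun m hm =>
    le_trans (by gcongr) hnd
  have ha : ∀ m, 1 ≤ m → m ≤ n → B * δ < a m := fun m h1 h2 => hcon m h1 (hmn m h2) (hmd m h2)
  have hQlow : ∀ m, 1 ≤ m → m ≤ n → a m / 4 ≤ Q m := by
    intro m h1 h2
    have h3 := (hfit m (hmn m h2)).lower
    have h4 : (k m : ℝ) * (δ ^ (1 - θ)) ^ 2 ≤ δ :=
      le_trans (by gcongr; exact_mod_cast hk m) (hmd m h2)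
    have h5 : c₂ * ((k m : ℝ) * (δ ^ (1 - θ)) ^ 2) ≤ c₂ * δ := by gcongr
    have h6 := ha m h1 h2
    have h7 : 4 * (E + c₂) * δ ≤ B * δ := by gcongr
    linarith
  have ha0 : ∀ m, 1 ≤ m → m ≤ n → 0 < a m := fun m h1 h2 =>
    lt_of_le_of_lt (by positivity) (ha m h1 h2)
  have hQpos : ∀ m, 1 ≤ m → m ≤ n → 0 < Q m := fun m h1 h2 => by
    linarith [ha0 m h1 h2, hQlow m h1 h2]
  have hrec : ∀ m, 1 ≤ m → m < n → Q (m + 1) ≤ Q m - c * Q m ^ (1 + s) := by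
    intro m h1 h2
    have hf := hfit m (hmn m h2.le)
    have ham := ha m h1 h2.le
    have ham0 := ha0 m h1 h2.le
    obtain ⟨hR, hQ⟩ := (hstep m (hmn (m + 1) h2)).resolve_left (not_le.2 ham0)
    have hEδ : 4 * (E * δ) ≤ a m := by
      have h7 : 4 * (E + c₂) * δ ≤ B * δ := by gcongr
      have : 0 ≤ c₂ * δ := by positivity
      linarith
    have hδa : δ ≤ a m := by nlinarith
    have h3 : a m / 4 ≤ N m * sc m * G := by linarith [hf.corr]
    have h4 : N m ≤ 2 * E * a m ^ θ := by
      calc N m ≤ E * (a m + δ) ^ θ := hf.coef_le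
        _ ≤ E * (2 * a m) ^ θ := by gcongr; linarith
        _ = E * (2 ^ θ * a m ^ θ) := by rw [Real.mul_rpow (by norm_num) ham0.le]
        _ ≤ E * (2 ^ (1 : ℝ) * a m ^ θ) := by
          gcongr
          · norm_num
          · linarith
        _ = _ := by rw [Real.rpow_one]; ring
    have h5 : a m ≤ 8 * E * G * a m ^ θ * sc m := by
      have h6 : N m * sc m * G ≤ 2 * E * a m ^ θ * sc m * G := by
        have := hsc m
        gcongr
      linarith
    -- Dividing by `a ^ θ`; squaring then gives the exponent `2 (1 - θ) = 1 + s` of the recursion.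
    have h6 : a m ^ (1 - θ) ≤ 8 * E * G * sc m := by
      have h7 : a m ^ θ * a m ^ (1 - θ) = a m := by
        rw [← Real.rpow_add ham0]; simp
      have h8 : 0 < a m ^ θ := Real.rpow_pos_of_pos ham0 _
      refine le_of_mul_le_mul_left ?_ h8
      rw [h7]
      linarith
    have h7 : a m ^ (1 + s) ≤ 64 * E ^ 2 * G ^ 2 * sc m ^ 2 := by
      have h8 : a m ^ (1 + s) = (a m ^ (1 - θ)) ^ 2 := by
        rw [← Real.rpow_natCast, ← Real.rpow_mul ham0.le]
        congr 1
        rw [hs]; push_cast; ring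
      rw [h8]
      calc (a m ^ (1 - θ)) ^ 2 ≤ (8 * E * G * sc m) ^ 2 := by gcongr
        _ = _ := by ring
    have h8 : Q m ≤ 3 * a m := by linarith [hf.upper]
    have h9 : Q m ^ (1 + s) ≤ 9 * a m ^ (1 + s) := by
      calc Q m ^ (1 + s) ≤ (3 * a m) ^ (1 + s) :=
            Real.rpow_le_rpow (hQpos m h1 h2.le).le h8 (by linarith)
        _ = 3 ^ (1 + s) * a m ^ (1 + s) := Real.mul_rpow (by norm_num) ham0.le
        _ ≤ 3 ^ (2 : ℝ) * a m ^ (1 + s) := by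
          gcongr
          · norm_num
          · linarith
        _ = _ := by norm_num
    have h10 : c * Q m ^ (1 + s) ≤ sc m ^ 2 := by
      rw [hc, one_div, inv_mul_le_iff₀ (by positivity)]
      linarith
    linarith
  have hfin := recursion_bound hs0 (by linarith) hc0 Q n hQpos hrec n (by omega) le_rfl
  have h1 := hQlow n (by omega) le_rfl
  have h2 := ha n (by omega) le_rfl
  have h3 : U ^ (1 / s) * δ < Q n := by
    have : 4 * U ^ (1 / s) * δ ≤ B * δ := by gcongr; linarith
    linarith
  have h4 : U * δ ^ s < Q n ^ s := by
    have := Real.rpow_lt_rpow (by positivity) h3 hs0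
    rwa [Real.mul_rpow hUs.le hδ.le, ← Real.rpow_mul hU0.le, one_div, inv_mul_cancel₀ hs0.ne',
      Real.rpow_one] at this
  have hδs : 0 < δ ^ s := by positivity
  have h5 : 1 ≤ c * s * (M / 2 * δ ^ (-s)) * (U * δ ^ s) := by
    rw [hU, Real.rpow_neg hδ.le]
    apply le_of_eq
    field_simp
  have h6 : c * s * (M / 2 * δ ^ (-s)) * (U * δ ^ s) < c * s * ((n : ℝ) - 1) * Q n ^ s := by
    have : 0 < δ ^ (-s) := by positivity
    refine lt_of_lt_of_le (mul_lt_mul_of_pos_left h4 (by positivity)) ?_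
    have := hQpos n (by omega) le_rfl
    gcongr
  linarith

/-- The minimizer of the penalized criterion balances bias and variance. -/
lemma exists_selection_bound {θ Mk E c₂ s₀ S₁ sa B : ℝ} (hθ1 : θ < 1 / 2)
    (hMk : 0 < Mk) (hE : 1 ≤ E) (hc₂ : 0 ≤ c₂) (hs₀ : 0 < s₀) (hS₁ : 0 ≤ S₁) (hB : 0 ≤ B)
    (hsa : 0 ≤ sa) (hsa' : c₂ + 1 ≤ sa * (s₀ / 2)) :
    ∃ B' : ℝ, 0 ≤ B' ∧ ∀ᶠ δ in 𝓝[>] (0 : ℝ), ∀ (a Q a' Q' sh : ℝ) (k k' : ℕ),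
      0 ≤ a' → (k : ℝ) * (δ ^ (1 - θ)) ^ 2 ≤ δ → Q ≤ 2 * a + E * δ → a ≤ B * δ →
      (k' : ℝ) ≤ Mk * (δ ^ (1 - θ))⁻¹ →
      a' / 2 - E * δ - c₂ * (k' * (δ ^ (1 - θ)) ^ 2) ≤ Q' → s₀ ≤ sh → sh ≤ S₁ →
      (1 + sa * ((k' : ℝ) + 1) * (δ ^ (1 - θ)) ^ 2) * (sh + Q') ≤
        (1 + sa * ((k : ℝ) + 1) * (δ ^ (1 - θ)) ^ 2) * (sh + Q) →
      a' + k' * (δ ^ (1 - θ)) ^ 2 ≤ B' * δ := by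
  have hE0 : 0 < E := by linarith
  refine ⟨2 * (2 * sa * (S₁ + 2 * B + E) + (2 * B + E) + E), by positivity, ?_⟩
  have h1 : Tendsto (fun δ : ℝ => E * δ + c₂ * (Mk * δ ^ (1 - θ))) (𝓝[>] 0) (𝓝 0) := by
    have h2 : ContinuousAt (fun δ : ℝ => E * δ + c₂ * (Mk * δ ^ (1 - θ))) 0 := by
      have : ContinuousAt (fun δ : ℝ => δ ^ (1 - θ)) 0 :=
        Real.continuousAt_rpow_const _ _ (Or.inr (by linarith))
      fun_prop
    have h3 := h2.tendsto
    simp only [mul_zero, Real.zero_rpow (show (1 - θ) ≠ 0 by linarith), add_zero] at h3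
    exact h3.mono_left nhdsWithin_le_nhds
  filter_upwards [h1.eventually (eventually_le_nhds (half_pos hs₀)), self_mem_nhdsWithin,
    eventually_nhdsWithin_of_eventually_nhds (eventually_le_nhds one_pos)] with δ hsm hδ hδ1
  replace hδ : 0 < δ := hδ
  intro a Q a' Q' sh k k' ha' hk hQ ha hk' hQ' hsh hsh' hmin
  set d := δ ^ (1 - θ) with hd
  have hd0 : 0 < d := by positivity
  have hdd : d ^ 2 ≤ δ := by
    calc d ^ 2 = δ ^ (2 * (1 - θ)) := by
          rw [hd, ← Real.rpow_natCast, ← Real.rpow_mul hδ.le]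
          congr 1; push_cast; ring
      _ ≤ δ ^ (1 : ℝ) := Real.rpow_le_rpow_of_exponent_ge hδ hδ1 (by linarith)
      _ = δ := Real.rpow_one _
  have hkd : (k' : ℝ) * d ^ 2 ≤ Mk * d := by
    calc (k' : ℝ) * d ^ 2 ≤ Mk * d⁻¹ * d ^ 2 := by gcongr
      _ = Mk * d := by field_simp
  have hkd0 : 0 ≤ (k' : ℝ) * d ^ 2 := by positivity
  -- Fitted noise lowers the residual variance by at most `c₂ k' d² ≤ c₂ Mk d`, which tends to zero
  -- by the cap on the iterations. Hence overfitting cannot destroy the multiplicative penalty.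
  have hlow : s₀ / 2 ≤ sh + Q' := by
    have : c₂ * ((k' : ℝ) * d ^ 2) ≤ c₂ * (Mk * d) := by gcongr
    linarith
  have hup : (1 + sa * ((k : ℝ) + 1) * d ^ 2) * (sh + Q) ≤
      sh + (2 * sa * (S₁ + 2 * B + E) + (2 * B + E)) * δ := by
    have h2 : sh + Q ≤ sh + (2 * B + E) * δ := by nlinarith
    have h3 : sa * ((k : ℝ) + 1) * d ^ 2 ≤ 2 * sa * δ := by
      calc sa * ((k : ℝ) + 1) * d ^ 2 = sa * (k * d ^ 2 + d ^ 2) := by ring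
        _ ≤ sa * (δ + δ) := by gcongr
        _ = _ := by ring
    calc (1 + sa * ((k : ℝ) + 1) * d ^ 2) * (sh + Q)
        ≤ (1 + sa * ((k : ℝ) + 1) * d ^ 2) * (sh + (2 * B + E) * δ) := by gcongr
      _ ≤ (1 + 2 * sa * δ) * (sh + (2 * B + E) * δ) := by
        have : 0 ≤ sh + (2 * B + E) * δ := by
          have : 0 ≤ (2 * B + E) * δ := by positivity
          linarith
        gcongr
      _ = sh + 2 * sa * δ * (sh + (2 * B + E) * δ) + (2 * B + E) * δ := by ring
      _ ≤ sh + 2 * sa * δ * (S₁ + (2 * B + E) * 1) + (2 * B + E) * δ := by gcongr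
      _ = _ := by ring
  -- The penalty is worth at least `(c₂ + 1) k' d²`: the part `c₂` pays for the fitted noise and the
  -- part 1 remains to bound the model size.
  have hlow2 : sh + a' / 2 - E * δ + k' * d ^ 2 ≤ (1 + sa * ((k' : ℝ) + 1) * d ^ 2) * (sh + Q') := by
    have h2 : sa * (s₀ / 2) * (k' * d ^ 2) ≤ sa * ((k' : ℝ) + 1) * d ^ 2 * (sh + Q') := by
      calc sa * (s₀ / 2) * (k' * d ^ 2) = sa * (k' : ℝ) * d ^ 2 * (s₀ / 2) := by ring
        _ ≤ sa * ((k' : ℝ) + 1) * d ^ 2 * (sh + Q') := by gcongr; linarith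
    have h3 : (c₂ + 1) * (k' * d ^ 2) ≤ sa * (s₀ / 2) * (k' * d ^ 2) := by gcongr
    linarith
  linarith

end Rates

/-! ### Weighted sample moments -/

section SampleMoments

variable {n p : ℕ}

/-- Weighted sample mean. -/
noncomputable def wAvg (w f : Fin n → ℝ) : ℝ := (n : ℝ)⁻¹ * ∑ t, w t * f t

/-- Weighted sample covariance. -/
noncomputable def wCov (w f g : Fin n → ℝ) : ℝ := wAvg w (fun t => f t * g t) - wAvg w f * wAvg w g

lemma wAvg_add (w f g : Fin n → ℝ) :
    wAvg w (fun t => f t + g t) = wAvg w f + wAvg w g := by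
  simp [wAvg, mul_add, Finset.sum_add_distrib]

lemma wAvg_sub (w f g : Fin n → ℝ) :
    wAvg w (fun t => f t - g t) = wAvg w f - wAvg w g := by
  simp [wAvg, mul_sub, Finset.sum_sub_distrib]

lemma wAvg_const_mul (w : Fin n → ℝ) (c : ℝ) (f : Fin n → ℝ) :
    wAvg w (fun t => c * f t) = c * wAvg w f := by
  simp only [wAvg, Finset.mul_sum]
  exact Finset.sum_congr rfl fun t _ => by ring

lemma wAvg_const {w : Fin n → ℝ} (hw : wAvg w (fun _ => 1) = 1) (c : ℝ) :
    wAvg w (fun _ => c) = c := by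
  have := wAvg_const_mul w c (fun _ => 1)
  simpa [hw] using this

lemma wAvg_sum {ι : Type*} (s : Finset ι) (w : Fin n → ℝ) (f : ι → Fin n → ℝ) :
    wAvg w (fun t => ∑ j ∈ s, f j t) = ∑ j ∈ s, wAvg w (f j) := by
  simp only [wAvg, Finset.mul_sum]
  exact Finset.sum_comm

lemma wAvg_nonneg {w f : Fin n → ℝ} (hw : ∀ t, 0 ≤ w t) (hf : ∀ t, 0 ≤ f t) : 0 ≤ wAvg w f :=
  mul_nonneg (by positivity) (Finset.sum_nonneg fun t _ => mul_nonneg (hw t) (hf t))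

lemma wCov_comm (w f g : Fin n → ℝ) : wCov w f g = wCov w g f := by
  simp only [wCov, mul_comm]

lemma wCov_add_left (w f f' g : Fin n → ℝ) :
    wCov w (fun t => f t + f' t) g = wCov w f g + wCov w f' g := by
  simp only [wCov, add_mul, wAvg_add]
  ring

lemma wCov_add_right (w f g g' : Fin n → ℝ) :
    wCov w f (fun t => g t + g' t) = wCov w f g + wCov w f g' := by
  rw [wCov_comm, wCov_add_left, wCov_comm w g, wCov_comm w g']

lemma wCov_const_right {w : Fin n → ℝ} (hw : wAvg w (fun _ => 1) = 1) (f : Fin n → ℝ) (c : ℝ) :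
    wCov w f (fun _ => c) = 0 := by
  have h : (fun t => f t * c) = fun t => c * f t := by ext t; ring
  rw [wCov, h, wAvg_const_mul, wAvg_const hw]
  ring

lemma wCov_linear_left (w : Fin n → ℝ) (x : Fin n → Fin p → ℝ) (r : Fin p → ℝ) (g : Fin n → ℝ) :
    wCov w (fun t => r ⬝ᵥ x t) g = ∑ j, r j * wCov w (fun t => x t j) g := by
  simp only [wCov, dotProduct, Finset.sum_mul, mul_assoc, wAvg_sum, wAvg_const_mul, mul_sub,
    Finset.sum_sub_distrib]

lemma wCov_linear_right (w : Fin n → ℝ) (x : Fin n → Fin p → ℝ) (r : Fin p → ℝ) (g : Fin n → ℝ) :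
    wCov w g (fun t => r ⬝ᵥ x t) = ∑ j, r j * wCov w g (fun t => x t j) := by
  rw [wCov_comm, wCov_linear_left]
  simp only [wCov_comm w g]

/-- The weighted covariance is the weighted mean of the product of centred variables. -/
lemma wAvg_centered_mul (w : Fin n → ℝ) (f g : Fin n → ℝ) :
    wAvg w (fun t => (f t - wAvg w f) * g t) = wCov w f g := by
  simp only [sub_mul, wAvg_sub, wAvg_const_mul]
  rfl

lemma wAvg_centered_sq {w : Fin n → ℝ} (hw : wAvg w (fun _ => 1) = 1) (f : Fin n → ℝ) :
    wAvg w (fun t => (f t - wAvg w f) ^ 2) = wCov w f f := by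
  have h : (fun t => (f t - wAvg w f) ^ 2) =
      fun t => (f t - wAvg w f) * f t - wAvg w f * (f t - wAvg w f) := by ext t; ring
  rw [h, wAvg_sub, wAvg_centered_mul, wAvg_const_mul, wAvg_sub, wAvg_const hw]
  ring

lemma centerW_apply {w : Fin n → ℝ} (hw0 : ∀ t, 0 ≤ w t) (s t : Fin n) :
    centerW w s t = (if s = t then w t else 0) - (n : ℝ)⁻¹ * (w s * w t) := by
  have h1 : ∀ a b, projW w a b = (n : ℝ)⁻¹ * (√(w a) * √(w b)) := by
    intro a b
    simp [projW, sqrtW, Matrix.mul_apply, Matrix.diagonal_apply, Matrix.vecMulVec_apply]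
  have h2 : centerW w s t = √(w s) * ((1 : Matrix _ _ ℝ) s t - projW w s t) * √(w t) := by
    rw [centerW, sqrtW, Matrix.mul_diagonal, Matrix.diagonal_mul, Matrix.sub_apply]
  rw [h2, h1, Matrix.one_apply]
  have hs := Real.mul_self_sqrt (hw0 s)
  have ht := Real.mul_self_sqrt (hw0 t)
  by_cases hst : s = t
  · subst hst
    simp only [if_true]
    linear_combination hs - (n : ℝ)⁻¹ * (√(w s) * √(w s) + w s) * hs
  · simp only [hst, if_false]
    linear_combination -(n : ℝ)⁻¹ * (√(w t) * √(w t)) * hs - (n : ℝ)⁻¹ * w s * ht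

/-- Translates the projection matrices of the definitions into weighted covariances; all later
algebra uses only bilinearity of `wCov`. -/
lemma centerW_form {w : Fin n → ℝ} (hw0 : ∀ t, 0 ≤ w t) (f g : Fin n → ℝ) :
    (n : ℝ)⁻¹ * ∑ t, (∑ s, f s * centerW w s t) * g t = wCov w f g := by
  simp only [centerW_apply hw0, mul_sub, Finset.sum_sub_distrib, mul_ite, mul_zero,
    Finset.sum_ite_eq', Finset.mem_univ, if_true, sub_mul]
  have h : ∑ t, (∑ s, f s * ((n : ℝ)⁻¹ * (w s * w t))) * g t =
      (n : ℝ)⁻¹ * (∑ s, w s * f s) * ∑ t, w t * g t := by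
    rw [Finset.mul_sum]
    refine Finset.sum_congr rfl fun t _ => ?_
    rw [Finset.mul_sum, Finset.sum_mul, Finset.sum_mul]
    exact Finset.sum_congr rfl fun s _ => by ring
  rw [h, wCov, wAvg, wAvg, wAvg]
  have h2 : ∑ t, f t * w t * g t = ∑ t, w t * (f t * g t) :=
    Finset.sum_congr rfl fun t _ => by ring
  rw [h2]
  ring

lemma SigmaHat_apply {w : Fin n → ℝ} (hw0 : ∀ t, 0 ≤ w t) (x : Fin n → Fin p → ℝ) (i j : Fin p) :
    SigmaHat w x i j = wCov w (fun t => x t i) (fun t => x t j) := by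
  rw [← centerW_form hw0]
  simp [SigmaHat, Matrix.mul_apply]

lemma sHat_apply {w : Fin n → ℝ} (hw0 : ∀ t, 0 ≤ w t) (x : Fin n → Fin p → ℝ) (y : Fin n → ℝ)
    (i : Fin p) : sHat w x y i = wCov w (fun t => x t i) y := by
  rw [← centerW_form hw0]
  simp [sHat, Matrix.mul_apply, Matrix.mulVec, dotProduct]

lemma SigmaHat_transpose {w : Fin n → ℝ} (hw0 : ∀ t, 0 ≤ w t) (x : Fin n → Fin p → ℝ) :
    (SigmaHat w x)ᵀ = SigmaHat w x := by
  ext i j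
  rw [Matrix.transpose_apply, SigmaHat_apply hw0, SigmaHat_apply hw0, wCov_comm]

lemma SigmaHat_mulVec {w : Fin n → ℝ} (hw0 : ∀ t, 0 ≤ w t) (x : Fin n → Fin p → ℝ)
    (v : Fin p → ℝ) (i : Fin p) :
    (SigmaHat w x *ᵥ v) i = wCov w (fun t => x t i) (fun t => v ⬝ᵥ x t) := by
  rw [wCov_linear_right]
  simp [Matrix.mulVec, dotProduct, SigmaHat_apply hw0, mul_comm]

lemma SigmaHat_quadForm {w : Fin n → ℝ} (hw0 : ∀ t, 0 ≤ w t) (x : Fin n → Fin p → ℝ)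
    (v : Fin p → ℝ) :
    v ⬝ᵥ SigmaHat w x *ᵥ v = wCov w (fun t => v ⬝ᵥ x t) (fun t => v ⬝ᵥ x t) := by
  rw [wCov_linear_left]
  simp [dotProduct, SigmaHat_mulVec hw0]

lemma SigmaHat_quadForm_nonneg {w : Fin n → ℝ} (hw0 : ∀ t, 0 ≤ w t)
    (hw : wAvg w (fun _ => 1) = 1) (x : Fin n → Fin p → ℝ) (v : Fin p → ℝ) :
    0 ≤ v ⬝ᵥ SigmaHat w x *ᵥ v := by
  rw [SigmaHat_quadForm hw0, ← wAvg_centered_sq hw]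
  exact wAvg_nonneg hw0 fun t => sq_nonneg _

/-- The coefficient vector `β - β̂_J`. -/
noncomputable def coefError (w : Fin n → ℝ) (x : Fin n → Fin p → ℝ) (y : Fin n → ℝ) (β : Fin p → ℝ)
    (J : Finset (Fin p)) (i : Fin p) : ℝ :=
  if h : i ∈ J then β i - betaHat w x y J ⟨i, h⟩ else β i

lemma coefError_dotProduct (w : Fin n → ℝ) (x : Fin n → Fin p → ℝ) (y : Fin n → ℝ)
    (β : Fin p → ℝ) (J : Finset (Fin p)) (z : Fin p → ℝ) :
    coefError w x y β J ⬝ᵥ z = β ⬝ᵥ z - ∑ a : J, betaHat w x y J a * z a := by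
  have h : ∑ a : J, betaHat w x y J a * z a =
      ∑ i, if h : i ∈ J then betaHat w x y J ⟨i, h⟩ * z i else 0 := by
    rw [Finset.sum_dite, Finset.sum_const_zero, add_zero]
    refine Finset.sum_bij' (fun a _ => ⟨a.1, by simp [a.2]⟩)
      (fun b _ => ⟨b.1, by simpa using b.2⟩) ?_ ?_ ?_ ?_ ?_ <;> simp
  rw [h, dotProduct, dotProduct, ← Finset.sum_sub_distrib]
  refine Finset.sum_congr rfl fun i _ => ?_
  by_cases hi : i ∈ J <;> simp [coefError, hi, sub_mul]

variable {w : Fin n → ℝ} {x : Fin n → Fin p → ℝ} {y e : Fin n → ℝ} {α : ℝ} {β : Fin p → ℝ}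

lemma muYHat_eq (hw : wAvg w (fun _ => 1) = 1) (hy : ∀ t, y t = linPred α β (x t) + e t) :
    muYHat w y = α + β ⬝ᵥ muHat w x + wAvg w e := by
  have h1 : muYHat w y = wAvg w y := rfl
  have h2 : y = fun t => (α + ∑ j, β j * x t j) + e t := by
    ext t; rw [hy t]; rfl
  rw [h1, h2, wAvg_add, wAvg_add, wAvg_const hw, wAvg_sum]
  simp only [wAvg_const_mul]
  rfl

/-- The fitted intercept cancels `α` and leaves a centring by weighted means, so that only the slope
error and the mean error matter. -/
lemma linPred_sub_yHat (hw : wAvg w (fun _ => 1) = 1)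
    (hy : ∀ t, y t = linPred α β (x t) + e t) (J : Finset (Fin p)) (z : Fin p → ℝ) :
    linPred α β z - yHat w x y J z =
      coefError w x y β J ⬝ᵥ z - (coefError w x y β J ⬝ᵥ muHat w x + wAvg w e) := by
  rw [coefError_dotProduct, coefError_dotProduct, yHat, alphaHat, muYHat_eq hw hy, linPred]
  ring

lemma residual_eq (hw : wAvg w (fun _ => 1) = 1)
    (hy : ∀ t, y t = linPred α β (x t) + e t) (J : Finset (Fin p)) (t : Fin n) :
    y t - yHat w x y J (x t) = (coefError w x y β J ⬝ᵥ x t + e t) -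
      wAvg w (fun t => coefError w x y β J ⬝ᵥ x t + e t) := by
  have h1 := linPred_sub_yHat hw hy J (x t)
  have h2 : wAvg w (fun t => coefError w x y β J ⬝ᵥ x t) =
      coefError w x y β J ⬝ᵥ muHat w x := by
    simp only [dotProduct, wAvg_sum, wAvg_const_mul]
    rfl
  rw [wAvg_add, h2, hy t]
  linarith

/-- The residual is the centred version of `(β - β̂_J)ᵀ x + e`; expanding its weighted variance
isolates a noise term that all models share, so HDIWIC values can be compared through `quadCrit`. -/
lemma sigmaSqHat_eq (hw0 : ∀ t, 0 ≤ w t) (hw : wAvg w (fun _ => 1) = 1)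
    (hy : ∀ t, y t = linPred α β (x t) + e t) (J : Finset (Fin p)) :
    sigmaSqHat w x y J = wCov w e e +
      quadCrit (SigmaHat w x) (fun i => wCov w (fun t => x t i) e) (coefError w x y β J) := by
  have h1 : sigmaSqHat w x y J = wAvg w (fun t => (y t - yHat w x y J (x t)) ^ 2) := rfl
  simp only [h1, residual_eq hw hy J]
  rw [wAvg_centered_sq hw, wCov_add_left, wCov_add_right, wCov_add_right, quadCrit,
    SigmaHat_quadForm hw0, wCov_comm w e, wCov_linear_left w x _ e]
  simp only [dotProduct, mul_comm]
  ring

lemma greedyScore_eq (hw0 : ∀ t, 0 ≤ w t) (hw : wAvg w (fun _ => 1) = 1)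
    (hy : ∀ t, y t = linPred α β (x t) + e t) (J : Finset (Fin p)) (i : Fin p) :
    greedyScore w x y J i = |(SigmaHat w x *ᵥ coefError w x y β J) i +
      wCov w (fun t => x t i) e| / √(SigmaHat w x i i) := by
  have h1 : (n : ℝ)⁻¹ * ∑ t, w t * (y t - yHat w x y J (x t)) * x t i =
      wAvg w (fun t => (y t - yHat w x y J (x t)) * x t i) := by
    simp only [wAvg, mul_assoc]
  rw [greedyScore, h1]
  simp only [residual_eq hw hy J]
  rw [wAvg_centered_mul, wCov_add_left, SigmaHat_mulVec hw0, wCov_comm w _ (fun t => x t i),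
    wCov_comm w e]

/-- Coercivity on `J` makes the block invertible, so the matrix inverse in `betaHat` really solves
the normal equations; subtracting the true coefficients leaves the noise covariances on the
right-hand side. -/
lemma coefError_isResidual (hw0 : ∀ t, 0 ≤ w t) (hw : wAvg w (fun _ => 1) = 1)
    (hy : ∀ t, y t = linPred α β (x t) + e t) {J : Finset (Fin p)} {lam : ℝ} (hlam : 0 < lam)
    (hT : ∀ v : Fin p → ℝ, (∀ i ∉ J, v i = 0) → lam * (v ⬝ᵥ v) ≤ v ⬝ᵥ SigmaHat w x *ᵥ v) :
    IsResidual (SigmaHat w x) (fun i => wCov w (fun t => x t i) e) β J (coefError w x y β J) := by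
  classical
  set T := SigmaHat w x with hTdef
  set g : Fin p → ℝ := fun i => wCov w (fun t => x t i) e with hg
  have hs : ∀ i, sHat w x y i = (T *ᵥ β) i + g i := by
    intro i
    have h2 : y = fun t => (α + β ⬝ᵥ x t) + e t := by ext t; rw [hy t]; rfl
    rw [sHat_apply hw0, h2, wCov_add_right, wCov_add_right, wCov_const_right hw, zero_add,
      hTdef, SigmaHat_mulVec hw0]
  obtain ⟨k, hk, hks⟩ := exists_solution hlam hT (sHat w x y)
  set A := T.submatrix (fun a : J => (a : Fin p)) (fun a : J => (a : Fin p)) with hA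
  have hunit : IsUnit A.det := isUnit_det_submatrix_of_coercive hlam hT
  have hinv : betaHat w x y J = fun a : J => k a := by
    have : (fun a : J => sHat w x y a) = A *ᵥ fun a : J => k a := by
      ext a
      rw [hA, submatrix_mulVec_apply T hk a, hks a a.2]
    rw [betaHat, this, Matrix.mulVec_mulVec, Matrix.nonsing_inv_mul _ hunit, Matrix.one_mulVec]
  have hr : coefError w x y β J = β - k := by
    ext i
    by_cases hi : i ∈ J
    · simp [coefError, hi, hinv]
    · simp [coefError, hi, hk i hi]
  refine ⟨fun i hi => by simp [coefError, hi], fun i hi => ?_⟩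
  have := hks i hi
  rw [hs i] at this
  rw [hr, Matrix.mulVec_sub, Pi.sub_apply]
  linarith

end SampleMoments

/-! ### The selected model on a sample with well-behaved moments -/

section Deterministic

variable {n p : ℕ}

/-- The input with an additional constant coordinate `x₀ = 1`. -/
def withOne (x : Fin p → ℝ) : Fin (p + 1) → ℝ := Fin.cons 1 x

@[simp] lemma withOne_zero (x : Fin p → ℝ) : withOne x 0 = 1 := rfl

@[simp] lemma withOne_succ (x : Fin p → ℝ) (i : Fin p) : withOne x i.succ = x i := rfl

namespace Population

/-- Second moments of the test input, including the constant coordinate. -/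
noncomputable def moment (M : Population p) (i j : Fin (p + 1)) : ℝ :=
  ∫ x, withOne x i * withOne x j ∂M.inputTe

/-- The test input has second moments bounded by `A`. -/
structure MomentBound (M : Population p) (A : ℝ) : Prop where
  one_le : 1 ≤ A
  memLp : ∀ i : Fin p, MemLp (fun x : Fin p → ℝ => x i) 2 M.inputTe
  moment_le : ∀ i j, |M.moment i j| ≤ A

lemma SigmaTe_apply {M : Population p} {A : ℝ} (h : M.MomentBound A) (i j : Fin p) :
    M.SigmaTe i j = M.moment i.succ j.succ - M.moment 0 i.succ * M.moment 0 j.succ := by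
  rw [SigmaTe, Matrix.of_apply, covariance_eq_sub (h.memLp i) (h.memLp j)]
  simp [moment]

lemma SigmaTe_transpose (M : Population p) : M.SigmaTeᵀ = M.SigmaTe := by
  ext i j
  simp [SigmaTe, covariance_comm]

lemma importance_nonneg (M : Population p) (x : Fin p → ℝ) : 0 ≤ M.importance x :=
  div_nonneg (M.fTe_nonneg x) (M.fTr_nonneg x)

end Population

/-- The mean of the test input. -/
noncomputable def meanTe (M : Population p) (i : Fin p) : ℝ := ∫ x, x i ∂M.inputTe

/-- Second moment equals variance plus squared mean under the test law: the variance is the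
quadratic form in the slope error, the squared mean is the error of the intercept. -/
lemma MCPE_eq {M : Population p} {A : ℝ} (hM : M.MomentBound A) {w : Fin n → ℝ}
    {x : Fin n → Fin p → ℝ} {y e : Fin n → ℝ} {α : ℝ} {β : Fin p → ℝ}
    (hw : wAvg w (fun _ => 1) = 1)
    (hy : ∀ t, y t = linPred α β (x t) + e t) (J : Finset (Fin p)) :
    MCPE M α β w x y J = coefError w x y β J ⬝ᵥ M.SigmaTe *ᵥ coefError w x y β J +
      (coefError w x y β J ⬝ᵥ (meanTe M - muHat w x) - wAvg w e) ^ 2 := by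
  set r := coefError w x y β J with hr
  set κ := r ⬝ᵥ muHat w x + wAvg w e with hκ
  have h0 : MCPE M α β w x y J = ∫ z, (r ⬝ᵥ z - κ) ^ 2 ∂M.inputTe := by
    simp only [MCPE, linPred_sub_yHat hw hy J]
    rfl
  have hmem' : ∀ i, MemLp (fun z : Fin p → ℝ => r i * z i) 2 M.inputTe :=
    fun i => (hM.memLp i).const_mul (r i)
  have hmem : MemLp (fun z : Fin p → ℝ => r ⬝ᵥ z) 2 M.inputTe :=
    memLp_finsetSum _ fun i _ => hmem' i
  have hmem2 : MemLp (fun z : Fin p → ℝ => r ⬝ᵥ z - κ) 2 M.inputTe := hmem.sub (memLp_const κ)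
  have h1 := variance_eq_sub hmem2
  rw [variance_sub_const hmem.aestronglyMeasurable] at h1
  have h2 : Var[fun z : Fin p → ℝ => r ⬝ᵥ z; M.inputTe] = r ⬝ᵥ M.SigmaTe *ᵥ r := by
    rw [← covariance_self hmem.aestronglyMeasurable.aemeasurable]
    have := covariance_fun_sum_fun_sum (μ := M.inputTe) hmem' hmem'
    simp only [dotProduct, Matrix.mulVec]
    rw [this]
    simp only [covariance_const_mul_left, covariance_const_mul_right, Finset.mul_sum]
    refine Finset.sum_congr rfl fun i _ => Finset.sum_congr rfl fun j _ => ?_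
    rw [Population.SigmaTe, Matrix.of_apply]
    ring
  have h3 : ∫ z, (r ⬝ᵥ z - κ) ∂M.inputTe = r ⬝ᵥ meanTe M - κ := by
    rw [integral_sub (hmem.integrable one_le_two) (integrable_const _), integral_const]
    simp only [dotProduct, probReal_univ, one_smul]
    rw [integral_finsetSum _ fun i _ => (hmem' i).integrable one_le_two]
    simp [integral_const_mul, meanTe]
  rw [h2] at h1
  have h4 : ∫ z, (r ⬝ᵥ z - κ) ^ 2 ∂M.inputTe =
      r ⬝ᵥ M.SigmaTe *ᵥ r + (∫ z, (r ⬝ᵥ z - κ) ∂M.inputTe) ^ 2 := by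
    rw [h1]
    simp
  rw [h0, h4, h3, hκ, dotProduct_sub]
  ring

/-- The truncated importances of a sample of inputs. -/
noncomputable def truncWeight (M : Population p) (b : ℝ) (x : Fin n → Fin p → ℝ) (t : Fin n) : ℝ :=
  min (M.importance (x t)) b

/-- A training sample whose truncated importance-weighted moments are close to the moments of the
test population. -/
structure GoodSample (M : Population p) (α : ℝ) (β : Fin p → ℝ) (b : ℝ) (x : Fin n → Fin p → ℝ)
    (y : Fin n → ℝ) (ε s₀ S₁ : ℝ) : Prop where
  input : ∀ i j, |wAvg (truncWeight M b x) (fun t => withOne (x t) i * withOne (x t) j)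
    - M.moment i j| ≤ ε
  noise : ∀ i, |wAvg (truncWeight M b x)
    (fun t => withOne (x t) i * (y t - linPred α β (x t)))| ≤ ε
  lower : s₀ ≤ wAvg (truncWeight M b x) (fun t => (y t - linPred α β (x t)) ^ 2)
  upper : wAvg (truncWeight M b x) (fun t => (y t - linPred α β (x t)) ^ 2) ≤ S₁

/-- The sample moments with normalized weights are close to the moments of the test population. -/
structure GoodWeights (M : Population p) (w : Fin n → ℝ) (x : Fin n → Fin p → ℝ)
    (e : Fin n → ℝ) (ε s₀ S₁ : ℝ) : Prop where
  nonneg : ∀ t, 0 ≤ w t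
  normalized : wAvg w (fun _ => 1) = 1
  gram : ∀ i j, |SigmaHat w x i j - M.SigmaTe i j| ≤ ε
  noise : ∀ i, |wCov w (fun t => x t i) e| ≤ ε
  mean : ∀ i, |meanTe M i - muHat w x i| ≤ ε
  noise_mean : |wAvg w e| ≤ ε
  lower : s₀ ≤ wCov w e e
  upper : wCov w e e ≤ S₁

/-- Cost of normalizing the weights by their mean `u`, from `F/u - m = ((F - m) - m (u - 1)) / u`
and `u ≥ 1/2`. -/
lemma abs_div_sub_le {F u m A ε : ℝ} (hA : 1 ≤ A) (hε : ε ≤ 1 / 2) (hu : |u - 1| ≤ ε)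
    (hF : |F - m| ≤ ε) (hm : |m| ≤ A) : |F / u - m| ≤ 4 * A * ε := by
  have hε0 : 0 ≤ ε := (abs_nonneg _).trans hu
  have hu' := abs_le.1 hu
  have hu0 : 0 < u := by linarith
  have h1 : F / u - m = (F - m - m * (u - 1)) / u := by field_simp; ring
  rw [h1, abs_div, abs_of_pos hu0, div_le_iff₀ hu0]
  calc |F - m - m * (u - 1)| ≤ |F - m| + |m * (u - 1)| := abs_sub _ _
    _ ≤ ε + A * ε := by rw [abs_mul]; gcongr
    _ ≤ 4 * A * ε * (1 / 2) := by nlinarith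
    _ ≤ 4 * A * ε * u := by gcongr; linarith

/-- The mean of the truncated weights is the input moment with both indices 0, hence close to 1. The
factor 20 collects `4 A + 12 A² + 4 A²`, from normalizing the second moment and from the product of
the means. For the variance, normalization leaves `s₀ / 2` and the squared mean error costs at most
`4 ε² ≤ s₀ / 4`. -/
lemma GoodSample.goodWeights {M : Population p} {α : ℝ} {β : Fin p → ℝ} {b : ℝ} (hb : 0 ≤ b)
    {x : Fin n → Fin p → ℝ} {y : Fin n → ℝ} {ε s₀ S₁ A : ℝ} (hM : M.MomentBound A)
    (hε : ε ≤ 1 / 2) (hs : 16 * ε ^ 2 ≤ s₀) (h : GoodSample M α β b x y ε s₀ S₁) :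
    GoodWeights M (sampleWeight M b x) x (fun t => y t - linPred α β (x t))
      (20 * A ^ 2 * ε) (s₀ / 4) (2 * S₁) := by
  set v := truncWeight M b x with hv
  set w := sampleWeight M b x with hw
  set e : Fin n → ℝ := fun t => y t - linPred α β (x t) with he
  set u := wAvg v (fun _ => 1) with hu
  have hA := hM.one_le
  have hu1 : |u - 1| ≤ ε := by
    have := h.input 0 0
    simpa [Population.moment] using this
  have hε0 : 0 ≤ ε := (abs_nonneg _).trans hu1
  have hu' := abs_le.1 hu1
  have hu0 : 0 < u := by linarith
  have hwv : ∀ f : Fin n → ℝ, wAvg w f = wAvg v f / u := by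
    intro f
    have h1 : ∀ t, w t = v t / u := by
      intro t
      simp [hw, hu, hv, sampleWeight, wAvg, truncWeight]
    simp only [wAvg, h1]
    rw [mul_div_assoc, Finset.sum_div]
    congr 1
    exact Finset.sum_congr rfl fun t _ => by ring
  have hv0 : ∀ t, 0 ≤ v t := fun t => le_min (M.importance_nonneg _) hb
  have hw0 : ∀ t, 0 ≤ w t := by
    intro t
    have : w t = v t / u := by simp [hw, hu, hv, sampleWeight, wAvg, truncWeight]
    rw [this]
    exact div_nonneg (hv0 t) hu0.le
  have hmom : ∀ i j, |wAvg w (fun t => withOne (x t) i * withOne (x t) j) - M.moment i j|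
      ≤ 4 * A * ε := by
    intro i j
    rw [hwv]
    exact abs_div_sub_le hA hε hu1 (h.input i j) (hM.moment_le i j)
  have hnoise : ∀ i, |wAvg w (fun t => withOne (x t) i * e t)| ≤ 2 * ε := by
    intro i
    rw [hwv, abs_div, abs_of_pos hu0, div_le_iff₀ hu0]
    refine (h.noise i).trans ?_
    nlinarith
  have hmean : ∀ i : Fin p, |muHat w x i - M.moment 0 i.succ| ≤ 4 * A * ε := by
    intro i
    have := hmom 0 i.succ
    simpa [muHat, wAvg] using this
  have hmoment : ∀ i : Fin p, M.moment 0 i.succ = meanTe M i := by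
    intro i; simp [Population.moment, meanTe]
  have hebar : |wAvg w e| ≤ 2 * ε := by simpa using hnoise 0
  have hAε : 4 * A * ε ≤ 20 * A ^ 2 * ε := mul_le_mul_of_nonneg_right (by nlinarith) hε0
  have h2ε : 2 * ε ≤ 20 * A ^ 2 * ε := mul_le_mul_of_nonneg_right (by nlinarith) hε0
  have hmu3 : ∀ i : Fin p, |muHat w x i| ≤ 3 * A := by
    intro i
    have h1 := abs_le.1 (hmean i)
    have h2 := abs_le.1 (hM.moment_le 0 i.succ)
    rw [abs_le]
    constructor <;> nlinarith
  have hwn : wAvg w (fun _ => 1) = 1 := by rw [hwv]; exact div_self hu0.ne'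
  refine ⟨hw0, hwn, ?_, ?_, ?_, ?_, ?_, ?_⟩
  · intro i j
    rw [SigmaHat_apply hw0, Population.SigmaTe_apply hM, wCov]
    have h1 := hmom i.succ j.succ
    simp only [withOne_succ] at h1
    have h2 : wAvg w (fun t => x t i) = muHat w x i := rfl
    have h3 : wAvg w (fun t => x t j) = muHat w x j := rfl
    rw [h2, h3]
    set P := wAvg w (fun t => x t i * x t j)
    have h4 : P - muHat w x i * muHat w x j -
        (M.moment i.succ j.succ - M.moment 0 i.succ * M.moment 0 j.succ) =
        (P - M.moment i.succ j.succ) - ((muHat w x i - M.moment 0 i.succ) * muHat w x j +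
          M.moment 0 i.succ * (muHat w x j - M.moment 0 j.succ)) := by ring
    rw [h4]
    refine (abs_sub _ _).trans ?_
    have h5 : |(muHat w x i - M.moment 0 i.succ) * muHat w x j +
          M.moment 0 i.succ * (muHat w x j - M.moment 0 j.succ)| ≤
        4 * A * ε * (3 * A) + A * (4 * A * ε) := by
      refine (abs_add_le _ _).trans ?_
      rw [abs_mul, abs_mul]
      gcongr
      · exact hmean i
      · exact hmu3 j
      · exact hM.moment_le _ _
      · exact hmean j
    nlinarith
  · intro i
    rw [wCov]
    have h2 : wAvg w (fun t => x t i) = muHat w x i := rfl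
    rw [h2]
    refine (abs_sub _ _).trans ?_
    rw [abs_mul]
    have h3 := hnoise i.succ
    simp only [withOne_succ] at h3
    have h4 : |muHat w x i| * |wAvg w e| ≤ 3 * A * (2 * ε) := by
      gcongr
      exact hmu3 i
    nlinarith [mul_nonneg (mul_nonneg (by linarith : 0 ≤ A) hε0) (by linarith : 0 ≤ A - 1)]
  · intro i
    rw [← hmoment, abs_sub_comm]
    exact (hmean i).trans hAε
  · exact hebar.trans h2ε
  · have h1 : s₀ / 2 ≤ wAvg w (fun t => e t * e t) := by
      rw [hwv, le_div_iff₀ hu0]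
      have h2 : wAvg v (fun t => e t * e t) = wAvg v (fun t => e t ^ 2) := by simp only [sq]
      rw [h2]
      refine le_trans ?_ h.lower
      have : 0 ≤ s₀ := le_trans (by positivity) hs
      nlinarith
    have h2 : wAvg w e * wAvg w e ≤ 4 * ε ^ 2 := by
      have := sq_le_sq' (abs_le.1 hebar).1 (abs_le.1 hebar).2
      nlinarith
    rw [wCov]
    linarith
  · have h1 : wAvg w (fun t => e t * e t) ≤ 2 * S₁ := by
      rw [hwv, div_le_iff₀ hu0]
      have h2 : wAvg v (fun t => e t * e t) = wAvg v (fun t => e t ^ 2) := by simp only [sq]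
      rw [h2]
      refine h.upper.trans ?_
      have : 0 ≤ S₁ := le_trans (wAvg_nonneg hv0 fun t => sq_nonneg (e t)) h.upper
      nlinarith
    rw [wCov]
    linarith [mul_self_nonneg (wAvg w e)]

/-- The regularity of the population that the rate of the selected model depends on. -/
structure RegularPopulation (M : Population p) (α : ℝ) (β : Fin p → ℝ) (A lam C K ξ Cξ Bβ : ℝ) :
    Prop where
  moments : M.MomentBound A
  eigenvalue : MinEigenvalueGE M.SigmaTe lam
  regression : RegressionBound M.SigmaTe K C
  coef : |α| + √(∑ j, β j ^ 2) ≤ Bβ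
  sparse : ∀ J : Finset (Fin p), J.Nonempty →
    ∑ j ∈ J, |β j| ≤ Cξ * √(∑ j ∈ J, β j ^ 2) ^ (2 * ξ / (2 * ξ + 1))

lemma RegularPopulation.sum_le {M : Population p} {α : ℝ} {β : Fin p → ℝ}
    {A lam C K ξ Cξ Bβ : ℝ} (h : RegularPopulation M α β A lam C K ξ Cξ Bβ) (hCξ : 0 ≤ Cξ)
    (J : Finset (Fin p)) :
    ∑ j ∈ J, |β j| ≤ Cξ * (∑ j ∈ J, β j ^ 2) ^ (ξ / (2 * ξ + 1)) ∧
      ∑ j ∈ J, β j ^ 2 ≤ Bβ ^ 2 := by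
  constructor
  · rcases J.eq_empty_or_nonempty with rfl | hJ
    · simp only [Finset.sum_empty]
      positivity
    · refine (h.sparse J hJ).trans (le_of_eq ?_)
      rw [Real.sqrt_eq_rpow, ← Real.rpow_mul (Finset.sum_nonneg fun _ _ => sq_nonneg _)]
      congr 2
      ring
  · have h1 : ∑ j ∈ J, β j ^ 2 ≤ ∑ j, β j ^ 2 :=
      Finset.sum_le_sum_of_subset_of_nonneg (Finset.subset_univ _) fun _ _ _ => sq_nonneg _
    have h2 : √(∑ j, β j ^ 2) ≤ Bβ := by linarith [h.coef, abs_nonneg α]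
    have h3 := Real.sq_sqrt (show 0 ≤ ∑ j, β j ^ 2 from Finset.sum_nonneg fun _ _ => sq_nonneg _)
    have h4 := Real.sqrt_nonneg (∑ j, β j ^ 2)
    nlinarith

/-- On a good sample, the fit on every model of moderate size satisfies the basic bounds. -/
lemma GoodWeights.exists_fitBounds {M : Population p} {α : ℝ} {β : Fin p → ℝ}
    {A lam C K ξ Cξ Bβ : ℝ} (hM : RegularPopulation M α β A lam C K ξ Cξ Bβ)
    (hlam : 0 < lam) (hC : 0 ≤ C) {w : Fin n → ℝ} {x : Fin n → Fin p → ℝ} {y e : Fin n → ℝ}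
    {ε s₀ S₁ : ℝ} (hε : 0 ≤ ε)
    (hy : ∀ t, y t = linPred α β (x t) + e t) (hw : GoodWeights M w x e ε s₀ S₁)
    {J : Finset (Fin p)} (hJ : (J.card : ℝ) ≤ K) (hKε : K * ε ≤ lam / 2) :
    IsResidual (SigmaHat w x) (fun i => wCov w (fun t => x t i) e) β J (coefError w x y β J) ∧
    ∃ a, FitBounds M.SigmaTe (SigmaHat w x) (fun i => wCov w (fun t => x t i) e) β J ε lam
      (2 * (1 + C)) (coefError w x y β J) a := by
  have hS := hM.eigenvalue.quadForm_ge M.SigmaTe_transpose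
  have hJε : J.card * ε ≤ lam / 2 := le_trans (by gcongr) hKε
  have hr := coefError_isResidual hw.nonneg hw.normalized hy (half_pos hlam) (J := J)
    (fun v hv => coercive_of_close hS hw.gram hε hJε hv)
  refine ⟨hr, ?_⟩
  exact CovShift.exists_fitBounds hlam hε (by linarith) M.SigmaTe_transpose
    (SigmaHat_transpose hw.nonneg x) hS (SigmaHat_quadForm_nonneg hw.nonneg hw.normalized x)
    hw.gram hw.noise hJε (fun j hj => hM.regression.exists_residual hC hlam hS hJ hj) hr

lemma IsIWOGA.card_le {w : Fin n → ℝ} {x : Fin n → Fin p → ℝ} {y : Fin n → ℝ}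
    {J : ℕ → Finset (Fin p)} (h : IsIWOGA w x y J) (m : ℕ) : (J m).card ≤ m := by
  classical
  induction m with
  | zero => simp [h.1]
  | succ m ih =>
    by_cases hu : J m = Finset.univ
    · rw [(h.2 m).2 hu, ← hu]
      omega
    · obtain ⟨i, _, _, h2⟩ := (h.2 m).1 hu
      rw [h2]
      exact (Finset.card_insert_le _ _).trans (by omega)

/-- The risk of the model selected from a greedy run is of the optimal order on good samples. -/
theorem exists_risk_bound {A D lam C s₀ S₁ Mk sa ξ Cξ Bβ : ℝ} (hD : 0 < D) (hA : 1 ≤ A)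
    (hlam : 0 < lam) (hC : 0 ≤ C) (hs₀ : 0 < s₀) (hS₁ : 0 ≤ S₁) (hMk : 0 < Mk)
    (hMk' : Mk * (20 * A ^ 2 * D) ≤ lam / 2) (hsa : 0 ≤ sa)
    (hsa' : 2 * (20 * A ^ 2 * D) ^ 2 / lam + 1 ≤ sa * (s₀ / 4 / 2)) (hξ : 0 ≤ ξ) (hCξ : 0 ≤ Cξ) :
    ∃ B : ℝ, ∀ᶠ d in 𝓝[>] (0 : ℝ), ∀ {n p : ℕ} (M : Population p) (α : ℝ) (β : Fin p → ℝ) (b : ℝ)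
      (x : Fin n → Fin p → ℝ) (y : Fin n → ℝ) (J : ℕ → Finset (Fin p)) (k : ℕ), 0 ≤ b →
      RegularPopulation M α β A lam C (Mk * d⁻¹) ξ Cξ Bβ →
      GoodSample M α β b x y (D * d) s₀ S₁ →
      IsIWOGA (sampleWeight M b x) x y J →
      IsHDIWICMin (sampleWeight M b x) x y sa d (Mk * d⁻¹) J k →
      MCPE M α β (sampleWeight M b x) x y (J k) ≤ B * d ^ ((1 + 2 * ξ) / (1 + ξ)) := by
  set D' := 20 * A ^ 2 * D with hD'
  have hD'0 : 0 < D' := by positivity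
  set θ := ξ / (2 * ξ + 1) with hθ
  have hθ0 : 0 ≤ θ := by positivity
  have hθ1 : θ < 1 / 2 := by
    rw [hθ, div_lt_div_iff₀ (by positivity) two_pos]
    linarith
  obtain ⟨E, hE1, hE⟩ := exists_sparseFitBounds hθ0 (by linarith : θ < 1) hlam
    (show 0 ≤ 2 * (1 + C) by positivity) hD'0.le hCξ (sq_nonneg Bβ)
  have hc₂ : 0 ≤ 2 * D' ^ 2 / lam := by positivity
  obtain ⟨B₁, hB₁, hgreedy⟩ := exists_greedy_bias_le hθ0 hθ1 hMk hE1 hc₂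
    (show 0 < √(A + 1) by positivity)
  obtain ⟨B₂, hB₂, hsel⟩ := exists_selection_bound (S₁ := 2 * S₁) hθ1 hMk hE1 hc₂
    (by positivity : 0 < s₀ / 4) (by positivity) hB₁ hsa hsa'
  -- Links the two parametrizations of the rate: `δ = d ^ ((1 + 2ξ)/(1 + ξ))` satisfies `δ ^ (1 - θ)
  -- = d`.
  have hexp : (1 + 2 * ξ) / (1 + ξ) * (1 - θ) = 1 := by rw [hθ]; field_simp; ring
  have hexp0 : 0 < (1 + 2 * ξ) / (1 + ξ) := by positivity
  have htend : Tendsto (fun d : ℝ => d ^ ((1 + 2 * ξ) / (1 + ξ))) (𝓝[>] 0) (𝓝[>] 0) := by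
    refine tendsto_nhdsWithin_iff.2 ⟨?_, ?_⟩
    · have := (Real.continuousAt_rpow_const 0 ((1 + 2 * ξ) / (1 + ξ)) (Or.inr hexp0.le)).tendsto
      rw [Real.zero_rpow hexp0.ne'] at this
      exact this.mono_left nhdsWithin_le_nhds
    · filter_upwards [self_mem_nhdsWithin] with d hd
      exact Real.rpow_pos_of_pos hd _
  refine ⟨E * (B₂ + 1) + (D' * (E + 1)) ^ 2, ?_⟩
  have hsmall : ∀ c : ℝ, 0 < c → ∀ᶠ d in 𝓝[>] (0 : ℝ), d ≤ c := fun c hc =>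
    eventually_nhdsWithin_of_eventually_nhds (eventually_le_nhds hc)
  filter_upwards [htend.eventually hgreedy, htend.eventually hsel, self_mem_nhdsWithin,
    hsmall Mk hMk, hsmall 1 one_pos, hsmall (1 / (2 * D)) (by positivity),
    hsmall (1 / D') (by positivity), hsmall (√s₀ / (4 * D)) (by positivity)]
    with d hgreedy hsel hd hdMk hd1 hdD hdD' hds
  replace hd : 0 < d := hd
  intro n p M α β b x y J k hb hM hgood hrun hmin
  have hδ0 : 0 < d ^ ((1 + 2 * ξ) / (1 + ξ)) := Real.rpow_pos_of_pos hd _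
  have hδd : (d ^ ((1 + 2 * ξ) / (1 + ξ))) ^ (1 - θ) = d := by
    rw [← Real.rpow_mul hd.le, hexp, Real.rpow_one]
  have hdδ : d ^ 2 ≤ d ^ ((1 + 2 * ξ) / (1 + ξ)) := by
    rw [← Real.rpow_natCast]
    refine Real.rpow_le_rpow_of_exponent_ge hd hd1 ?_
    rw [div_le_iff₀ (by positivity)]
    push_cast; linarith
  set δ := d ^ ((1 + 2 * ξ) / (1 + ξ)) with hδ
  rw [hδd] at hgreedy hsel
  set K := Mk * d⁻¹ with hK
  have hDd : D * d ≤ 1 / 2 := by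
    rw [le_div_iff₀ (by positivity)] at hdD
    linarith
  have hD'd : D' * d ≤ 1 := by
    rw [le_div_iff₀ (by positivity)] at hdD'
    linarith
  have hDs : 16 * (D * d) ^ 2 ≤ s₀ := by
    rw [le_div_iff₀ (by positivity)] at hds
    have h1 := Real.sq_sqrt hs₀.le
    have h2 : (d * (4 * D)) ^ 2 ≤ √s₀ ^ 2 := by gcongr
    nlinarith
  have hw := hgood.goodWeights hb hM.moments hDd hDs
  set w := sampleWeight M b x with hwdef
  set e : Fin n → ℝ := fun t => y t - linPred α β (x t) with he
  have hy : ∀ t, y t = linPred α β (x t) + e t := fun t => by simp [he]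
  have hεD : 20 * A ^ 2 * (D * d) = D' * d := by rw [hD']; ring
  rw [hεD] at hw
  have hKε : K * (D' * d) ≤ lam / 2 := by
    refine le_trans (le_of_eq ?_) hMk'
    rw [hK]; field_simp
  have hε0 : 0 ≤ D' * d := by positivity
  set T := SigmaHat w x with hT
  set g : Fin p → ℝ := fun i => wCov w (fun t => x t i) e with hg
  have hcard : ∀ m : ℕ, (m : ℝ) ≤ K → ((J m).card : ℝ) ≤ K := fun m hm =>
    le_trans (by exact_mod_cast hrun.card_le m) hm
  have hfitJ : ∀ m : ℕ, ∃ a, (m : ℝ) ≤ K →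
      FitBounds M.SigmaTe T g β (J m) (D' * d) lam (2 * (1 + C)) (coefError w x y β (J m)) a := by
    intro m
    by_cases hm : (m : ℝ) ≤ K
    · obtain ⟨a, ha⟩ := (hw.exists_fitBounds hM hlam hC hε0 hy (hcard m hm) hKε).2
      exact ⟨a, fun _ => ha⟩
    · exact ⟨0, fun h => absurd h hm⟩
  choose a ha using hfitJ
  have hsparse : ∀ m : ℕ, (m : ℝ) ≤ K → SparseFitBounds E (2 * D' ^ 2 / lam) θ δ d (J m).card
      (quadCrit T g (coefError w x y β (J m)))
      (coefError w x y β (J m) ⬝ᵥ M.SigmaTe *ᵥ coefError w x y β (J m))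
      (l1 (coefError w x y β (J m))) (∑ j ∈ (J m)ᶜ, |β j|)
      (∑ j ∈ (J m)ᶜ, β j * ((T *ᵥ coefError w x y β (J m)) j + g j)) (a m) := by
    intro m hm
    have h1 := ha m hm
    obtain ⟨h2, h3⟩ := hM.sum_le hCξ (J m)ᶜ
    have := hE M.SigmaTe T g β (coefError w x y β (J m)) (J m) (a m) δ hδ0.le
      (by rw [hδd]; exact h1) h2 h3
    rwa [hδd] at this
  have h1K : 1 ≤ K := by rw [hK, ← div_eq_mul_inv, le_div_iff₀ hd]; linarith
  -- Coercivity on the singleton `{i}`, allowed because `1 ≤ K`, and closeness to the bounded test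
  -- variances; this bounds the normalization in the scores.
  have hdiag : ∀ i, 0 < T i i ∧ T i i ≤ A + 1 := by
    intro i
    have hS := hM.eigenvalue.quadForm_ge M.SigmaTe_transpose
    have h1 := coercive_of_close (J := {i}) hS hw.gram hε0
      (by simp only [Finset.card_singleton, Nat.cast_one]
          exact le_trans (by gcongr) hKε) (v := Pi.single i 1) (fun j hj => by
        simp only [Finset.mem_singleton] at hj
        simp [hj])
    have h2 : (Pi.single i 1 : Fin p → ℝ) ⬝ᵥ Pi.single i 1 = 1 := by simp
    have h3 : (Pi.single i 1 : Fin p → ℝ) ⬝ᵥ T *ᵥ Pi.single i 1 = T i i := by simp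
    rw [h2, h3] at h1
    refine ⟨by linarith, ?_⟩
    have h4 := (abs_le.1 (hw.gram i i)).2
    have h5 := (abs_le.1 (hM.moments.moment_le i.succ i.succ)).2
    rw [Population.SigmaTe_apply hM.moments] at h4
    nlinarith [mul_self_nonneg (M.moment 0 i.succ)]
  -- For the full model no covariate is left to add, but then the bias is zero. Otherwise `ℓ¹`–`ℓ^∞`
  -- duality against the largest score bounds the total correlation.
  have hstep : ∀ m : ℕ, ∃ sc : ℝ, 0 ≤ sc ∧ (((m + 1 : ℕ) : ℝ) ≤ K → a m ≤ 0 ∨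
      ((∑ j ∈ (J m)ᶜ, β j * ((T *ᵥ coefError w x y β (J m)) j + g j)) ≤
        (∑ j ∈ (J m)ᶜ, |β j|) * sc * √(A + 1) ∧
      quadCrit T g (coefError w x y β (J (m + 1))) ≤
        quadCrit T g (coefError w x y β (J m)) - sc ^ 2)) := by
    intro m
    by_cases hu : J m = Finset.univ
    · refine ⟨0, le_rfl, fun hm => Or.inl ?_⟩
      have hm' : (m : ℝ) ≤ K := le_trans (by push_cast; linarith) hm
      exact ((ha m hm').univ hu).le
    obtain ⟨i, hi, himax, hins⟩ := (hrun.2 m).1 hu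
    refine ⟨greedyScore w x y (J m) i, div_nonneg (abs_nonneg _) (Real.sqrt_nonneg _),
      fun hm => Or.inr ⟨?_, ?_⟩⟩
    · rw [Finset.sum_mul, Finset.sum_mul]
      refine Finset.sum_le_sum fun j hj => ?_
      have h1 := himax j (Finset.mem_compl.1 hj)
      rw [greedyScore_eq hw.nonneg hw.normalized hy (J m) j,
        div_le_iff₀ (Real.sqrt_pos.2 (hdiag j).1)] at h1
      have hsc : 0 ≤ greedyScore w x y (J m) i := div_nonneg (abs_nonneg _) (Real.sqrt_nonneg _)
      calc β j * ((T *ᵥ coefError w x y β (J m)) j + g j)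
          ≤ |β j| * |(T *ᵥ coefError w x y β (J m)) j + g j| := by
            rw [← abs_mul]; exact le_abs_self _
        _ ≤ |β j| * (greedyScore w x y (J m) i * √(A + 1)) := by
            gcongr
            refine h1.trans ?_
            gcongr
            exact (hdiag j).2
        _ = _ := by ring
    · have hm' : (m : ℝ) ≤ K := le_trans (by push_cast; linarith) hm
      have hr := (hw.exists_fitBounds hM hlam hC hε0 hy (hcard m hm') hKε).1
      have hr' := (hw.exists_fitBounds hM hlam hC hε0 hy (hcard (m + 1) hm) hKε).1
      rw [hins] at hr' ⊢
      have h1 := hr.quadCrit_insert_le (SigmaHat_transpose hw.nonneg x)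
        (SigmaHat_quadForm_nonneg hw.nonneg hw.normalized x) (hdiag i).1 hr'
      refine h1.trans (le_of_eq ?_)
      rw [greedyScore_eq hw.nonneg hw.normalized hy (J m) i, div_pow, sq_abs,
        Real.sq_sqrt (hdiag i).1.le]
  choose sc hsc0 hsc using hstep
  obtain ⟨m, hm1, hmK, hmd, ham⟩ := hgreedy a _ _ _ _ _ sc (fun m => (J m).card) hsparse
    hrun.card_le hsc0 (fun m => Finset.sum_nonneg fun _ _ => abs_nonneg _) hsc
  obtain ⟨hk1, hkK, hkmin⟩ := hmin
  have hfm := hsparse m hmK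
  have hfk := hsparse k hkK
  have hmin' := hkmin m hm1 hmK
  rw [HDIWIC, HDIWIC, sigmaSqHat_eq hw.nonneg hw.normalized hy,
    sigmaSqHat_eq hw.nonneg hw.normalized hy] at hmin'
  have hcm : ((J m).card : ℝ) * d ^ 2 ≤ δ :=
    le_trans (by gcongr; exact_mod_cast hrun.card_le m) hmd
  have hbal := hsel (a m) _ (a k) _ (wCov w e e) (J m).card (J k).card hfk.nonneg hcm hfm.upper ham
    (hcard k hkK) hfk.lower hw.lower hw.upper hmin'
  rw [MCPE_eq hM.moments hw.normalized hy]
  have hrisk : coefError w x y β (J k) ⬝ᵥ M.SigmaTe *ᵥ coefError w x y β (J k) ≤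
      E * (B₂ + 1) * δ := by
    refine hfk.risk_le.trans ?_
    rw [mul_assoc]
    gcongr
    linarith
  -- The intercept error is of order `d` because the slope error has bounded `ℓ¹` norm, and `d² ≤
  -- δ`.
  have hint : (coefError w x y β (J k) ⬝ᵥ (meanTe M - muHat w x) - wAvg w e) ^ 2 ≤
      (D' * (E + 1)) ^ 2 * δ := by
    have h1 : |coefError w x y β (J k) ⬝ᵥ (meanTe M - muHat w x) - wAvg w e| ≤
        D' * (E + 1) * d := by
      refine (abs_sub _ _).trans ?_
      have h2 := abs_dotProduct_le (v := coefError w x y β (J k)) (g := meanTe M - muHat w x)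
        (G := D' * d) fun i _ => hw.mean i
      have h3 : D' * d * l1 (coefError w x y β (J k)) ≤ D' * d * E := by
        gcongr
        exact hfk.norm_le
      have h4 := hw.noise_mean
      linarith
    calc _ = |coefError w x y β (J k) ⬝ᵥ (meanTe M - muHat w x) - wAvg w e| ^ 2 :=
          (sq_abs _).symm
      _ ≤ (D' * (E + 1) * d) ^ 2 := by gcongr
      _ = (D' * (E + 1)) ^ 2 * d ^ 2 := by ring
      _ ≤ _ := by gcongr
  linarith

/-- The value `d ^ ((1 + 2 ξ) / (1 + ξ))` is the order of the minimum of the bound on the risk. -/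
lemma exists_iterRate_bounds {ξ Mk : ℝ} (hξ : 0 ≤ ξ) (hMk : 0 < Mk) :
    ∃ c C : ℝ, 0 < c ∧ 0 < C ∧ ∀ᶠ d in 𝓝[>] (0 : ℝ),
      (∀ m : ℕ, 1 ≤ m → (m : ℝ) ≤ Mk * d⁻¹ →
        c * d ^ ((1 + 2 * ξ) / (1 + ξ)) ≤ iterRate ξ d m) ∧
      ∃ m : ℕ, 1 ≤ m ∧ (m : ℝ) ≤ Mk * d⁻¹ ∧
        iterRate ξ d m ≤ C * d ^ ((1 + 2 * ξ) / (1 + ξ)) := by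
  set θ := ξ / (2 * ξ + 1) with hθ
  have hθ0 : 0 ≤ θ := by positivity
  have hθ1 : θ < 1 / 2 := by
    rw [hθ, div_lt_div_iff₀ (by positivity) two_pos]
    linarith
  have hexp : (1 + 2 * ξ) / (1 + ξ) * (1 - θ) = 1 := by rw [hθ]; field_simp; ring
  have hexp0 : 0 < (1 + 2 * ξ) / (1 + ξ) := by positivity
  have htend : Tendsto (fun d : ℝ => d ^ ((1 + 2 * ξ) / (1 + ξ))) (𝓝[>] 0) (𝓝[>] 0) := by
    refine tendsto_nhdsWithin_iff.2 ⟨?_, ?_⟩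
    · have := (Real.continuousAt_rpow_const 0 ((1 + 2 * ξ) / (1 + ξ)) (Or.inr hexp0.le)).tendsto
      rw [Real.zero_rpow hexp0.ne'] at this
      exact this.mono_left nhdsWithin_le_nhds
    · filter_upwards [self_mem_nhdsWithin] with d hd
      exact Real.rpow_pos_of_pos hd _
  have hM0 : 0 < min 1 Mk / 2 := half_pos (lt_min one_pos hMk)
  refine ⟨1, (min 1 Mk / 2) ^ (-(1 + 2 * ξ)) + 1, one_pos, by positivity, ?_⟩
  filter_upwards [htend.eventually (exists_iteration_number hθ0 hθ1 hMk), self_mem_nhdsWithin]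
    with d hex hd
  replace hd : 0 < d := hd
  have hδ0 : 0 < d ^ ((1 + 2 * ξ) / (1 + ξ)) := Real.rpow_pos_of_pos hd _
  have hδd : (d ^ ((1 + 2 * ξ) / (1 + ξ))) ^ (1 - θ) = d := by
    rw [← Real.rpow_mul hd.le, hexp, Real.rpow_one]
  set δ := d ^ ((1 + 2 * ξ) / (1 + ξ)) with hδ
  rw [hδd] at hex
  obtain ⟨m, hm2, hmK, hmd, hm1⟩ := hex
  have hpow : (δ ^ (-(1 - 2 * θ))) ^ (-(1 + 2 * ξ)) = δ := by
    rw [← Real.rpow_mul hδ0.le]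
    have : -(1 - 2 * θ) * -(1 + 2 * ξ) = 1 := by rw [hθ]; field_simp; ring
    rw [this, Real.rpow_one]
  have hneg : -(1 + 2 * ξ) ≤ 0 := by linarith
  constructor
  · intro l hl1 _
    have hl0 : (0 : ℝ) < l := by exact_mod_cast hl1
    rw [one_mul, iterRate]
    -- At this crossing point both terms of `iterRate` equal `δ`; below it the bias term is at least
    -- `δ`, above it the variance term.
    rcases le_total (l : ℝ) (δ ^ (-(1 - 2 * θ))) with h | h
    · have h1 := Real.rpow_le_rpow_of_nonpos hl0 h hneg
      rw [hpow] at h1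
      have : 0 ≤ (l : ℝ) * d ^ 2 := by positivity
      linarith
    · have h1 : δ ^ (-(1 - 2 * θ)) * d ^ 2 = δ := by
        rw [← hδd, ← Real.rpow_natCast, ← Real.rpow_mul hδ0.le, ← Real.rpow_add hδ0]
        have : -(1 - 2 * θ) + (1 - θ) * ((2 : ℕ) : ℝ) = 1 := by push_cast; ring
        rw [this, Real.rpow_one]
      have h2 : δ ^ (-(1 - 2 * θ)) * d ^ 2 ≤ l * d ^ 2 := by gcongr
      have h3 : (0 : ℝ) ≤ (l : ℝ) ^ (-(1 + 2 * ξ)) := by positivity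
      linarith
  · refine ⟨m, by omega, hmK, ?_⟩
    have hpos : 0 < min 1 Mk / 2 * δ ^ (-(1 - 2 * θ)) := by positivity
    have h1 : (m : ℝ) ^ (-(1 + 2 * ξ)) ≤ (min 1 Mk / 2) ^ (-(1 + 2 * ξ)) * δ := by
      have h2 := Real.rpow_le_rpow_of_nonpos hpos (show _ ≤ (m : ℝ) by linarith) hneg
      rwa [Real.mul_rpow hM0.le (by positivity), hpow] at h2
    rw [iterRate]
    linarith

end Deterministic

/-! ### Concentration of truncated importance-weighted means -/

section Concentration

/-- A Taylor bound valid for all real `u`; it yields Bernstein-type estimates for unbounded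
variables once `u² e^{|u|}` is integrable. -/
lemma exp_le_one_add_add_sq_mul_exp_abs (u : ℝ) :
    Real.exp u ≤ 1 + u + u ^ 2 * Real.exp |u| := by
  rcases le_total 0 u with h | h
  · rw [abs_of_nonneg h]
    have h1 : 1 - u ≤ Real.exp (-u) := by linarith [Real.add_one_le_exp (-u)]
    have h2 : Real.exp u * Real.exp (-u) = 1 := by rw [← Real.exp_add]; simp
    have h3 : Real.exp u - 1 ≤ u * Real.exp u := by
      nlinarith [Real.exp_pos u]
    nlinarith
  · have h1 : 1 - u ≤ Real.exp (-u) := by linarith [Real.add_one_le_exp (-u)]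
    have h2 : Real.exp u * Real.exp (-u) = 1 := by rw [← Real.exp_add]; simp
    have h3 : Real.exp u * (1 - u) ≤ 1 := by
      nlinarith [Real.exp_pos u]
    have h4 : 1 ≤ Real.exp |u| := Real.one_le_exp (abs_nonneg _)
    have h5 : Real.exp u ≤ 1 + u + u ^ 2 := by
      by_contra hc
      push Not at hc
      nlinarith [mul_lt_mul_of_pos_right hc (by linarith : 0 < 1 - u), sq_nonneg u,
        mul_nonneg (sq_nonneg u) (neg_nonneg.2 h)]
    nlinarith [sq_nonneg u]

variable {𝒵 Ω : Type*} [MeasurableSpace 𝒵] [MeasurableSpace Ω]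

/-- `ν` has density `W` with respect to `μ`. -/
structure IsImportance (μ ν : Measure 𝒵) (W : 𝒵 → ℝ) : Prop where
  measurable : Measurable W
  nonneg : ∀ z, 0 ≤ W z
  eq_withDensity : ν = μ.withDensity fun z => ENNReal.ofReal (W z)

variable {μ ν : Measure 𝒵} {W : 𝒵 → ℝ}

lemma IsImportance.integrable_iff (hW : IsImportance μ ν W) (f : 𝒵 → ℝ) :
    Integrable f ν ↔ Integrable (fun z => W z * f z) μ := by
  rw [hW.eq_withDensity, integrable_withDensity_iff_integrable_smul'
    hW.measurable.ennreal_ofReal (ae_of_all _ fun _ => ENNReal.ofReal_lt_top)]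
  simp only [ENNReal.toReal_ofReal (hW.nonneg _), smul_eq_mul]

lemma IsImportance.integral_eq (hW : IsImportance μ ν W) (f : 𝒵 → ℝ) :
    ∫ z, f z ∂ν = ∫ z, W z * f z ∂μ := by
  rw [hW.eq_withDensity, integral_withDensity_eq_integral_toReal_smul
    hW.measurable.ennreal_ofReal (ae_of_all _ fun _ => ENNReal.ofReal_lt_top)]
  simp only [ENNReal.toReal_ofReal (hW.nonneg _), smul_eq_mul]

lemma IsImportance.integrable_trunc_mul (hW : IsImportance μ ν W) {b : ℝ} (hb : 0 ≤ b)
    {f : 𝒵 → ℝ} (hfm : Measurable f) (hf : Integrable f ν) :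
    Integrable (fun z => min (W z) b * f z) μ := by
  have hWm := hW.measurable
  refine (((hW.integrable_iff f).1 hf).norm).mono' (by fun_prop) (ae_of_all _ fun z => ?_)
  rw [norm_mul, norm_mul, Real.norm_eq_abs, Real.norm_eq_abs (W z),
    abs_of_nonneg (le_min (hW.nonneg z) hb), abs_of_nonneg (hW.nonneg z)]
  gcongr
  exact min_le_left _ _

/-- The bias caused by truncating the importances. -/
lemma IsImportance.abs_integral_trunc_sub_le (hW : IsImportance μ ν W) {b : ℝ} (hb : 0 ≤ b)
    {h U : 𝒵 → ℝ} (hhm : Measurable h) (hh : Integrable h ν) (hU : Integrable U ν)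
    (hU0 : ∀ z, 0 ≤ U z) (hle : ∀ z, b < W z → |h z| ≤ U z) :
    |∫ z, min (W z) b * h z ∂μ - ∫ z, h z ∂ν| ≤ ∫ z, U z ∂ν := by
  rw [hW.integral_eq, hW.integral_eq,
    ← integral_sub (hW.integrable_trunc_mul hb hhm hh) ((hW.integrable_iff h).1 hh)]
  refine (abs_integral_le_integral_abs).trans
    (integral_mono_of_nonneg (ae_of_all _ fun z => abs_nonneg _) ((hW.integrable_iff U).1 hU)
      (ae_of_all _ fun z => ?_))
  have h0 := hW.nonneg z
  change |min (W z) b * h z - W z * h z| ≤ W z * U z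
  rw [← sub_mul, abs_mul]
  rcases le_or_gt (W z) b with hz | hz
  · rw [min_eq_left hz, sub_self, abs_zero, zero_mul]
    exact mul_nonneg h0 (hU0 z)
  · rw [min_eq_right hz.le, abs_of_nonpos (by linarith)]
    refine mul_le_mul (by linarith) (hle z hz) (abs_nonneg _) h0

lemma mgf_le_of_integral_le [IsProbabilityMeasure μ] {φ ψ : 𝒵 → ℝ} {l V : ℝ}
    (hφm : Measurable φ) (hφ : Integrable φ μ) (hψ : Integrable ψ μ)
    (hle : ∀ z, φ z ^ 2 * Real.exp (l * |φ z|) ≤ ψ z) (hV : ∫ z, ψ z ∂μ ≤ V) (hl : 0 ≤ l) :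
    Integrable (fun z => Real.exp (l * φ z)) μ ∧
      mgf φ μ l ≤ Real.exp (l * ∫ z, φ z ∂μ + l ^ 2 * V) := by
  have hpt : ∀ z, Real.exp (l * φ z) ≤ 1 + l * φ z + l ^ 2 * ψ z := by
    intro z
    refine (exp_le_one_add_add_sq_mul_exp_abs _).trans ?_
    rw [abs_mul, abs_of_nonneg hl, mul_pow, mul_assoc]
    gcongr
    exact hle z
  have hint : Integrable (fun z => 1 + l * φ z + l ^ 2 * ψ z) μ :=
    ((integrable_const 1).add (hφ.const_mul l)).add (hψ.const_mul (l ^ 2))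
  refine ⟨hint.mono' (by fun_prop) (ae_of_all _ fun z => ?_), ?_⟩
  · rw [Real.norm_eq_abs, abs_of_pos (Real.exp_pos _)]
    exact hpt z
  · calc mgf φ μ l ≤ ∫ z, (1 + l * φ z + l ^ 2 * ψ z) ∂μ :=
          integral_mono_of_nonneg (ae_of_all _ fun z => (Real.exp_pos _).le) hint
            (ae_of_all _ hpt)
      _ = 1 + l * ∫ z, φ z ∂μ + l ^ 2 * ∫ z, ψ z ∂μ := by
          have h1 : Integrable (fun z => 1 + l * φ z) μ :=
            (integrable_const 1).add (hφ.const_mul l)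
          rw [integral_add h1 (hψ.const_mul (l ^ 2)),
            integral_add (integrable_const 1) (hφ.const_mul l), integral_const_mul,
            integral_const_mul]
          simp
      _ ≤ 1 + l * ∫ z, φ z ∂μ + l ^ 2 * V := by gcongr
      _ ≤ Real.exp (l * ∫ z, φ z ∂μ + l ^ 2 * V) := by
          linarith [Real.add_one_le_exp (l * ∫ z, φ z ∂μ + l ^ 2 * V)]

/-- An independent sample from `μ`. -/
structure IsSample {n : ℕ} (P : Measure Ω) (μ : Measure 𝒵) (Z : Fin n → Ω → 𝒵) : Prop where
  measurable : ∀ t, Measurable (Z t)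
  law : ∀ t, P.map (Z t) = μ
  indep : iIndepFun Z P

variable {n : ℕ} {P : Measure Ω} [IsProbabilityMeasure P] [IsProbabilityMeasure μ]
  {Z : Fin n → Ω → 𝒵}

lemma IsSample.chernoff (hZ : IsSample P μ Z) {φ ψ : 𝒵 → ℝ} {l V : ℝ}
    (hφm : Measurable φ) (hφ : Integrable φ μ) (hψ : Integrable ψ μ)
    (hle : ∀ z, φ z ^ 2 * Real.exp (l * |φ z|) ≤ ψ z) (hV : ∫ z, ψ z ∂μ ≤ V) (hl : 0 ≤ l)
    (τ : ℝ) :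
    P.real {ω | n * (∫ z, φ z ∂μ) + n * τ ≤ ∑ t, φ (Z t ω)} ≤
      Real.exp (n * (l ^ 2 * V) - l * (n * τ)) := by
  obtain ⟨hint, hmgf⟩ := mgf_le_of_integral_le hφm hφ hψ hle hV hl
  have hem : Measurable fun z => Real.exp (l * φ z) := by fun_prop
  set X : Fin n → Ω → ℝ := fun t ω => φ (Z t ω) with hX
  have hXm : ∀ t, Measurable (X t) := fun t => hφm.comp (hZ.measurable t)
  have hXi : iIndepFun X P := hZ.indep.comp (fun _ => φ) fun _ => hφm
  have hXint : ∀ t ∈ Finset.univ, Integrable (fun ω => Real.exp (l * X t ω)) P := by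
    intro t _
    have h := hint
    rw [← hZ.law t, integrable_map_measure hem.aestronglyMeasurable
      (hZ.measurable t).aemeasurable] at h
    exact h
  have hXmgf : ∀ t, mgf (X t) P l = mgf φ μ l := by
    intro t
    rw [mgf, mgf, ← hZ.law t, integral_map (hZ.measurable t).aemeasurable
      hem.aestronglyMeasurable]
  have h1 := measure_ge_le_exp_mul_mgf (X := ∑ t, X t) (μ := P)
    (n * (∫ z, φ z ∂μ) + n * τ) hl (hXi.integrable_exp_mul_sum hXm hXint)
  rw [hXi.mgf_sum hXm, Finset.prod_congr rfl fun t _ => hXmgf t, Finset.prod_const,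
    Finset.card_univ, Fintype.card_fin] at h1
  have h2 : {ω | n * (∫ z, φ z ∂μ) + n * τ ≤ ∑ t, φ (Z t ω)} =
      {ω | n * (∫ z, φ z ∂μ) + n * τ ≤ (∑ t, X t) ω} := by
    ext ω; simp [hX]
  rw [h2]
  refine h1.trans ?_
  calc _ ≤ Real.exp (-l * (n * (∫ z, φ z ∂μ) + n * τ)) *
        Real.exp (l * ∫ z, φ z ∂μ + l ^ 2 * V) ^ n := by
        have : 0 ≤ mgf φ μ l := mgf_nonneg
        gcongr
    _ = _ := by
        rw [← Real.exp_nat_mul, ← Real.exp_add]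
        congr 1
        ring

lemma IsSample.chernoff_abs (hZ : IsSample P μ Z) (hn : 0 < n) {φ ψ : 𝒵 → ℝ} {l V : ℝ}
    (hφm : Measurable φ) (hφ : Integrable φ μ) (hψ : Integrable ψ μ)
    (hle : ∀ z, φ z ^ 2 * Real.exp (l * |φ z|) ≤ ψ z) (hV : ∫ z, ψ z ∂μ ≤ V) (hl : 0 ≤ l)
    (τ : ℝ) :
    P.real {ω | τ ≤ |(n : ℝ)⁻¹ * ∑ t, φ (Z t ω) - ∫ z, φ z ∂μ|} ≤
      2 * Real.exp (n * (l ^ 2 * V) - l * (n * τ)) := by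
  have h1 := hZ.chernoff hφm hφ hψ hle hV hl τ
  have h2 := hZ.chernoff (φ := fun z => -φ z) hφm.neg hφ.neg hψ
    (by simpa using hle) hV hl τ
  have hn0 : (0 : ℝ) < n := by exact_mod_cast hn
  have hsub : {ω | τ ≤ |(n : ℝ)⁻¹ * ∑ t, φ (Z t ω) - ∫ z, φ z ∂μ|} ⊆
      {ω | n * (∫ z, φ z ∂μ) + n * τ ≤ ∑ t, φ (Z t ω)} ∪
      {ω | n * (∫ z, -φ z ∂μ) + n * τ ≤ ∑ t, -φ (Z t ω)} := by
    intro ω hω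
    simp only [Set.mem_ofPred_eq, Set.mem_union] at hω ⊢
    rw [integral_neg, Finset.sum_neg_distrib]
    have h3 : ∑ t, φ (Z t ω) = n * ((n : ℝ)⁻¹ * ∑ t, φ (Z t ω)) := by field_simp
    rw [h3]
    rcases le_abs.1 hω with h | h
    · left; nlinarith
    · right; nlinarith
  calc _ ≤ _ := measureReal_mono hsub
    _ ≤ _ := measureReal_union_le _ _
    _ ≤ _ := by linarith

/-- Deviation of a truncated importance-weighted mean from a test expectation. -/
lemma IsSample.trunc_deviation [IsProbabilityMeasure ν] (hZ : IsSample P μ Z) (hn : 0 < n)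
    (hW : IsImportance μ ν W) {b l V : ℝ} (hb : 0 ≤ b) (hl : 0 ≤ l) {h F : 𝒵 → ℝ}
    (hhm : Measurable h) (hh : Integrable h ν)
    (hF : Integrable (fun z => min (W z) b * F z ^ 2) ν)
    (hle : ∀ z, h z ^ 2 * Real.exp (l * (min (W z) b * |h z|)) ≤ F z ^ 2)
    (hV : ∫ z, min (W z) b * F z ^ 2 ∂ν ≤ V) (τ : ℝ) :
    P.real {ω | τ ≤ |(n : ℝ)⁻¹ * ∑ t, min (W (Z t ω)) b * h (Z t ω) -
      ∫ z, min (W z) b * h z ∂μ|} ≤ 2 * Real.exp (n * (l ^ 2 * V) - l * (n * τ)) := by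
  have hWm := hW.measurable
  have hv0 : ∀ z, 0 ≤ min (W z) b := fun z => le_min (hW.nonneg z) hb
  -- Of the two factors `min (W z) b` in the square one is replaced by `W z`, so the second-order
  -- term becomes an integral under the test law `ν`.
  refine hZ.chernoff_abs hn (φ := fun z => min (W z) b * h z)
    (ψ := fun z => W z * (min (W z) b * F z ^ 2)) (by fun_prop)
    (hW.integrable_trunc_mul hb hhm hh) ((hW.integrable_iff _).1 hF) (fun z => ?_) ?_ hl τ
  · have h1 := hv0 z
    rw [abs_mul, abs_of_nonneg h1]
    calc (min (W z) b * h z) ^ 2 * Real.exp (l * (min (W z) b * |h z|))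
        = min (W z) b * (min (W z) b *
          (h z ^ 2 * Real.exp (l * (min (W z) b * |h z|)))) := by ring
      _ ≤ W z * (min (W z) b * F z ^ 2) := by
        gcongr
        · exact hW.nonneg z
        · exact min_le_left _ _
        · exact hle z
  · rwa [← hW.integral_eq]

end Concentration

/-! ### Envelopes -/

section TailMajorant

variable {𝒵 : Type*} {F : 𝒵 → ℝ} {G : Set 𝒵} {N : ℝ}

/-- The majorant of the envelope and of its square outside of the event `G`. -/
noncomputable def tailMajorant (F : 𝒵 → ℝ) (G : Set 𝒵) (N : ℝ) (z : 𝒵) : ℝ :=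
  F z ^ (4 : ℕ) / N + N * Set.indicator Gᶜ 1 z

lemma tailMajorant_nonneg (hN : 0 < N) (z : 𝒵) : 0 ≤ tailMajorant F G N z := by
  unfold tailMajorant
  have : (0 : ℝ) ≤ Set.indicator Gᶜ 1 z := Set.indicator_nonneg (fun _ _ => zero_le_one) _
  positivity

/-- AM–GM for `F⁴/N` and `N`. This form is used since a fourth moment and `ν Gᶜ = O(N⁻²)` make the
majorant integrate to `O(1/N)`. -/
lemma sq_le_tailMajorant (hN : 0 < N) {z : 𝒵} (hz : z ∉ G) : F z ^ 2 ≤ tailMajorant F G N z := by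
  rw [tailMajorant, Set.indicator_of_mem (by simpa using hz), Pi.one_apply, mul_one,
    div_add' _ _ _ hN.ne', le_div_iff₀ hN]
  nlinarith [sq_nonneg (F z ^ 2 - N), sq_nonneg (F z ^ 2), sq_nonneg N]

lemma le_tailMajorant (hN : 1 ≤ N) {z : 𝒵} (hz : z ∉ G) : F z ≤ tailMajorant F G N z := by
  have h0 : 0 < N := by linarith
  rw [tailMajorant, Set.indicator_of_mem (by simpa using hz), Pi.one_apply, mul_one]
  rcases le_total (F z) N with h | h
  · have : 0 ≤ F z ^ 4 / N := by positivity
    linarith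
  · have h1 : F z ≤ F z ^ 4 / N := by
      rw [le_div_iff₀ h0]
      have hF : 1 ≤ F z := hN.trans h
      calc F z * N ≤ F z * F z := by gcongr
        _ = F z ^ 2 := by ring
        _ ≤ F z ^ 4 := pow_le_pow_right₀ hF (by norm_num)
    linarith

end TailMajorant

section Envelopes

variable {𝒵 Ω : Type*} [MeasurableSpace 𝒵] [MeasurableSpace Ω]

/-- A function `F` with bounded `s`-th moment that is at most `H` outside of an event of probability
of order `N⁻²`. -/
structure Envelope (ν : Measure 𝒵) (F : 𝒵 → ℝ) (G : Set 𝒵) (H C N s : ℝ) : Prop where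
  measurable : Measurable F
  nonneg : ∀ z, 0 ≤ F z
  measurableSet : MeasurableSet G
  le_of_mem : ∀ z ∈ G, F z ≤ H
  integrable : Integrable (fun z => F z ^ s) ν
  integral_le : ∫ z, F z ^ s ∂ν ≤ C
  compl_le : ν.real Gᶜ ≤ C / N ^ 2

lemma rpow_le_one_add_rpow {x a s : ℝ} (hx : 0 ≤ x) (ha : 0 ≤ a) (has : a ≤ s) :
    x ^ a ≤ 1 + x ^ s := by
  rcases le_total x 1 with h | h
  · have := Real.rpow_le_one hx h ha
    have : 0 ≤ x ^ s := Real.rpow_nonneg hx _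
    linarith
  · have := Real.rpow_le_rpow_of_exponent_le h has
    linarith

variable {ν : Measure 𝒵} [IsProbabilityMeasure ν] {F : 𝒵 → ℝ} {G : Set 𝒵} {H C N s : ℝ}

namespace Envelope

lemma rpow_integrable (hF : Envelope ν F G H C N s) {a : ℝ} (ha : 0 ≤ a) (has : a ≤ s) :
    Integrable (fun z => F z ^ a) ν ∧ ∫ z, F z ^ a ∂ν ≤ 1 + C := by
  have hFm := hF.measurable
  have hint : Integrable (fun z => 1 + F z ^ s) ν := (integrable_const 1).add hF.integrable
  have hle : ∀ z, F z ^ a ≤ 1 + F z ^ s := fun z => rpow_le_one_add_rpow (hF.nonneg z) ha has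
  constructor
  · refine hint.mono' (by fun_prop) (ae_of_all _ fun z => ?_)
    rw [Real.norm_eq_abs, abs_of_nonneg (Real.rpow_nonneg (hF.nonneg z) _)]
    exact hle z
  · refine (integral_mono_of_nonneg (ae_of_all _ fun z => Real.rpow_nonneg (hF.nonneg z) _) hint
      (ae_of_all _ hle)).trans ?_
    rw [integral_add (integrable_const 1) hF.integrable]
    simpa using hF.integral_le

lemma pow_integrable (hF : Envelope ν F G H C N s) (k : ℕ) (hk : (k : ℝ) ≤ s) :
    Integrable (fun z => F z ^ k) ν ∧ ∫ z, F z ^ k ∂ν ≤ 1 + C := by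
  have := hF.rpow_integrable (Nat.cast_nonneg k) hk
  simpa only [Real.rpow_natCast] using this

lemma tailMajorant_integrable (hF : Envelope ν F G H C N s) (hs : 4 ≤ s) (hN : 0 < N) :
    Integrable (tailMajorant F G N) ν ∧ ∫ z, tailMajorant F G N z ∂ν ≤ (1 + 2 * C) / N := by
  obtain ⟨h1, h2⟩ := hF.pow_integrable 4 (by exact_mod_cast hs)
  have h3 : Integrable (fun z => N * Set.indicator Gᶜ (1 : 𝒵 → ℝ) z) ν :=
    ((integrable_const (1 : ℝ)).indicator hF.measurableSet.compl).const_mul N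
  refine ⟨(h1.div_const N).add h3, ?_⟩
  have h4 : ∫ z, tailMajorant F G N z ∂ν = (∫ z, F z ^ 4 ∂ν) / N + N * ν.real Gᶜ := by
    simp only [tailMajorant]
    rw [integral_add (h1.div_const N) h3, integral_div, integral_const_mul,
      integral_indicator_one hF.measurableSet.compl]
  rw [h4]
  have h5 : N * ν.real Gᶜ ≤ C / N := by
    calc N * ν.real Gᶜ ≤ N * (C / N ^ 2) := by
          gcongr
          exact hF.compl_le
      _ = C / N := by field_simp
  calc _ ≤ (1 + C) / N + C / N := by gcongr
    _ = _ := by ring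

variable {W : 𝒵 → ℝ} {q b Cw : ℝ}

/-- Second moments of truncated weighted envelopes, for heavy-tailed importances. -/
lemma variance_le_of_le_one (hF : Envelope ν F G H C N s) (hs : 4 ≤ s) (hN : 0 < N)
    (hW : ∀ z, 0 ≤ W z) (hWm : Measurable W) (hWq : Integrable (fun z => W z ^ q) ν)
    (hWC : ∫ z, W z ^ q ∂ν ≤ Cw) (hq : 0 < q) (hq1 : q ≤ 1) (hb : 0 < b) :
    Integrable (fun z => min (W z) b * F z ^ 2) ν ∧
      ∫ z, min (W z) b * F z ^ 2 ∂ν ≤ b ^ (1 - q) * H ^ 2 * Cw + b * ((1 + 2 * C) / N) := by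
  have hFm := hF.measurable
  obtain ⟨hU, hU'⟩ := hF.tailMajorant_integrable hs hN
  have hint : Integrable (fun z => b ^ (1 - q) * H ^ 2 * W z ^ q + b * tailMajorant F G N z) ν :=
    (hWq.const_mul _).add (hU.const_mul b)
  have hv0 : ∀ z, 0 ≤ min (W z) b := fun z => le_min (hW z) hb.le
  have hle : ∀ z, min (W z) b * F z ^ 2 ≤
      b ^ (1 - q) * H ^ 2 * W z ^ q + b * tailMajorant F G N z := by
    intro z
    have hWq0 : 0 ≤ W z ^ q := Real.rpow_nonneg (hW z) _
    by_cases hz : z ∈ G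
    -- Interpolation: the power `1 - q` of the truncated weight is bounded by `b` and the power `q`
    -- by `W`, whose `q`-th moment is finite.
    · have h1 : min (W z) b ≤ b ^ (1 - q) * W z ^ q := by
        calc min (W z) b = min (W z) b ^ (1 - q) * min (W z) b ^ q := by
              rcases (hv0 z).eq_or_lt with h | h
              · rw [← h, Real.zero_rpow hq.ne', mul_zero]
              · rw [← Real.rpow_add h]; simp
          _ ≤ b ^ (1 - q) * W z ^ q := by
              have := hv0 z
              have := hW z
              gcongr
              · exact min_le_right _ _
              · exact min_le_left _ _
      have h2 : F z ^ 2 ≤ H ^ 2 := by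
        have := hF.nonneg z
        gcongr
        exact hF.le_of_mem z hz
      have h3 := tailMajorant_nonneg (F := F) (G := G) hN z
      calc min (W z) b * F z ^ 2 ≤ (b ^ (1 - q) * W z ^ q) * H ^ 2 := by gcongr
        _ ≤ b ^ (1 - q) * H ^ 2 * W z ^ q + b * tailMajorant F G N z := by
          have : 0 ≤ b * tailMajorant F G N z := by positivity
          linarith
    · have h1 := sq_le_tailMajorant (F := F) hN hz
      have h2 : min (W z) b * F z ^ 2 ≤ b * tailMajorant F G N z := by
        gcongr
        exact min_le_right _ _
      have : 0 ≤ b ^ (1 - q) * H ^ 2 * W z ^ q := by positivity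
      linarith
  constructor
  · refine hint.mono' (by fun_prop) (ae_of_all _ fun z => ?_)
    rw [Real.norm_eq_abs, abs_of_nonneg (mul_nonneg (hv0 z) (sq_nonneg _))]
    exact hle z
  · refine (integral_mono_of_nonneg (ae_of_all _ fun z => mul_nonneg (hv0 z) (sq_nonneg _)) hint
      (ae_of_all _ hle)).trans ?_
    rw [integral_add (hWq.const_mul _) (hU.const_mul b), integral_const_mul, integral_const_mul]
    gcongr

/-- Second moments of truncated weighted envelopes, for light-tailed importances. -/
lemma variance_le_of_one_lt (hF : Envelope ν F G H C N s)
    (hW : ∀ z, 0 ≤ W z) (hWm : Measurable W) (hWq : Integrable (fun z => W z ^ q) ν)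
    (hWC : ∫ z, W z ^ q ∂ν ≤ Cw) (hq1 : 1 < q) (hqs : 2 * q / (q - 1) ≤ s) (hb : 0 < b) :
    Integrable (fun z => min (W z) b * F z ^ 2) ν ∧
      ∫ z, min (W z) b * F z ^ 2 ∂ν ≤ Cw + (1 + C) := by
  have hFm := hF.measurable
  have hq' : 0 < q - 1 := by linarith
  obtain ⟨hU, hU'⟩ := hF.rpow_integrable (a := 2 * q / (q - 1)) (by positivity) hqs
  have hint : Integrable (fun z => W z ^ q + F z ^ (2 * q / (q - 1))) ν := hWq.add hU
  have hv0 : ∀ z, 0 ≤ min (W z) b := fun z => le_min (hW z) hb.le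
  have hle : ∀ z, min (W z) b * F z ^ 2 ≤ W z ^ q + F z ^ (2 * q / (q - 1)) := by
    intro z
    have hF0 := hF.nonneg z
    have hW0 := hW z
    have h1 : min (W z) b * F z ^ 2 ≤ W z * F z ^ 2 := by
      gcongr
      exact min_le_left _ _
    have h2 : 0 ≤ W z ^ q := Real.rpow_nonneg hW0 _
    have h3 : 0 ≤ F z ^ (2 * q / (q - 1)) := Real.rpow_nonneg hF0 _
    -- Young's inequality with exponents `q` and `q/(q-1)`, done by comparing the two factors
    -- directly.
    rcases le_total (F z ^ 2) (W z ^ (q - 1)) with h | h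
    · have h4 : W z * W z ^ (q - 1) = W z ^ q := by
        rcases hW0.eq_or_lt with h0 | h0
        · rw [← h0, zero_mul, Real.zero_rpow (by linarith)]
        · nth_rewrite 1 [← Real.rpow_one (W z)]
          rw [← Real.rpow_add h0]; simp
      have : W z * F z ^ 2 ≤ W z * W z ^ (q - 1) := by gcongr
      linarith
    · have h4 : W z ≤ F z ^ (2 / (q - 1)) := by
        have h5 := Real.rpow_le_rpow (Real.rpow_nonneg hW0 _) h (inv_pos.2 hq').le
        rw [← Real.rpow_mul hW0, mul_inv_cancel₀ hq'.ne', Real.rpow_one, ← Real.rpow_natCast,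
          ← Real.rpow_mul hF0] at h5
        simpa [div_eq_mul_inv] using h5
      have h5 : F z ^ (2 / (q - 1)) * F z ^ 2 = F z ^ (2 * q / (q - 1)) := by
        rw [← Real.rpow_natCast, ← Real.rpow_add_of_nonneg hF0 (by positivity) (by positivity)]
        congr 1
        push_cast
        field_simp
        ring
      have : W z * F z ^ 2 ≤ F z ^ (2 / (q - 1)) * F z ^ 2 := by gcongr
      linarith
  constructor
  · refine hint.mono' (by fun_prop) (ae_of_all _ fun z => ?_)
    rw [Real.norm_eq_abs, abs_of_nonneg (mul_nonneg (hv0 z) (sq_nonneg _))]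
    exact hle z
  · refine (integral_mono_of_nonneg (ae_of_all _ fun z => mul_nonneg (hv0 z) (sq_nonneg _)) hint
      (ae_of_all _ hle)).trans ?_
    rw [integral_add hWq hU]
    gcongr

/-- The bias due to truncation of the importances. -/
lemma bias_le (hF : Envelope ν F G H C N s) (hs : 4 ≤ s) (hN : 1 ≤ N) {μ : Measure 𝒵}
    (hW : IsImportance μ ν W) (hWq : Integrable (fun z => W z ^ q) ν)
    (hWC : ∫ z, W z ^ q ∂ν ≤ Cw) (hq : 0 < q) (hb : 0 < b) (hH : 0 ≤ H) {h : 𝒵 → ℝ}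
    (hhm : Measurable h) (hhF : ∀ z, |h z| ≤ F z) :
    Integrable h ν ∧ |∫ z, min (W z) b * h z ∂μ - ∫ z, h z ∂ν| ≤
      H * b ^ (-q) * Cw + (1 + 2 * C) / N := by
  have hN0 : 0 < N := by linarith
  obtain ⟨hU, hU'⟩ := hF.tailMajorant_integrable hs hN0
  have hh : Integrable h ν := by
    have := (hF.pow_integrable 1 (by push_cast; linarith)).1
    simp only [pow_one] at this
    exact this.mono' hhm.aestronglyMeasurable (ae_of_all _ hhF)
  refine ⟨hh, ?_⟩
  have hbq : 0 < b ^ (-q) := Real.rpow_pos_of_pos hb _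
  have hint : Integrable (fun z => H * b ^ (-q) * W z ^ q + tailMajorant F G N z) ν :=
    (hWq.const_mul _).add hU
  have h1 := hW.abs_integral_trunc_sub_le hb.le hhm hh hint
    (fun z => by
      have h2 := tailMajorant_nonneg (F := F) (G := G) hN0 z
      have h3 : 0 ≤ W z ^ q := Real.rpow_nonneg (hW.nonneg z) _
      positivity)
    (fun z hz => by
      have h2 := tailMajorant_nonneg (F := F) (G := G) hN0 z
      have h3 : 0 ≤ W z ^ q := Real.rpow_nonneg (hW.nonneg z) _
      refine (hhF z).trans ?_
      by_cases hzG : z ∈ G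
      -- Markov-type bound: truncation matters only where `W > b`.
      · have h4 : 1 ≤ b ^ (-q) * W z ^ q := by
          rw [Real.rpow_neg hb.le, ← div_eq_inv_mul, one_le_div (Real.rpow_pos_of_pos hb _)]
          exact Real.rpow_le_rpow hb.le hz.le hq.le
        have h5 := hF.le_of_mem z hzG
        nlinarith
      · have h4 := le_tailMajorant (F := F) hN hzG
        have : 0 ≤ H * b ^ (-q) * W z ^ q := by positivity
        linarith)
  refine h1.trans ?_
  rw [integral_add (hWq.const_mul _) hU, integral_const_mul]
  gcongr

end Envelope

/-- Relations between the rate `d`, the truncation level `b`, the logarithm `lp` of the dimension and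
the parameter `l` of exponential moments. -/
structure RateBounds (n : ℕ) (lp d b l r q κ R : ℝ) : Prop where
  two_le : 2 ≤ n
  one_le_log : 1 ≤ Real.log n
  lp_pos : 0 < lp
  d_pos : 0 < d
  one_le_b : 1 ≤ b
  b_le : b ≤ n
  l_pos : 0 < l
  l_eq : n * l * d = κ * lp
  l_mul_b : l * b * Real.log n ^ r ≤ κ * R
  variance : n * l ^ 2 ≤ κ ^ 2 * lp
  variance' : q ≤ 1 → n * l ^ 2 * (b ^ (1 - q) * (Real.log n ^ r) ^ 2) ≤ κ ^ 2 * R * lp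
  bias : Real.log n ^ r * b ^ (-q) ≤ R * d
  inv_le : 1 / (n : ℝ) ≤ d

/-- The constant in the deviation bound. -/
noncomputable def deviationConst (CH C Cw κ R : ℝ) : ℝ :=
  CH * R * Cw + 2 * (1 + 2 * C) +
    (4 + κ ^ 2 * (Cw * CH ^ 2 * R + (1 + 2 * C) + Cw + (1 + C))) / κ

/-- The envelope `F` absorbs the exponential in the second-order Chernoff term. The deviation from
`m` consists of the truncation bias, the error `|∫ h ∂ν - m|` and the random part; `RateBounds`
makes the first two `O(d)` and the exponent for the third a multiple of `lp`. -/
lemma IsSample.deviation_of_envelope {n : ℕ} {P : Measure Ω} [IsProbabilityMeasure P]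
    {μ : Measure 𝒵} [IsProbabilityMeasure μ] {Z : Fin n → Ω → 𝒵} {W : 𝒵 → ℝ}
    (hZ : IsSample P μ Z) (hW : IsImportance μ ν W)
    {lp d b l r q κ R CH Cw : ℝ} (hκ : 0 < κ) (hR : 0 ≤ R) (hCH : 0 ≤ CH) (hC : 0 ≤ C)
    (hCw : 0 ≤ Cw) (hrate : RateBounds n lp d b l r q κ R)
    (hF : Envelope ν F G (CH * Real.log n ^ r) C n s) (hs : 4 ≤ s)
    (hqs : 1 < q → 2 * q / (q - 1) ≤ s) (hq : 0 < q)
    (hWq : Integrable (fun z => W z ^ q) ν) (hWC : ∫ z, W z ^ q ∂ν ≤ Cw)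
    {h : 𝒵 → ℝ} (hhm : Measurable h) (hhF : ∀ z, |h z| ≤ F z)
    (hle : ∀ z, h z ^ 2 * Real.exp (l * (min (W z) b * |h z|)) ≤ F z ^ 2)
    {m : ℝ} (hm : |∫ z, h z ∂ν - m| ≤ (1 + 2 * C) / n) :
    P.real {ω | deviationConst CH C Cw κ R * d ≤
      |(n : ℝ)⁻¹ * ∑ t, min (W (Z t ω)) b * h (Z t ω) - m|} ≤ 2 * Real.exp (-(4 * lp)) := by
  have hn2 := hrate.two_le
  have hn0 : (0 : ℝ) < n := by exact_mod_cast (by omega : 0 < n)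
  have hn1 : (1 : ℝ) ≤ n := by exact_mod_cast (by omega : 1 ≤ n)
  have hb0 : 0 < b := by linarith [hrate.one_le_b]
  have hlog : 0 < Real.log n := by linarith [hrate.one_le_log]
  have hlogr : 0 < Real.log n ^ r := Real.rpow_pos_of_pos hlog _
  have hlp := hrate.lp_pos
  have hd := hrate.d_pos
  have hl := hrate.l_pos
  set H := CH * Real.log n ^ r with hH
  have hH0 : 0 ≤ H := by positivity
  obtain ⟨hh, hbias⟩ := hF.bias_le hs hn1 hW hWq hWC hq hb0 hH0 hhm hhF
  set K₁ := κ ^ 2 * (Cw * CH ^ 2 * R + (1 + 2 * C) + Cw + (1 + C)) with hK₁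
  have hvar : ∃ V, Integrable (fun z => min (W z) b * F z ^ 2) ν ∧
      ∫ z, min (W z) b * F z ^ 2 ∂ν ≤ V ∧ n * l ^ 2 * V ≤ K₁ * lp := by
    rcases le_or_gt q 1 with hq1 | hq1
    · obtain ⟨h1, h2⟩ := hF.variance_le_of_le_one hs hn0 hW.nonneg hW.measurable hWq hWC hq hq1 hb0
      refine ⟨_, h1, h2, ?_⟩
      have h3 := hrate.variance' hq1
      have h4 : b * ((1 + 2 * C) / n) ≤ 1 + 2 * C := by
        rw [mul_div_assoc', div_le_iff₀ hn0, mul_comm]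
        gcongr
        exact hrate.b_le
      calc n * l ^ 2 * (b ^ (1 - q) * H ^ 2 * Cw + b * ((1 + 2 * C) / n))
          = (n * l ^ 2 * (b ^ (1 - q) * (Real.log n ^ r) ^ 2)) * (CH ^ 2 * Cw) +
            n * l ^ 2 * (b * ((1 + 2 * C) / n)) := by rw [hH]; ring
        _ ≤ (κ ^ 2 * R * lp) * (CH ^ 2 * Cw) + κ ^ 2 * lp * (1 + 2 * C) := by
            exact add_le_add (mul_le_mul_of_nonneg_right h3 (by positivity))
              (mul_le_mul hrate.variance h4 (by positivity) (by positivity))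
        _ ≤ K₁ * lp := by
            have : 0 ≤ κ ^ 2 * lp * (Cw + (1 + C)) := by positivity
            rw [hK₁]; linarith
    · obtain ⟨h1, h2⟩ := hF.variance_le_of_one_lt hW.nonneg hW.measurable hWq hWC hq1 (hqs hq1) hb0
      refine ⟨_, h1, h2, ?_⟩
      calc n * l ^ 2 * (Cw + (1 + C)) ≤ κ ^ 2 * lp * (Cw + (1 + C)) :=
            mul_le_mul_of_nonneg_right hrate.variance (by positivity)
        _ ≤ K₁ * lp := by
            have : 0 ≤ κ ^ 2 * lp * (Cw * CH ^ 2 * R + (1 + 2 * C)) := by positivity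
            rw [hK₁]; linarith
  obtain ⟨V, hVi, hV, hV'⟩ := hvar
  set D := deviationConst CH C Cw κ R with hD
  set K₂ := CH * R * Cw + 2 * (1 + 2 * C) with hK₂
  have hDK : D = K₂ + (4 + K₁) / κ := rfl
  have hdev := hZ.trunc_deviation (by omega) hW hb0.le hl.le hhm hh hVi hle hV
    ((D - K₂) * d)
  -- `deviationConst` contains `(4 + K₁)/κ` so that the linear term `(4 + K₁) lp` beats the
  -- quadratic term `K₁ lp` by `4 lp`.
  have hexp : n * (l ^ 2 * V) - l * (n * ((D - K₂) * d)) ≤ -(4 * lp) := by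
    have h1 : l * (n * ((D - K₂) * d)) = (4 + K₁) * lp := by
      have h2 : D - K₂ = (4 + K₁) / κ := by rw [hDK]; ring
      calc l * (n * ((D - K₂) * d)) = (D - K₂) * (n * l * d) := by ring
        _ = (4 + K₁) / κ * (κ * lp) := by rw [hrate.l_eq, h2]
        _ = _ := by field_simp
    rw [h1]
    linarith
  have hbd : |∫ z, min (W z) b * h z ∂μ - m| ≤ K₂ * d := by
    have h1 : H * b ^ (-q) * Cw ≤ CH * R * Cw * d := by
      calc H * b ^ (-q) * Cw = CH * (Real.log n ^ r * b ^ (-q)) * Cw := by rw [hH]; ring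
        _ ≤ CH * (R * d) * Cw :=
          mul_le_mul_of_nonneg_right (mul_le_mul_of_nonneg_left hrate.bias hCH) hCw
        _ = _ := by ring
    have h2 : (1 + 2 * C) / n ≤ (1 + 2 * C) * d := by
      rw [div_eq_mul_one_div]
      gcongr
      exact hrate.inv_le
    calc |∫ z, min (W z) b * h z ∂μ - m| ≤
          |∫ z, min (W z) b * h z ∂μ - ∫ z, h z ∂ν| + |∫ z, h z ∂ν - m| := abs_sub_le _ _ _
      _ ≤ K₂ * d := by rw [hK₂]; linarith
  refine (measureReal_mono fun ω hω => ?_).trans (hdev.trans ?_)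
  · simp only [Set.mem_ofPred_eq] at hω ⊢
    have := abs_sub_le ((n : ℝ)⁻¹ * ∑ t, min (W (Z t ω)) b * h (Z t ω))
      (∫ z, min (W z) b * h z ∂μ) m
    linarith
  · gcongr

end Envelopes

/-! ### Envelopes from exponential moments -/

section ExponentialMoments

lemma rpow_le_const_mul_exp {s a t : ℝ} (hs : 0 < s) (ha : 0 < a) (ht : 0 ≤ t) :
    t ^ s ≤ (s / a) ^ s * Real.exp (a * t) := by
  have h1 : t ≤ s / a * Real.exp (a * t / s) := by
    have h2 : a * t / s ≤ Real.exp (a * t / s) := by linarith [Real.add_one_le_exp (a * t / s)]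
    calc t = s / a * (a * t / s) := by field_simp
      _ ≤ _ := by gcongr
  calc t ^ s ≤ (s / a * Real.exp (a * t / s)) ^ s := by gcongr
    _ = (s / a) ^ s * Real.exp (a * t) := by
      rw [Real.mul_rpow (by positivity) (Real.exp_pos _).le, ← Real.exp_mul]
      congr 2
      field_simp

variable {𝒵 Ω : Type*} [MeasurableSpace 𝒵] [MeasurableSpace Ω]

/-- The exponential moment `∫ exp f` is at most `C`. -/
structure ExpMoment (ν : Measure 𝒵) (f : 𝒵 → ℝ) (C : ℝ) : Prop where
  integrable : Integrable (fun z => Real.exp (f z)) ν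
  integral_le : ∫ z, Real.exp (f z) ∂ν ≤ C

variable {ν : Measure 𝒵}

lemma ExpMoment.nonneg {f : 𝒵 → ℝ} {C : ℝ} (h : ExpMoment ν f C) : 0 ≤ C :=
  (integral_nonneg fun _ => (Real.exp_pos _).le).trans h.integral_le

lemma ExpMoment.integral_le_of_le {f g : 𝒵 → ℝ} {C K : ℝ} (h : ExpMoment ν f C)
    (hgm : Measurable g) (hg : ∀ z, 0 ≤ g z) (hle : ∀ z, g z ≤ K * Real.exp (f z)) (hK : 0 ≤ K) :
    Integrable g ν ∧ ∫ z, g z ∂ν ≤ K * C := by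
  have hint := h.integrable.const_mul K
  refine ⟨hint.mono' hgm.aestronglyMeasurable (ae_of_all _ fun z => ?_),
    (integral_mono_of_nonneg (ae_of_all _ hg) hint (ae_of_all _ hle)).trans ?_⟩
  · rw [Real.norm_eq_abs, abs_of_nonneg (hg z)]
    exact hle z
  · rw [integral_const_mul]
    exact mul_le_mul_of_nonneg_left h.integral_le hK

variable [IsProbabilityMeasure ν]

lemma ExpMoment.measureReal_le {f : 𝒵 → ℝ} {C : ℝ} (h : ExpMoment ν f C) (a : ℝ) :
    ν.real {z | a ≤ f z} ≤ C * Real.exp (-a) := by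
  have h1 := measure_ge_le_exp_mul_mgf (μ := ν) (X := f) (t := 1) a zero_le_one
    (by simpa using h.integrable)
  refine h1.trans ?_
  have h2 : mgf f ν 1 ≤ C := by simpa [mgf] using h.integral_le
  rw [mul_comm, neg_one_mul]
  gcongr

lemma exp_neg_mul_log_le {n : ℕ} {k : ℝ} (hn : 2 ≤ n) (hk : 2 ≤ k) :
    Real.exp (-(k * Real.log n)) ≤ 1 / (n : ℝ) ^ 2 := by
  have hn0 : (0 : ℝ) < n := by exact_mod_cast (by omega : 0 < n)
  have hlog : 0 ≤ Real.log n := Real.log_natCast_nonneg n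
  have h2 : Real.exp (2 * Real.log n) = (n : ℝ) ^ 2 := by
    rw [mul_comm, Real.exp_mul, Real.exp_log hn0]
    norm_cast
  rw [Real.exp_neg, ← one_div, ← h2]
  gcongr

/-- The constant in the bound of the envelopes on the regular event. -/
noncomputable def envelopeConst (A r k : ℝ) : ℝ := A ^ r * Real.exp (k * A)

/-- The factor `exp(k |h| / log n)` is what the Chernoff bound asks for. Where `|h| ≤ A log n` it is
at most `e^{kA}`, and in the `s`-th moment it uses at most half of the exponential moment. The
remaining event has probability `O(n^{-θA})`, and `θ A ≥ 4`. -/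
lemma envelope_of_expMoment {h : 𝒵 → ℝ} (hhm : Measurable h) {θ C A r k s : ℝ} {n : ℕ}
    (hθ : 0 < θ) (hs : 4 ≤ s) (hk0 : 0 ≤ k) (hk : k * s ≤ θ / 2) (hA : 1 ≤ A) (hθA : 4 ≤ θ * A)
    (hr : 1 ≤ r) (hn : 2 ≤ n) (hlog : 1 ≤ Real.log n)
    (hexp : ExpMoment ν (fun z => θ * |h z|) C) :
    Envelope ν (fun z => |h z| * Real.exp (k * (|h z| / Real.log n)))
      {z | |h z| ≤ A * Real.log n} (envelopeConst A r k * Real.log n ^ r)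
      (((s / (θ / 2)) ^ s + 1) * C) n s := by
  have hC := hexp.nonneg
  have hs0 : 0 < s := by linarith
  have hlog0 : 0 < Real.log n := by linarith
  set K : ℝ := (s / (θ / 2)) ^ s with hK
  have hK0 : 0 ≤ K := by positivity
  have hle : ∀ z, (|h z| * Real.exp (k * (|h z| / Real.log n))) ^ s ≤
      K * Real.exp (θ * |h z|) := by
    intro z
    rw [Real.mul_rpow (abs_nonneg _) (Real.exp_pos _).le, ← Real.exp_mul]
    have h1 := rpow_le_const_mul_exp hs0 (half_pos hθ) (abs_nonneg (h z))
    have h2 : k * (|h z| / Real.log n) * s ≤ θ / 2 * |h z| := by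
      have h3 : |h z| / Real.log n ≤ |h z| := div_le_self (abs_nonneg _) hlog
      calc k * (|h z| / Real.log n) * s = k * s * (|h z| / Real.log n) := by ring
        _ ≤ θ / 2 * |h z| := by
          have := abs_nonneg (h z)
          gcongr
    calc |h z| ^ s * Real.exp (k * (|h z| / Real.log n) * s)
        ≤ (K * Real.exp (θ / 2 * |h z|)) * Real.exp (θ / 2 * |h z|) := by gcongr
      _ = K * Real.exp (θ * |h z|) := by
          rw [mul_assoc, ← Real.exp_add]; ring_nf
  have hFs := hexp.integral_le_of_le (g := fun z =>
    (|h z| * Real.exp (k * (|h z| / Real.log n))) ^ s) (by fun_prop)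
    (fun z => by positivity) hle hK0
  refine ⟨by fun_prop, fun z => by positivity, measurableSet_le (by fun_prop) (by fun_prop),
    fun z hz => ?_, hFs.1, hFs.2.trans (by nlinarith), ?_⟩
  · simp only [Set.mem_ofPred_eq] at hz
    have h1 : |h z| ≤ A ^ r * Real.log n ^ r := by
      rw [← Real.mul_rpow (by linarith) hlog0.le]
      refine hz.trans ?_
      have h2 : 1 ≤ A * Real.log n := one_le_mul_of_one_le_of_one_le hA hlog
      calc A * Real.log n = (A * Real.log n) ^ (1 : ℝ) := (Real.rpow_one _).symm
        _ ≤ _ := Real.rpow_le_rpow_of_exponent_le h2 hr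
    have h2 : |h z| / Real.log n ≤ A := by rwa [div_le_iff₀ hlog0]
    calc |h z| * Real.exp (k * (|h z| / Real.log n))
        ≤ (A ^ r * Real.log n ^ r) * Real.exp (k * A) := by gcongr
      _ = _ := by rw [envelopeConst]; ring
  · have h1 := hexp.measureReal_le (θ * A * Real.log n)
    have h2 := exp_neg_mul_log_le hn (by linarith : 2 ≤ θ * A)
    calc ν.real {z | |h z| ≤ A * Real.log n}ᶜ ≤ ν.real {z | θ * A * Real.log n ≤ θ * |h z|} := by
          refine measureReal_mono fun z hz => ?_
          simp only [Set.mem_compl_iff, Set.mem_ofPred_eq, not_le] at hz ⊢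
          rw [mul_assoc]
          gcongr
      _ ≤ C * (1 / (n : ℝ) ^ 2) := h1.trans (by gcongr)
      _ ≤ (K + 1) * C / (n : ℝ) ^ 2 := by
          rw [mul_one_div]
          gcongr
          nlinarith

/-- The constant in the moment bound for the envelope of the product of an input and an error. -/
noncomputable def noiseMomentConst (θ η s : ℝ) : ℝ :=
  (2 * s / (θ / 2)) ^ (2 * s) + (2 * s / η / θ) ^ (2 * s / η) + 2

/-- Only `x` enters the exponential factor: `|e|` may have no ordinary exponential moment when `η <
1`, and it is handled by truncation instead. The product in the `s`-th moment is separated by AM–GM,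
and on the good event `|x|` and `|e|` contribute the powers `1/2` and `1/η` of `log n`. -/
lemma envelope_of_expMoment_noise {x e : 𝒵 → ℝ} (hxm : Measurable x) (hem : Measurable e)
    {θ η C A k s : ℝ} {n : ℕ} (hθ : 0 < θ) (hη : 0 < η) (hs : 4 ≤ s) (hk0 : 0 ≤ k)
    (hk : k * (2 * s) ≤ θ / 2) (hA : 1 ≤ A) (hθA : 4 ≤ θ * A)
    (hn : 2 ≤ n) (hlog : 1 ≤ Real.log n)
    (hx1 : ExpMoment ν (fun z => θ * |x z|) C) (hx2 : ExpMoment ν (fun z => θ * |x z * x z|) C)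
    (he : ExpMoment ν (fun z => θ * |e z| ^ η) C) :
    Envelope ν (fun z => |x z| * |e z| * Real.exp (k * (|x z| / √(Real.log n))))
      {z | |x z * x z| ≤ A * Real.log n ∧ |e z| ^ η ≤ A * Real.log n}
      (envelopeConst A (1 / η + 1 / 2) k * Real.log n ^ (1 / η + 1 / 2))
      (noiseMomentConst θ η s * C) n s := by
  have hC := hx1.nonneg
  have hs0 : 0 < s := by linarith
  have hlog0 : 0 < Real.log n := by linarith
  have hsq : 1 ≤ √(Real.log n) := Real.one_le_sqrt.2 hlog
  set K₁ : ℝ := (2 * s / (θ / 2)) ^ (2 * s) with hK₁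
  set K₂ : ℝ := (2 * s / η / θ) ^ (2 * s / η) with hK₂
  have hK₁0 : 0 ≤ K₁ := by positivity
  have hK₂0 : 0 ≤ K₂ := by positivity
  have hle : ∀ z, (|x z| * |e z| * Real.exp (k * (|x z| / √(Real.log n)))) ^ s ≤
      K₁ * Real.exp (θ * |x z|) + K₂ * Real.exp (θ * |e z| ^ η) := by
    intro z
    have h0 : 0 ≤ |x z| := abs_nonneg _
    have he0 : 0 ≤ |e z| := abs_nonneg _
    set E := Real.exp (k * (|x z| / √(Real.log n))) with hE
    have hE0 : 0 < E := Real.exp_pos _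
    have h1 : (|x z| * |e z| * E) ^ s = (|x z| * E) ^ s * |e z| ^ s := by
      rw [← Real.mul_rpow (by positivity) he0]; ring_nf
    have hsq1 : ∀ t : ℝ, 0 ≤ t → (t ^ s) ^ 2 = t ^ (2 * s) := fun t ht => by
      rw [← Real.rpow_natCast, ← Real.rpow_mul ht, mul_comm]; norm_num
    have h2 : (|x z| * E) ^ s * |e z| ^ s ≤ (|x z| * E) ^ (2 * s) + |e z| ^ (2 * s) := by
      rw [← hsq1 _ (by positivity), ← hsq1 _ he0]
      nlinarith [sq_nonneg ((|x z| * E) ^ s), sq_nonneg (|e z| ^ s),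
        sq_nonneg ((|x z| * E) ^ s - |e z| ^ s)]
    have h3 : (|x z| * E) ^ (2 * s) ≤ K₁ * Real.exp (θ * |x z|) := by
      rw [Real.mul_rpow h0 hE0.le, hE, ← Real.exp_mul]
      have h4 := rpow_le_const_mul_exp (by positivity : 0 < 2 * s) (half_pos hθ) h0
      have h5 : k * (|x z| / √(Real.log n)) * (2 * s) ≤ θ / 2 * |x z| := by
        have h6 : |x z| / √(Real.log n) ≤ |x z| := div_le_self h0 hsq
        calc k * (|x z| / √(Real.log n)) * (2 * s) = k * (2 * s) * (|x z| / √(Real.log n)) := by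
              ring
          _ ≤ θ / 2 * |x z| := by gcongr
      calc |x z| ^ (2 * s) * Real.exp (k * (|x z| / √(Real.log n)) * (2 * s))
          ≤ (K₁ * Real.exp (θ / 2 * |x z|)) * Real.exp (θ / 2 * |x z|) := by gcongr
        _ = K₁ * Real.exp (θ * |x z|) := by
            rw [mul_assoc, ← Real.exp_add]; ring_nf
    have h4 : |e z| ^ (2 * s) ≤ K₂ * Real.exp (θ * |e z| ^ η) := by
      have h5 := rpow_le_const_mul_exp (by positivity : 0 < 2 * s / η) hθ
        (Real.rpow_nonneg he0 η)
      rw [← Real.rpow_mul he0] at h5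
      have h6 : η * (2 * s / η) = 2 * s := by field_simp
      rwa [h6] at h5
    rw [h1]
    linarith
  have hmaj : Integrable (fun z => K₁ * Real.exp (θ * |x z|) + K₂ * Real.exp (θ * |e z| ^ η)) ν :=
    (hx1.integrable.const_mul _).add (he.integrable.const_mul _)
  have hFs0 : ∀ z, 0 ≤ (|x z| * |e z| * Real.exp (k * (|x z| / √(Real.log n)))) ^ s :=
    fun z => by positivity
  have hG1 : MeasurableSet {z | |x z * x z| ≤ A * Real.log n} :=
    measurableSet_le (by fun_prop) measurable_const
  have hG2 : MeasurableSet {z | |e z| ^ η ≤ A * Real.log n} :=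
    measurableSet_le (by fun_prop) measurable_const
  have hFsm : Measurable fun z =>
      (|x z| * |e z| * Real.exp (k * (|x z| / √(Real.log n)))) ^ s := by
    have hF : Measurable fun z => |x z| * |e z| * Real.exp (k * (|x z| / √(Real.log n))) := by
      fun_prop
    exact hF.pow_const s
  refine ⟨by fun_prop, fun z => by positivity, hG1.inter hG2, fun z hz => ?_, ?_, ?_, ?_⟩
  · obtain ⟨hz1, hz2⟩ := hz
    rw [← abs_mul_abs_self, abs_mul, abs_abs, ← sq] at hz1
    have hAl : 0 ≤ A * Real.log n := by positivity
    have h1 : |x z| ≤ (A * Real.log n) ^ (1 / 2 : ℝ) := by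
      rw [← Real.sqrt_eq_rpow]
      exact Real.le_sqrt_of_sq_le hz1
    have h2 : |e z| ≤ (A * Real.log n) ^ (1 / η) := by
      have h3 := Real.rpow_le_rpow (Real.rpow_nonneg (abs_nonneg _) _) hz2
        (by positivity : 0 ≤ 1 / η)
      rwa [← Real.rpow_mul (abs_nonneg _), mul_one_div_cancel hη.ne', Real.rpow_one] at h3
    have h3 : |x z| / √(Real.log n) ≤ A := by
      rw [div_le_iff₀ (by positivity)]
      refine h1.trans ?_
      rw [← Real.sqrt_eq_rpow, Real.sqrt_mul (by linarith)]
      gcongr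
      rw [Real.sqrt_le_left (by linarith)]
      nlinarith
    calc |x z| * |e z| * Real.exp (k * (|x z| / √(Real.log n)))
        ≤ (A * Real.log n) ^ (1 / 2 : ℝ) * (A * Real.log n) ^ (1 / η) * Real.exp (k * A) := by
          gcongr
      _ = _ := by
          rw [← Real.rpow_add (by positivity), envelopeConst, add_comm (1 / 2 : ℝ),
            Real.mul_rpow (by linarith) hlog0.le]
          ring
  · refine hmaj.mono' hFsm.aestronglyMeasurable (ae_of_all _ fun z => ?_)
    rw [Real.norm_eq_abs, abs_of_nonneg (hFs0 z)]
    exact hle z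
  · refine (integral_mono_of_nonneg (ae_of_all _ hFs0) hmaj (ae_of_all _ hle)).trans ?_
    rw [integral_add (hx1.integrable.const_mul _) (he.integrable.const_mul _),
      integral_const_mul, integral_const_mul]
    have h1 := mul_le_mul_of_nonneg_left hx1.integral_le hK₁0
    have h2 := mul_le_mul_of_nonneg_left he.integral_le hK₂0
    rw [noiseMomentConst]
    nlinarith
  · have h1 := hx2.measureReal_le (θ * A * Real.log n)
    have h2 := he.measureReal_le (θ * A * Real.log n)
    have h3 := exp_neg_mul_log_le hn (by linarith : 2 ≤ θ * A)
    have hsub : {z | |x z * x z| ≤ A * Real.log n ∧ |e z| ^ η ≤ A * Real.log n}ᶜ ⊆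
        {z | θ * A * Real.log n ≤ θ * |x z * x z|} ∪
        {z | θ * A * Real.log n ≤ θ * |e z| ^ η} := by
      intro z hz
      simp only [Set.mem_compl_iff, Set.mem_ofPred_eq, not_and_or, not_le, Set.mem_union] at hz ⊢
      rw [mul_assoc]
      exact hz.imp (fun h => by gcongr) (fun h => by gcongr)
    calc _ ≤ _ := measureReal_mono hsub
      _ ≤ _ := measureReal_union_le _ _
      _ ≤ C * (1 / (n : ℝ) ^ 2) + C * (1 / (n : ℝ) ^ 2) :=
          add_le_add (h1.trans (by gcongr)) (h2.trans (by gcongr))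
      _ = 2 * C / (n : ℝ) ^ 2 := by ring
      _ ≤ noiseMomentConst θ η s * C / (n : ℝ) ^ 2 := by
          gcongr
          rw [noiseMomentConst]
          linarith

variable {n : ℕ} {P : Measure Ω} [IsProbabilityMeasure P]
    {μ : Measure 𝒵} [IsProbabilityMeasure μ] {Z : Fin n → Ω → 𝒵} {W : 𝒵 → ℝ}
    {lp d b l r q κ R Cw θ C A k s : ℝ}

/-- Deviations of weighted means of functions with exponential moments. -/
lemma IsSample.deviation_of_expMoment (hZ : IsSample P μ Z) (hW : IsImportance μ ν W)
    (hκ : 0 < κ) (hR : 0 ≤ R) (hCw : 0 ≤ Cw) (hrate : RateBounds n lp d b l r q κ R)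
    (hθ : 0 < θ) (hs : 4 ≤ s) (hk0 : 0 ≤ k) (hk : k * s ≤ θ / 2) (hκk : κ * R ≤ k) (hA : 1 ≤ A)
    (hθA : 4 ≤ θ * A) (hr : 1 ≤ r)
    (hqs : 1 < q → 2 * q / (q - 1) ≤ s) (hq : 0 < q)
    (hWq : Integrable (fun z => W z ^ q) ν) (hWC : ∫ z, W z ^ q ∂ν ≤ Cw)
    {h : 𝒵 → ℝ} (hhm : Measurable h) (hexp : ExpMoment ν (fun z => θ * |h z|) C) :
    P.real {ω | deviationConst (envelopeConst A r k) (((s / (θ / 2)) ^ s + 1) * C) Cw κ R * d ≤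
      |(n : ℝ)⁻¹ * ∑ t, min (W (Z t ω)) b * h (Z t ω) - ∫ z, h z ∂ν|} ≤
      2 * Real.exp (-(4 * lp)) := by
  have hlog0 : 0 < Real.log n := by linarith [hrate.one_le_log]
  have henv := envelope_of_expMoment hhm hθ hs hk0 hk hA hθA hr hrate.two_le hrate.one_le_log hexp
  have hC := hexp.nonneg
  have hs0 : 0 < s := by linarith
  have hA0 : 0 < A := by linarith
  refine hZ.deviation_of_envelope hW hκ hR (by unfold envelopeConst; positivity) (by positivity)
    hCw hrate henv hs hqs hq hWq hWC hhm (fun z => ?_) (fun z => ?_) ?_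
  · exact le_mul_of_one_le_right (abs_nonneg _) (Real.one_le_exp (by positivity))
  · rw [mul_pow, sq_abs, ← Real.exp_nat_mul]
    refine mul_le_mul_of_nonneg_left (Real.exp_le_exp.2 ?_) (sq_nonneg _)
    have h1 : l * (min (W z) b * |h z|) ≤ l * b * |h z| := by
      rw [mul_assoc]
      have := hrate.l_pos
      gcongr
      exact min_le_right _ _
    have h2 : l * b ≤ k / Real.log n := by
      rw [le_div_iff₀ hlog0]
      refine le_trans ?_ (hrate.l_mul_b.trans hκk)
      have := hrate.l_pos
      have := hrate.one_le_b
      gcongr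
      calc Real.log n = Real.log n ^ (1 : ℝ) := (Real.rpow_one _).symm
        _ ≤ _ := Real.rpow_le_rpow_of_exponent_le hrate.one_le_log hr
    calc l * (min (W z) b * |h z|) ≤ l * b * |h z| := h1
      _ ≤ k / Real.log n * |h z| := by gcongr
      _ = k * (|h z| / Real.log n) := by ring
      _ ≤ (2 : ℕ) * (k * (|h z| / Real.log n)) := by
        have : 0 ≤ k * (|h z| / Real.log n) := by positivity
        push_cast; linarith
  · rw [sub_self, abs_zero]
    positivity

/-- The truncated product of an input and an error. -/
noncomputable def truncNoise (W x e : 𝒵 → ℝ) (b L : ℝ) : 𝒵 → ℝ :=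
  Set.indicator {z | min (W z) b * |e z| ≤ b * L} fun z => x z * e z

/-- Deviations of weighted means of truncated products of an input and an error. -/
lemma IsSample.deviation_truncNoise {η : ℝ} (hη : 0 < η) (hZ : IsSample P μ Z)
    (hW : IsImportance μ ν W)
    (hκ : 0 < κ) (hR : 0 ≤ R) (hCw : 0 ≤ Cw)
    (hrate : RateBounds n lp d b l (1 / η + 1 / 2) q κ R)
    (hθ : 0 < θ) (hs : 4 ≤ s) (hk0 : 0 ≤ k) (hk : k * (2 * s) ≤ θ / 2)
    (hκk : κ * R * A ^ (1 / η) ≤ k) (hA : 1 ≤ A)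
    (hθA : 4 ≤ θ * A)
    (hqs : 1 < q → 2 * q / (q - 1) ≤ s) (hq : 0 < q)
    (hWq : Integrable (fun z => W z ^ q) ν) (hWC : ∫ z, W z ^ q ∂ν ≤ Cw)
    {x e : 𝒵 → ℝ} (hxm : Measurable x) (hem : Measurable e)
    (hx1 : ExpMoment ν (fun z => θ * |x z|) C) (hx2 : ExpMoment ν (fun z => θ * |x z * x z|) C)
    (he : ExpMoment ν (fun z => θ * |e z| ^ η) C) (horth : ∫ z, x z * e z ∂ν = 0) :
    P.real {ω | deviationConst (envelopeConst A (1 / η + 1 / 2) k) (noiseMomentConst θ η s * C)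
        Cw κ R * d ≤ |(n : ℝ)⁻¹ * ∑ t, min (W (Z t ω)) b *
          truncNoise W x e b ((A * Real.log n) ^ (1 / η)) (Z t ω)|} ≤
      2 * Real.exp (-(4 * lp)) := by
  have hlog0 : 0 < Real.log n := by linarith [hrate.one_le_log]
  have hn1 : (1 : ℝ) ≤ n := by exact_mod_cast (by have := hrate.two_le; omega : 1 ≤ n)
  have henv := envelope_of_expMoment_noise hxm hem hθ hη hs hk0 hk hA hθA hrate.two_le
    hrate.one_le_log hx1 hx2 he
  have hC := hx1.nonneg
  have hs0 : 0 < s := by linarith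
  have hA0 : 0 < A := by linarith
  have hb0 : 0 < b := by linarith [hrate.one_le_b]
  have hWm := hW.measurable
  have hncc : 0 ≤ noiseMomentConst θ η s := by unfold noiseMomentConst; positivity
  set L := (A * Real.log n) ^ (1 / η) with hL
  set B : Set 𝒵 := {z | min (W z) b * |e z| ≤ b * L} with hB
  have hBm : MeasurableSet B := measurableSet_le (by fun_prop) (by fun_prop)
  have hhm : Measurable (truncNoise W x e b L) := (hxm.mul hem).indicator hBm
  set F : 𝒵 → ℝ := fun z => |x z| * |e z| * Real.exp (k * (|x z| / √(Real.log n))) with hF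
  set G : Set 𝒵 := {z | |x z * x z| ≤ A * Real.log n ∧ |e z| ^ η ≤ A * Real.log n} with hG
  have hxeF : ∀ z, |x z * e z| ≤ F z := fun z => by
    rw [abs_mul]
    exact le_mul_of_one_le_right (by positivity) (Real.one_le_exp (by positivity))
  have hhF : ∀ z, |truncNoise W x e b L z| ≤ F z := fun z => by
    by_cases hz : z ∈ B
    · rw [truncNoise, Set.indicator_of_mem hz]
      exact hxeF z
    · rw [truncNoise, Set.indicator_of_notMem hz, abs_zero]
      exact henv.nonneg z
  have hBG : ∀ z ∉ B, z ∉ G := by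
    intro z hz hzG
    refine hz ?_
    have h2 : |e z| ≤ L := by
      have h3 := Real.rpow_le_rpow (Real.rpow_nonneg (abs_nonneg _) _) hzG.2
        (by positivity : 0 ≤ 1 / η)
      rwa [← Real.rpow_mul (abs_nonneg _), mul_one_div_cancel hη.ne', Real.rpow_one] at h3
    change min (W z) b * |e z| ≤ b * L
    gcongr
    exact min_le_right _ _
  have hF1 : Integrable F ν := by
    simpa using (henv.pow_integrable 1 (by push_cast; linarith)).1
  obtain ⟨hU, hU'⟩ := henv.tailMajorant_integrable hs (by linarith)
  have hxe : Integrable (fun z => x z * e z) ν :=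
    hF1.mono' (hxm.mul hem).aestronglyMeasurable (ae_of_all _ hxeF)
  -- The untruncated product has mean zero by orthogonality, and truncation acts only outside `G`,
  -- where the tail majorant applies.
  have hmean : |∫ z, truncNoise W x e b L z ∂ν - 0| ≤
      (1 + 2 * (noiseMomentConst θ η s * C)) / n := by
    have h1 : ∫ z, truncNoise W x e b L z ∂ν - 0 =
        ∫ z, (truncNoise W x e b L z - x z * e z) ∂ν := by
      rw [integral_sub (hF1.mono' hhm.aestronglyMeasurable (ae_of_all _ hhF))
        hxe, horth]
    rw [h1]
    refine abs_integral_le_integral_abs.trans (le_trans (integral_mono_of_nonneg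
      (ae_of_all _ fun z => abs_nonneg _) hU (ae_of_all _ fun z => ?_)) hU')
    change |truncNoise W x e b L z - x z * e z| ≤ tailMajorant F G n z
    by_cases hz : z ∈ B
    · rw [truncNoise, Set.indicator_of_mem hz, sub_self, abs_zero]
      exact tailMajorant_nonneg (by linarith) z
    · rw [truncNoise, Set.indicator_of_notMem hz, zero_sub, abs_neg]
      exact (hxeF z).trans (le_tailMajorant hn1 (hBG z hz))
  have hmain := hZ.deviation_of_envelope hW hκ hR (by unfold envelopeConst; positivity)
    (by positivity) hCw hrate henv hs hqs hq hWq hWC hhm hhF (fun z => ?_) hmean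
  · simpa only [sub_zero] using hmain
  · by_cases hz : z ∈ B
    · have hz' : min (W z) b * |e z| ≤ b * L := hz
      rw [truncNoise, Set.indicator_of_mem hz, hF]
      simp only
      rw [← abs_mul, mul_pow |x z * e z|, ← Real.exp_nat_mul, sq_abs]
      refine mul_le_mul_of_nonneg_left (Real.exp_le_exp.2 ?_) (sq_nonneg _)
      have hl := hrate.l_pos
      have h1 : l * (min (W z) b * |x z * e z|) ≤ l * (b * L) * |x z| := by
        rw [abs_mul]
        calc l * (min (W z) b * (|x z| * |e z|)) = l * (min (W z) b * |e z|) * |x z| := by ring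
          _ ≤ l * (b * L) * |x z| := by gcongr
      -- `L` contributes the power `1/η` of `log n` and the square root the power `1/2`; together
      -- they are the exponent in `RateBounds`.
      have h2 : l * (b * L) ≤ k / √(Real.log n) := by
        rw [le_div_iff₀ (by positivity)]
        calc l * (b * L) * √(Real.log n)
            = A ^ (1 / η) * (l * b * (Real.log n ^ (1 / η) * Real.log n ^ (1 / 2 : ℝ))) := by
              rw [hL, Real.mul_rpow hA0.le hlog0.le, Real.sqrt_eq_rpow]; ring
          _ = A ^ (1 / η) * (l * b * Real.log n ^ (1 / η + 1 / 2)) := by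
              rw [← Real.rpow_add hlog0]
          _ ≤ A ^ (1 / η) * (κ * R) := by
              gcongr ?_ * ?_
              exact hrate.l_mul_b
          _ ≤ k := by linarith
      calc l * (min (W z) b * |x z * e z|) ≤ l * (b * L) * |x z| := h1
        _ ≤ k / √(Real.log n) * |x z| := by gcongr
        _ = k * (|x z| / √(Real.log n)) := by ring
        _ ≤ (2 : ℕ) * (k * (|x z| / √(Real.log n))) := by
          have : 0 ≤ k * (|x z| / √(Real.log n)) := by positivity
          push_cast; linarith
    · rw [truncNoise, Set.indicator_of_notMem hz]
      simp only [ne_eq, OfNat.ofNat_ne_zero, not_false_eq_true, zero_pow, zero_mul]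
      exact sq_nonneg _

end ExponentialMoments

/-! ### Truncation and second moments of the errors -/

section Errors

variable {𝒵 Ω : Type*} [MeasurableSpace 𝒵] [MeasurableSpace Ω] {μ ν : Measure 𝒵} {n : ℕ}
    {P : Measure Ω} {Z : Fin n → Ω → 𝒵} {W : 𝒵 → ℝ} {b q θ A C Cw : ℝ}

/-- With high probability no error exceeds the truncation level. -/
lemma IsSample.truncation_probability {η : ℝ} (hη : 0 < η) (hZ : IsSample P μ Z)
    (hW : IsImportance μ ν W) (hθ : 0 < θ) (hA : 1 ≤ A) (hθA : 4 ≤ θ * A) (hb : 1 ≤ b)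
    (hn : 2 ≤ n) (hlog : 1 ≤ Real.log n) {e : 𝒵 → ℝ} (hem : Measurable e)
    (he : ExpMoment ν (fun z => θ * |e z| ^ η) C) :
    P.real {ω | ∃ t, b * (A * Real.log n) ^ (1 / η) < min (W (Z t ω)) b * |e (Z t ω)|} ≤
      (1 / η / (θ / 2)) ^ (1 / η) * C / n := by
  have hlog0 : 0 < Real.log n := by linarith
  have hn0 : (0 : ℝ) < n := by exact_mod_cast (by omega : 0 < n)
  have hb0 : 0 < b := by linarith
  have hWm := hW.measurable
  set L := (A * Real.log n) ^ (1 / η) with hL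
  have hL1 : 1 ≤ L := Real.one_le_rpow (one_le_mul_of_one_le_of_one_le hA hlog) (by positivity)
  set K := (1 / η / (θ / 2)) ^ (1 / η) with hK
  have hK0 : 0 ≤ K := by positivity
  set B : Set 𝒵 := {z | b * L < min (W z) b * |e z|} with hB
  have hBm : MeasurableSet B := measurableSet_lt (by fun_prop) (by fun_prop)
  set T : Set 𝒵 := {z | A * Real.log n < |e z| ^ η} with hT
  have hTm : MeasurableSet T := measurableSet_lt (by fun_prop) (by fun_prop)
  have hBT : ∀ z ∈ B, z ∈ T := by
    intro z hz
    by_contra hzT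
    have hzT' : |e z| ^ η ≤ A * Real.log n := not_lt.1 hzT
    have h3 := Real.rpow_le_rpow (Real.rpow_nonneg (abs_nonneg _) _) hzT'
        (by positivity : 0 ≤ 1 / η)
    rw [← Real.rpow_mul (abs_nonneg _), mul_one_div_cancel hη.ne', Real.rpow_one] at h3
    have : min (W z) b * |e z| ≤ b * L := by
      gcongr
      exact min_le_right _ _
    exact absurd hz (not_lt.2 this)
  have htail := he.integral_le_of_le (g := T.indicator fun z => |e z|)
    (K := K * (1 / (n : ℝ) ^ 2)) ((by fun_prop : Measurable fun z => |e z|).indicator hTm)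
    (fun z => Set.indicator_nonneg (fun _ _ => abs_nonneg _) _)
    (fun z => by
      by_cases hz : z ∈ T
      · have hz' : A * Real.log n < |e z| ^ η := hz
        rw [Set.indicator_of_mem hz]
        have h1 := rpow_le_const_mul_exp (by positivity : 0 < 1 / η) (half_pos hθ)
          (Real.rpow_nonneg (abs_nonneg (e z)) η)
        rw [← Real.rpow_mul (abs_nonneg _), mul_one_div_cancel hη.ne', Real.rpow_one] at h1
        rw [← hK] at h1
        have h2 := exp_neg_mul_log_le hn (by linarith : 2 ≤ θ / 2 * A)
        have h3 : 1 ≤ Real.exp (-(θ / 2 * A * Real.log n)) * Real.exp (θ / 2 * |e z| ^ η) := by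
          rw [← Real.exp_add]
          refine Real.one_le_exp ?_
          nlinarith
        calc |e z| ≤ K * Real.exp (θ / 2 * |e z| ^ η) * 1 := by linarith
          _ ≤ K * Real.exp (θ / 2 * |e z| ^ η) *
              (Real.exp (-(θ / 2 * A * Real.log n)) * Real.exp (θ / 2 * |e z| ^ η)) := by gcongr
          _ ≤ K * Real.exp (θ / 2 * |e z| ^ η) *
              (1 / (n : ℝ) ^ 2 * Real.exp (θ / 2 * |e z| ^ η)) := by gcongr
          _ = K * (1 / (n : ℝ) ^ 2) *
              (Real.exp (θ / 2 * |e z| ^ η) * Real.exp (θ / 2 * |e z| ^ η)) := by ring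
          _ = _ := by rw [← Real.exp_add]; ring_nf
      · rw [Set.indicator_of_notMem hz]
        positivity) (by positivity)
  -- On `B` one has `1 ≤ b L < W |e|`, so the training probability of `B` is bounded by a test
  -- integral of `|e|` over its tail, which the exponential moment makes `O(n⁻²)`.
  have hμB : μ.real B ≤ K * (1 / (n : ℝ) ^ 2) * C := by
    rw [← integral_indicator_one hBm]
    refine le_trans ?_ htail.2
    rw [hW.integral_eq]
    refine integral_mono_of_nonneg
      (ae_of_all _ fun z => Set.indicator_nonneg (fun _ _ => zero_le_one) _)
      ((hW.integrable_iff _).1 htail.1) (ae_of_all _ fun z => ?_)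
    change B.indicator 1 z ≤ W z * T.indicator (fun z => |e z|) z
    by_cases hz : z ∈ B
    · have hz' : b * L < min (W z) b * |e z| := hz
      rw [Set.indicator_of_mem hz, Set.indicator_of_mem (hBT z hz), Pi.one_apply]
      have h1 : 1 ≤ b * L := one_le_mul_of_one_le_of_one_le hb hL1
      have h2 : min (W z) b * |e z| ≤ W z * |e z| := by
        gcongr
        exact min_le_left _ _
      linarith
    · rw [Set.indicator_of_notMem hz]
      exact mul_nonneg (hW.nonneg z) (Set.indicator_nonneg (fun _ _ => abs_nonneg _) _)
  have hunion : {ω | ∃ t, b * L < min (W (Z t ω)) b * |e (Z t ω)|} = ⋃ t, Z t ⁻¹' B := by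
    ext ω; simp [hB]
  rw [hunion]
  calc P.real (⋃ t, Z t ⁻¹' B) ≤ ∑ t, P.real (Z t ⁻¹' B) := measureReal_iUnion_fintype_le _
    _ = ∑ _t : Fin n, μ.real B := by
        refine Finset.sum_congr rfl fun t _ => ?_
        rw [← hZ.law t, map_measureReal_apply (hZ.measurable t) hBm]
    _ = n * μ.real B := by simp
    _ ≤ n * (K * (1 / (n : ℝ) ^ 2) * C) := by gcongr
    _ = K * C / n := by field_simp

variable [IsProbabilityMeasure P]

/-- Law of large numbers for weighted means of squared errors. -/
lemma IsSample.deviation_sq (hZ : IsSample P μ Z) (hW : IsImportance μ ν W) (hn : 0 < n)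
    (hb : 0 < b) (hq : 0 < q)
    (hWq : Integrable (fun z => W z ^ q) ν) (hWC : ∫ z, W z ^ q ∂ν ≤ Cw)
    {e : 𝒵 → ℝ} (hem : Measurable e) (he2 : Integrable (fun z => e z ^ 2) ν)
    (he4 : Integrable (fun z => e z ^ 4) ν)
    (hC : ∫ z, e z ^ 4 ∂ν ≤ C) {τ : ℝ} (hτ : 0 < τ) (hbias : b ^ (-(q / 2)) * (Cw + C) ≤ τ) :
    P.real {ω | 2 * τ ≤ |(n : ℝ)⁻¹ * ∑ t, min (W (Z t ω)) b * e (Z t ω) ^ 2 -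
      ∫ z, e z ^ 2 ∂ν|} ≤ b / n * (C / τ ^ 2) := by
  have hn0 : (0 : ℝ) < n := by exact_mod_cast hn
  have hWm := hW.measurable
  have hv0 : ∀ z, 0 ≤ min (W z) b := fun z => le_min (hW.nonneg z) hb.le
  set φ : 𝒵 → ℝ := fun z => min (W z) b * e z ^ 2 with hφ
  have hφm : Measurable φ := by fun_prop
  have hsq : ∀ z, φ z ^ 2 ≤ W z * (b * e z ^ 4) := by
    intro z
    calc φ z ^ 2 = min (W z) b * (min (W z) b * e z ^ 4) := by rw [hφ]; ring
      _ ≤ W z * (b * e z ^ 4) := by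
        have := hv0 z
        gcongr
        · exact hW.nonneg z
        · exact min_le_left _ _
        · exact min_le_right _ _
  have hmaj := (hW.integrable_iff _).1 (he4.const_mul b)
  have hφ2 : Integrable (fun z => φ z ^ 2) μ := hmaj.mono' (by fun_prop) (ae_of_all _ fun z => by
    rw [Real.norm_eq_abs, abs_of_nonneg (sq_nonneg _)]
    exact hsq z)
  have hφint : ∫ z, φ z ^ 2 ∂μ ≤ b * C := by
    refine (integral_mono_of_nonneg (ae_of_all _ fun z => sq_nonneg _) hmaj
      (ae_of_all _ hsq)).trans ?_
    rw [← hW.integral_eq, integral_const_mul]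
    gcongr
  have hφL : MemLp φ 2 μ := (memLp_two_iff_integrable_sq hφm.aestronglyMeasurable).2 hφ2
  set X : Fin n → Ω → ℝ := fun t ω => φ (Z t ω) with hX
  have hXL : ∀ t, MemLp (X t) 2 P := fun t => by
    have h := hφL
    rw [← hZ.law t] at h
    exact h.comp_of_map (hZ.measurable t).aemeasurable
  have hXi : iIndepFun X P := hZ.indep.comp (fun _ => φ) fun _ => hφm
  have hvarX : ∀ t, Var[X t; P] ≤ b * C := fun t => by
    refine (variance_le_expectation_sq (hXL t).aestronglyMeasurable).trans ?_
    refine le_trans (le_of_eq ?_) hφint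
    rw [← hZ.law t, integral_map (hZ.measurable t).aemeasurable
      (by rw [hZ.law t]; exact hφ2.aestronglyMeasurable)]
    rfl
  have hEX : ∀ t, ∫ ω, X t ω ∂P = ∫ z, φ z ∂μ := fun t => by
    rw [← hZ.law t, integral_map (hZ.measurable t).aemeasurable hφm.aestronglyMeasurable]
  set S : Ω → ℝ := ∑ t, X t with hS
  have hSL : MemLp S 2 P := memLp_finsetSum' _ fun t _ => hXL t
  have hvarS : Var[S; P] ≤ n * (b * C) := by
    rw [hS, IndepFun.variance_sum (fun t _ => hXL t) (fun i _ j _ hij => hXi.indepFun hij)]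
    calc ∑ t, Var[X t; P] ≤ ∑ _t : Fin n, b * C := Finset.sum_le_sum fun t _ => hvarX t
      _ = n * (b * C) := by simp
  have hES : ∫ ω, S ω ∂P = n * ∫ z, φ z ∂μ := by
    have : ∀ ω, S ω = ∑ t, X t ω := fun ω => by simp [hS]
    simp only [this]
    rw [integral_finsetSum _ fun t _ => (hXL t).integrable one_le_two]
    simp [hEX]
  -- Chebyshev suffices here: there is no union over covariates, only consistency is needed, and the
  -- variance is of order `b / n`.
  have hcheb := meas_ge_le_variance_div_sq hSL (c := n * τ) (by positivity)
  have hbias' : |∫ z, φ z ∂μ - ∫ z, e z ^ 2 ∂ν| ≤ τ := by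
    have hbq : 0 < b ^ (-(q / 2)) := Real.rpow_pos_of_pos hb _
    have h1 := hW.abs_integral_trunc_sub_le hb.le (h := fun z => e z ^ 2)
      (U := fun z => b ^ (-(q / 2)) * (W z ^ q + e z ^ 4)) (by fun_prop) he2
      ((hWq.add he4).const_mul _)
      (fun z => by
        have h3 : 0 ≤ W z ^ q := Real.rpow_nonneg (hW.nonneg z) _
        positivity)
      (fun z hz => by
        have h2 : b ^ q ≤ W z ^ q := Real.rpow_le_rpow hb.le hz.le hq.le
        have h3 : b ^ (q / 2) * b ^ (q / 2) = b ^ q := by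
          rw [← Real.rpow_add hb]; ring_nf
        have h4 : b ^ (-(q / 2)) * b ^ (q / 2) = 1 := by
          rw [← Real.rpow_add hb]; simp
        set a := b ^ (-(q / 2)) with ha
        -- Where `W > b`, `e² g ≤ g² + e⁴ ≤ W^q + e⁴`, so the bias gains the factor `b^{-q/2}`.
        set g := b ^ (q / 2) with hg
        have hg0 : 0 < g := Real.rpow_pos_of_pos hb _
        rw [abs_of_nonneg (sq_nonneg _)]
        have h5 : e z ^ 2 * 1 ≤ a * (g * g + e z ^ 4) := by
          rw [← h4]
          have h6 : e z ^ 2 * g ≤ g * g + e z ^ 4 := by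
            nlinarith [sq_nonneg (e z ^ 2 - g), sq_nonneg (e z ^ 2), sq_nonneg g]
          calc e z ^ 2 * (a * g) = a * (e z ^ 2 * g) := by ring
            _ ≤ _ := by gcongr
        rw [mul_one] at h5
        refine h5.trans ?_
        gcongr
        rw [h3]; exact h2)
    refine h1.trans (le_trans ?_ hbias)
    rw [integral_const_mul, integral_add hWq he4]
    gcongr
  have hfin : P.real {ω | 2 * τ ≤ |(n : ℝ)⁻¹ * ∑ t, min (W (Z t ω)) b * e (Z t ω) ^ 2 -
      ∫ z, e z ^ 2 ∂ν|} ≤ P.real {ω | n * τ ≤ |S ω - ∫ ω, S ω ∂P|} := by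
    refine measureReal_mono fun ω hω => ?_
    simp only [Set.mem_ofPred_eq] at hω ⊢
    have h1 : S ω = ∑ t, min (W (Z t ω)) b * e (Z t ω) ^ 2 := by simp [hS, hX, hφ]
    rw [hES, h1]
    have h2 := abs_sub_le ((n : ℝ)⁻¹ * ∑ t, min (W (Z t ω)) b * e (Z t ω) ^ 2)
      (∫ z, φ z ∂μ) (∫ z, e z ^ 2 ∂ν)
    have h3 : ∑ t, min (W (Z t ω)) b * e (Z t ω) ^ 2 - n * ∫ z, φ z ∂μ =
        n * ((n : ℝ)⁻¹ * ∑ t, min (W (Z t ω)) b * e (Z t ω) ^ 2 - ∫ z, φ z ∂μ) := by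
      field_simp
    rw [h3, abs_mul, abs_of_pos hn0]
    gcongr
    linarith
  refine hfin.trans ?_
  have h1 : P.real {ω | n * τ ≤ |S ω - ∫ ω, S ω ∂P|} ≤ Var[S; P] / (n * τ) ^ 2 :=
    ENNReal.toReal_le_of_le_ofReal (div_nonneg (variance_nonneg _ _) (sq_nonneg _)) hcheb
  calc _ ≤ _ := h1
    _ ≤ n * (b * C) / (n * τ) ^ 2 := by gcongr
    _ = b / n * (C / τ ^ 2) := by field_simp

end Errors

/-! ### The rates -/

section RateSequences

variable {p : ℕ → ℕ}

lemma CondC1.tendsto_log (h1 : CondC1 p) :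
    Tendsto (fun n => Real.log (p n)) atTop atTop :=
  Real.tendsto_log_atTop.comp (tendsto_natCast_atTop_atTop.comp h1.2)

lemma cRate_sq {n : ℕ} (hlog : 0 ≤ Real.log (p n)) : cRate p n ^ 2 = Real.log (p n) / n :=
  Real.sq_sqrt (div_nonneg hlog n.cast_nonneg)

lemma CondC1.eventually_cRate_pos (h1 : CondC1 p) : ∀ᶠ n in atTop, 0 < cRate p n := by
  filter_upwards [h1.tendsto_log.eventually_ge_atTop 1, eventually_ge_atTop 1] with n hn hn1
  have : (0 : ℝ) < n := by exact_mod_cast hn1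
  exact Real.sqrt_pos.2 (by positivity)

/-- Since `γ < 1`, `c_n` decays polynomially; every power of `log n` is therefore negligible against
a positive power of `c_n`. -/
lemma CondC1.exists_cRate_le (h1 : CondC1 p) :
    ∃ a C : ℝ, 0 < a ∧ 0 ≤ C ∧ ∀ᶠ n : ℕ in atTop, cRate p n ≤ C * (n : ℝ) ^ (-a) := by
  obtain ⟨⟨γ, hγ0, hγ1, hO⟩, -⟩ := id h1
  obtain ⟨C, hC0, hC⟩ := hO.exists_nonneg
  refine ⟨(1 - γ) / 2, √C, by linarith, Real.sqrt_nonneg _, ?_⟩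
  filter_upwards [hC.bound, h1.tendsto_log.eventually_ge_atTop 1, eventually_ge_atTop 1]
    with n hn hlp hn1
  have hn0 : (0 : ℝ) < n := by exact_mod_cast hn1
  rw [Real.norm_of_nonneg (by linarith), Real.norm_of_nonneg (by positivity)] at hn
  rw [cRate, Real.sqrt_le_left (by positivity), mul_pow, Real.sq_sqrt hC0, ← Real.rpow_natCast,
    ← Real.rpow_mul hn0.le, div_le_iff₀ hn0]
  calc Real.log (p n) ≤ C * (n : ℝ) ^ γ := hn
    _ = C * ((n : ℝ) ^ (-((1 - γ) / 2) * (2 : ℕ)) * (n : ℝ) ^ (1 : ℝ)) := by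
        rw [← Real.rpow_add hn0]; push_cast; ring_nf
    _ = _ := by rw [Real.rpow_one]; ring

lemma CondC1.tendsto_cRate_rpow_mul_log (h1 : CondC1 p) {ρ : ℝ} (hρ : 0 < ρ) (t : ℝ) :
    Tendsto (fun n : ℕ => cRate p n ^ ρ * Real.log n ^ t) atTop (𝓝 0) := by
  obtain ⟨a, C, ha, hC, hle⟩ := h1.exists_cRate_le
  have hlim : Tendsto (fun n : ℕ => C ^ ρ * (Real.log n ^ t / (n : ℝ) ^ (a * ρ))) atTop (𝓝 0) := by
    have h := ((isLittleO_log_rpow_rpow_atTop t (by positivity : 0 < a * ρ)).tendsto_div_nhds_zero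
      |>.comp tendsto_natCast_atTop_atTop).const_mul (C ^ ρ)
    simpa using h
  refine squeeze_zero' (Eventually.of_forall fun n => ?_) ?_ hlim
  · exact mul_nonneg (Real.rpow_nonneg (Real.sqrt_nonneg _) _)
      (Real.rpow_nonneg (Real.log_natCast_nonneg n) _)
  · filter_upwards [hle] with n hn
    have h2 : cRate p n ^ ρ ≤ C ^ ρ * ((n : ℝ) ^ (a * ρ))⁻¹ := by
      calc cRate p n ^ ρ ≤ (C * (n : ℝ) ^ (-a)) ^ ρ :=
            Real.rpow_le_rpow (Real.sqrt_nonneg _) hn hρ.le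
        _ = C ^ ρ * ((n : ℝ) ^ (a * ρ))⁻¹ := by
            rw [Real.mul_rpow hC (by positivity), ← Real.rpow_mul (by positivity),
              ← Real.rpow_neg (by positivity), neg_mul]
    calc _ ≤ C ^ ρ * ((n : ℝ) ^ (a * ρ))⁻¹ * Real.log n ^ t :=
          mul_le_mul_of_nonneg_right h2 (Real.rpow_nonneg (Real.log_natCast_nonneg n) _)
      _ = _ := by ring

lemma CondC1.tendsto_cRate (h1 : CondC1 p) : Tendsto (cRate p) atTop (𝓝 0) := by
  simpa using h1.tendsto_cRate_rpow_mul_log one_pos 0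

lemma eventually_one_le_log : ∀ᶠ n : ℕ in atTop, 1 ≤ Real.log n :=
  (Real.tendsto_log_atTop.comp tendsto_natCast_atTop_atTop).eventually_ge_atTop 1

lemma CondC1.eventually_inv_le (h1 : CondC1 p) : ∀ᶠ n : ℕ in atTop, 1 / (n : ℝ) ≤ cRate p n ^ 2 := by
  filter_upwards [h1.tendsto_log.eventually_ge_atTop 1] with n hlp
  rw [cRate_sq (by linarith)]
  gcongr

variable {q η : ℝ}

lemma CondC1.eventually_cRate_le_dRate (h1 : CondC1 p) (hη : 0 < η) (hq : 0 < q) :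
    ∀ᶠ n in atTop, cRate p n ≤ dRate p q η n := by
  filter_upwards [h1.eventually_cRate_pos, h1.tendsto_cRate.eventually_le_const one_pos,
    eventually_one_le_log] with n hc hc1 hlog
  rw [dRate]
  split_ifs with h
  · have h2 : cRate p n ≤ cRate p n ^ (2 * q / (1 + q)) := by
      calc cRate p n = cRate p n ^ (1 : ℝ) := (Real.rpow_one _).symm
        _ ≤ _ := Real.rpow_le_rpow_of_exponent_ge hc hc1 (by
          rw [div_le_one (by linarith)]; linarith)
    refine h2.trans (le_mul_of_one_le_right (by positivity) ?_)
    exact Real.one_le_rpow hlog (by positivity)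
  · exact le_rfl

lemma CondC1.tendsto_dRate (h1 : CondC1 p) (hη : 0 < η) (hq : 0 < q) :
    Tendsto (dRate p q η) atTop (𝓝[>] 0) := by
  refine tendsto_nhdsWithin_iff.2 ⟨?_, ?_⟩
  · by_cases h : q ≤ 1
    · have := h1.tendsto_cRate_rpow_mul_log (by positivity : 0 < 2 * q / (1 + q)) (1 / η + 1 / 2)
      refine this.congr fun n => ?_
      rw [dRate, if_pos h]
    · refine h1.tendsto_cRate.congr fun n => ?_
      rw [dRate, if_neg h]
  · filter_upwards [h1.eventually_cRate_pos, h1.eventually_cRate_le_dRate hη hq] with n h2 h3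
    exact h2.trans_le h3

variable {Mw Mη : ℝ}

/-- One form for both regimes of `q`. Positivity of `ρ` makes the trimming level diverge; `ρ < 2`
makes it `o(n)`, because `1/n ≤ c_n²` eventually. -/
lemma exists_trimLevel_eq (hq : 0 < q) : ∃ ρ t : ℝ, 0 < ρ ∧ ρ < 2 ∧ ∀ n : ℕ,
    trimLevel p q Mw Mη n = Mw * cRate p n ^ (-ρ) * Real.log n ^ (-t) := by
  by_cases h : q ≤ 1
  · refine ⟨2 / (1 + q), 0, by positivity, by rw [div_lt_iff₀ (by linarith)]; linarith,
      fun n => ?_⟩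
    rw [trimLevel, if_pos h, neg_zero, Real.rpow_zero, mul_one]
  · refine ⟨1, Mη, one_pos, one_lt_two, fun n => ?_⟩
    rw [trimLevel, if_neg h, Real.rpow_neg_one]

lemma CondC1.tendsto_trimLevel (h1 : CondC1 p) (hq : 0 < q) (hMw : 0 < Mw) :
    Tendsto (trimLevel p q Mw Mη) atTop atTop := by
  obtain ⟨ρ, t, hρ, -, heq⟩ := exists_trimLevel_eq (p := p) (Mw := Mw) (Mη := Mη) hq
  have h2 : Tendsto (fun n : ℕ => Mw⁻¹ * (cRate p n ^ ρ * Real.log n ^ t)) atTop (𝓝[>] 0) := by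
    refine tendsto_nhdsWithin_iff.2
      ⟨by simpa using (h1.tendsto_cRate_rpow_mul_log hρ t).const_mul Mw⁻¹, ?_⟩
    filter_upwards [h1.eventually_cRate_pos, eventually_one_le_log] with n hc hlog
    have : 0 < Real.log n := by linarith
    simp only [Set.mem_Ioi]
    positivity
  refine (tendsto_inv_nhdsGT_zero.comp h2).congr' ?_
  filter_upwards [h1.eventually_cRate_pos, eventually_one_le_log] with n hc hlog
  rw [heq n, Function.comp_apply, mul_inv, inv_inv, mul_inv,
    Real.rpow_neg hc.le, Real.rpow_neg (by linarith), mul_assoc]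

lemma CondC1.tendsto_trimLevel_div (h1 : CondC1 p) (hq : 0 < q) (hMw : 0 < Mw) :
    Tendsto (fun n : ℕ => trimLevel p q Mw Mη n / n) atTop (𝓝 0) := by
  obtain ⟨ρ, t, -, hρ, heq⟩ := exists_trimLevel_eq (p := p) (Mw := Mw) (Mη := Mη) hq
  have h2 : Tendsto (fun n : ℕ => Mw * (cRate p n ^ (2 - ρ) * Real.log n ^ (-t))) atTop (𝓝 0) := by
    simpa using (h1.tendsto_cRate_rpow_mul_log (by linarith : 0 < 2 - ρ) (-t)).const_mul Mw
  refine squeeze_zero' ?_ ?_ h2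
  · filter_upwards [(h1.tendsto_trimLevel (Mη := Mη) hq hMw).eventually_ge_atTop 0] with n hn
    positivity
  · filter_upwards [h1.eventually_cRate_pos, eventually_one_le_log, h1.eventually_inv_le]
      with n hc hlog hinv
    have hlog0 : 0 < Real.log n := by linarith
    rw [heq n]
    calc Mw * cRate p n ^ (-ρ) * Real.log n ^ (-t) / n
        = Mw * cRate p n ^ (-ρ) * Real.log n ^ (-t) * (1 / n) := by ring
      _ ≤ Mw * cRate p n ^ (-ρ) * Real.log n ^ (-t) * cRate p n ^ 2 := by gcongr
      _ = _ := by
        rw [sub_eq_neg_add, Real.rpow_add hc, Real.rpow_two]; ring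

/-- Here the definitions of `d_n` and `b_n` pay off. For `q ≤ 1` the powers of `c_n` match exactly,
mainly through `c² · c^{-2/(1+q)} = c^{2q/(1+q)}`; for `q > 1` the factor `(log n)^{-Mη}` controls
the range. The three summands of the last constant serve `l_mul_b`, `variance'` and `bias`
respectively. -/
theorem CondC1.eventually_rateBounds (h1 : CondC1 p) (hη : 0 < η) (hq : 0 < q) (hMw : 0 < Mw)
    (hMη : 1 / η + 1 / 2 ≤ Mη) :
    ∀ᶠ n in atTop, ∀ κ, 0 < κ → RateBounds n (Real.log (p n)) (dRate p q η n)
      (trimLevel p q Mw Mη n) (κ * cRate p n ^ 2 / dRate p q η n) (1 / η + 1 / 2) q κ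
      (Mw + Mw ^ (1 - q) + Mw ^ (-q)) := by
  -- For `q > 1` the truncation bias is `c^q` times logarithms; the surplus power `c^{q-1}` absorbs
  -- them.
  have hlate : ∀ᶠ n : ℕ in atTop,
      1 < q → cRate p n ^ (q - 1) * Real.log n ^ (1 / η + 1 / 2 + q * Mη) ≤ 1 := by
    by_cases h : 1 < q
    · filter_upwards [(h1.tendsto_cRate_rpow_mul_log (sub_pos.2 h)
        (1 / η + 1 / 2 + q * Mη)).eventually_le_const one_pos] with n hn _ using hn
    · exact Eventually.of_forall fun n h' => absurd h' h
  filter_upwards [h1.eventually_cRate_pos, h1.tendsto_cRate.eventually_le_const one_pos,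
    eventually_one_le_log, h1.eventually_inv_le, h1.tendsto_log.eventually_ge_atTop 1,
    h1.eventually_cRate_le_dRate hη hq, (h1.tendsto_trimLevel (Mη := Mη) hq hMw).eventually_ge_atTop 1,
    (h1.tendsto_trimLevel_div (Mη := Mη) hq hMw).eventually_le_const one_pos,
    eventually_ge_atTop 2, hlate]
    with n hc hc1 hlog hinv hlp hcd hb hbn hn hlaten κ hκ
  have hn0 : (0 : ℝ) < n := by exact_mod_cast (by omega : 0 < n)
  have hlog0 : 0 < Real.log n := by linarith
  have hnc : n * cRate p n ^ 2 = Real.log (p n) := by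
    rw [cRate_sq (by linarith)]; field_simp
  have hd : 0 < dRate p q η n := hc.trans_le hcd
  have hratio : cRate p n ^ 2 / dRate p q η n ^ 2 ≤ 1 := by
    rw [div_le_one (by positivity)]
    gcongr
  have hM1 : 0 < Mw ^ (1 - q) := Real.rpow_pos_of_pos hMw _
  have hM2 : 0 < Mw ^ (-q) := Real.rpow_pos_of_pos hMw _
  set c := cRate p n with hcdef
  set d := dRate p q η n with hddef
  set b := trimLevel p q Mw Mη n with hbdef
  set r := 1 / η + 1 / 2 with hr
  have hr0 : 0 < r := by positivity
  clear_value r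
  have hq1 : 1 + q ≠ 0 := by positivity
  refine ⟨hn, hlog, by linarith, hd, hb, by rwa [div_le_one hn0] at hbn, by positivity, ?_, ?_, ?_,
    ?_, ?_, ?_⟩
  · rw [← hnc]; field_simp
  · have hmain : c ^ 2 / d * b * Real.log n ^ r ≤ Mw := by
      by_cases h : q ≤ 1
      · rw [hddef, dRate, if_pos h, hbdef, trimLevel, if_pos h, ← hcdef, ← hr]
        have h2 : c ^ 2 * c ^ (-(2 / (1 + q))) = c ^ (2 * q / (1 + q)) := by
          rw [← Real.rpow_two, ← Real.rpow_add hc]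
          congr 1; field_simp; ring
        have h3 : 0 < c ^ (2 * q / (1 + q)) := Real.rpow_pos_of_pos hc _
        have h4 : 0 < Real.log n ^ r := Real.rpow_pos_of_pos hlog0 _
        refine le_of_eq ?_
        calc c ^ 2 / (c ^ (2 * q / (1 + q)) * Real.log n ^ r) * (Mw * c ^ (-(2 / (1 + q)))) *
              Real.log n ^ r
            = Mw * (c ^ 2 * c ^ (-(2 / (1 + q)))) / c ^ (2 * q / (1 + q)) := by field_simp
          _ = Mw := by rw [h2]; field_simp
      · rw [hddef, dRate, if_neg h, hbdef, trimLevel, if_neg h, ← hcdef]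
        calc c ^ 2 / c * (Mw * c⁻¹ * Real.log n ^ (-Mη)) * Real.log n ^ r
            = Mw * (Real.log n ^ (-Mη) * Real.log n ^ r) := by field_simp
          _ = Mw * Real.log n ^ (-Mη + r) := by rw [Real.rpow_add hlog0]
          _ ≤ Mw * 1 := by
              gcongr
              exact Real.rpow_le_one_of_one_le_of_nonpos hlog (by linarith)
          _ = Mw := mul_one _
    calc κ * c ^ 2 / d * b * Real.log n ^ r = κ * (c ^ 2 / d * b * Real.log n ^ r) := by ring
      _ ≤ κ * (Mw + Mw ^ (1 - q) + Mw ^ (-q)) := by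
        gcongr
        linarith
  · calc n * (κ * c ^ 2 / d) ^ 2 = κ ^ 2 * (n * c ^ 2) * (c ^ 2 / d ^ 2) := by ring
      _ ≤ κ ^ 2 * (n * c ^ 2) * 1 := by gcongr
      _ = _ := by rw [hnc, mul_one]
  · intro h
    have hmain : c ^ 2 / d ^ 2 * (b ^ (1 - q) * (Real.log n ^ r) ^ 2) = Mw ^ (1 - q) := by
      rw [hddef, dRate, if_pos h, hbdef, trimLevel, if_pos h, ← hcdef, ← hr,
        Real.mul_rpow hMw.le (by positivity), ← Real.rpow_mul hc.le]
      have h2 : c ^ 2 * c ^ (-(2 / (1 + q)) * (1 - q)) = (c ^ (2 * q / (1 + q))) ^ 2 := by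
        rw [← Real.rpow_two, ← Real.rpow_two, ← Real.rpow_add hc, ← Real.rpow_mul hc.le]
        congr 1; field_simp; ring
      have h3 : 0 < c ^ (2 * q / (1 + q)) := Real.rpow_pos_of_pos hc _
      have h4 : 0 < Real.log n ^ r := Real.rpow_pos_of_pos hlog0 _
      calc c ^ 2 / (c ^ (2 * q / (1 + q)) * Real.log n ^ r) ^ 2 *
            (Mw ^ (1 - q) * c ^ (-(2 / (1 + q)) * (1 - q)) * (Real.log n ^ r) ^ 2)
          = Mw ^ (1 - q) * (c ^ 2 * c ^ (-(2 / (1 + q)) * (1 - q))) /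
            (c ^ (2 * q / (1 + q))) ^ 2 := by field_simp
        _ = Mw ^ (1 - q) := by rw [h2]; field_simp
    calc n * (κ * c ^ 2 / d) ^ 2 * (b ^ (1 - q) * (Real.log n ^ r) ^ 2)
        = κ ^ 2 * (n * c ^ 2) * (c ^ 2 / d ^ 2 * (b ^ (1 - q) * (Real.log n ^ r) ^ 2)) := by ring
      _ = κ ^ 2 * Mw ^ (1 - q) * Real.log (p n) := by rw [hmain, hnc]; ring
      _ ≤ _ := by
        gcongr
        linarith
  · have hmain : Real.log n ^ r * b ^ (-q) ≤ Mw ^ (-q) * d := by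
      by_cases h : q ≤ 1
      · rw [hddef, dRate, if_pos h, hbdef, trimLevel, if_pos h, ← hcdef, ← hr,
          Real.mul_rpow hMw.le (by positivity), ← Real.rpow_mul hc.le]
        have h2 : -(2 / (1 + q)) * -q = 2 * q / (1 + q) := by ring
        rw [h2]
        exact le_of_eq (by ring)
      · rw [hddef, dRate, if_neg h, hbdef, trimLevel, if_neg h, ← hcdef,
          Real.mul_rpow (by positivity) (by positivity), Real.mul_rpow hMw.le (by positivity),
          ← Real.rpow_mul hlog0.le, ← Real.rpow_neg_one, ← Real.rpow_mul hc.le]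
        calc Real.log n ^ r * (Mw ^ (-q) * c ^ (-1 * -q) * Real.log n ^ (-Mη * -q))
            = Mw ^ (-q) * (c ^ (q - 1 + 1) * (Real.log n ^ r * Real.log n ^ (q * Mη))) := by
              rw [sub_add_cancel, neg_one_mul, neg_neg, neg_mul_neg, mul_comm Mη]; ring
          _ = Mw ^ (-q) * ((c ^ (q - 1) * Real.log n ^ (r + q * Mη)) * c) := by
              rw [Real.rpow_add hc, Real.rpow_one, Real.rpow_add hlog0]; ring
          _ ≤ Mw ^ (-q) * (1 * c) := by
              gcongr
              exact hlaten (not_le.1 h)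
          _ = _ := by rw [one_mul]
    refine hmain.trans ?_
    gcongr
    linarith
  · refine hinv.trans (le_trans ?_ hcd)
    nlinarith

end RateSequences

/-! ### Populations with exponential moments -/

namespace Population

variable {p : ℕ} (M : Population p)

lemma measurable_importance : Measurable M.importance := M.measurable_fTe.div M.measurable_fTr

lemma measurable_regression : Measurable M.regression :=
  (StronglyMeasurable.integral_kernel (κ := M.cond) stronglyMeasurable_id).measurable

/-- The common support is what makes the importance a genuine density: where `fTr` vanishes so does
`fTe`, and the default value `0 / 0 = 0` is harmless. -/
lemma inputTe_eq_withDensity :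
    M.inputTe = M.inputTr.withDensity fun x => ENNReal.ofReal (M.importance x) := by
  rw [inputTe, inputTr, ← withDensity_mul _ M.measurable_fTr.ennreal_ofReal
    M.measurable_importance.ennreal_ofReal]
  congr 1
  funext x
  rw [Pi.mul_apply, ← ENNReal.ofReal_mul (M.fTr_nonneg x), importance]
  rcases (M.fTr_nonneg x).eq_or_lt with h | h
  · have h2 : M.fTe x = 0 := le_antisymm
      (not_lt.1 fun h3 => ((M.common_support x).2 h3).ne h) (M.fTe_nonneg x)
    simp [h2]
  · rw [mul_div_cancel₀ _ h.ne']

instance : IsProbabilityMeasure M.lawTr := by unfold lawTr; infer_instance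

instance : IsProbabilityMeasure M.lawTe := by unfold lawTe; infer_instance

lemma isImportance_lawTe : IsImportance M.lawTr M.lawTe fun z => M.importance z.1 where
  measurable := M.measurable_importance.comp measurable_fst
  nonneg z := M.importance_nonneg z.1
  eq_withDensity := by
    have hW : Measurable fun z : (Fin p → ℝ) × ℝ => ENNReal.ofReal (M.importance z.1) :=
      (M.measurable_importance.comp measurable_fst).ennreal_ofReal
    ext s hs
    rw [lawTe, Measure.compProd_apply hs, inputTe_eq_withDensity,
      lintegral_withDensity_eq_lintegral_mul _ M.measurable_importance.ennreal_ofReal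
        (Kernel.measurable_kernel_prodMk_left hs), withDensity_apply _ hs,
      ← lintegral_indicator hs, lawTr, Measure.lintegral_compProd (hW.indicator hs)]
    refine lintegral_congr fun x => ?_
    have h : ∀ y, s.indicator (fun z => ENNReal.ofReal (M.importance z.1)) (x, y) =
        (Prod.mk x ⁻¹' s).indicator (fun _ => ENNReal.ofReal (M.importance x)) y := fun y => rfl
    simp only [h, lintegral_indicator_const (measurable_prodMk_left hs), Pi.mul_apply]

lemma map_fst_lawTe : M.lawTe.map Prod.fst = M.inputTe := Measure.fst_compProd _ _

variable {M}

lemma integrable_fst_lawTe {f : (Fin p → ℝ) → ℝ} (hf : Integrable f M.inputTe) :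
    Integrable (fun z => f z.1) M.lawTe := by
  rw [← M.map_fst_lawTe] at hf
  exact hf.comp_measurable measurable_fst

lemma integral_fst_lawTe {f : (Fin p → ℝ) → ℝ} (hf : Measurable f) :
    ∫ z, f z.1 ∂M.lawTe = ∫ x, f x ∂M.inputTe := by
  rw [← M.map_fst_lawTe, integral_map measurable_fst.aemeasurable hf.aestronglyMeasurable]

end Population

lemma measurable_linPred {p : ℕ} (α : ℝ) (β : Fin p → ℝ) : Measurable (linPred α β) := by
  unfold linPred dotProduct
  fun_prop

lemma measurable_withOne_apply {p : ℕ} (i : Fin (p + 1)) :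
    Measurable fun x : Fin p → ℝ => withOne x i := by
  refine Fin.cases ?_ (fun j => ?_) i
  · simp
  · simpa using measurable_pi_apply j

section Integrals

variable {𝒵 : Type*} [MeasurableSpace 𝒵] {ν : Measure 𝒵}

lemma integrable_of_lintegral_le {f : 𝒵 → ℝ} (hf : Measurable f) (hf0 : ∀ z, 0 ≤ f z) {C : ℝ}
    (hC : 0 ≤ C) (h : ∫⁻ z, ENNReal.ofReal (f z) ∂ν ≤ ENNReal.ofReal C) :
    Integrable f ν ∧ ∫ z, f z ∂ν ≤ C := by
  refine ⟨⟨hf.aestronglyMeasurable, ?_⟩, ?_⟩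
  · rw [hasFiniteIntegral_iff_ofReal (ae_of_all _ hf0)]
    exact h.trans_lt ENNReal.ofReal_lt_top
  · rw [integral_eq_lintegral_of_nonneg_ae (ae_of_all _ hf0) hf.aestronglyMeasurable]
    exact ENNReal.toReal_le_of_le_ofReal hC h

lemma exists_eventually_le_of_limsup_lt_top {u : ℕ → ENNReal} (h : limsup u atTop < ⊤) :
    ∃ C : ℝ, 0 ≤ C ∧ ∀ᶠ n in atTop, u n ≤ ENNReal.ofReal C := by
  obtain ⟨C, hC, -⟩ := ENNReal.lt_iff_exists_nnreal_btwn.1 h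
  refine ⟨C, C.2, ?_⟩
  filter_upwards [eventually_lt_of_limsup_lt hC] with n hn
  rw [ENNReal.ofReal_coe_nnreal]
  exact hn.le

end Integrals

/-- Exponential moments of the products of the inputs and of the error in the test population, and
moments of the importance. -/
structure TailBounds {p : ℕ} (M : Population p) (α : ℝ) (β : Fin p → ℝ) (θ η q C Cw : ℝ) : Prop where
  input : ∀ i j, ExpMoment M.inputTe (fun x => θ * |withOne x i * withOne x j|) C
  noise : ExpMoment M.lawTe (fun z => θ * |z.2 - linPred α β z.1| ^ η) C
  weight_integrable : Integrable (fun x => M.importance x ^ q) M.inputTe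
  weight_le : ∫ x, M.importance x ^ q ∂M.inputTe ≤ Cw

lemma exists_eventually_tailBounds {p : ℕ → ℕ} {M : ∀ n, Population (p n)} {α : ℕ → ℝ}
    {β : ∀ n, Fin (p n) → ℝ} {θ η q : ℝ} (h2 : CondC2 M α β θ η) (h3 : CondC3 M q) :
    ∃ C Cw : ℝ, 0 ≤ C ∧ 0 ≤ Cw ∧
      ∀ᶠ n in atTop, TailBounds (M n) (α n) (β n) θ η q C Cw := by
  obtain ⟨-, hn, hx⟩ := h2
  obtain ⟨C₁, hC₁, hn⟩ := exists_eventually_le_of_limsup_lt_top hn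
  obtain ⟨C₂, hC₂, hx⟩ := exists_eventually_le_of_limsup_lt_top hx
  obtain ⟨Cw, hCw, hw⟩ := exists_eventually_le_of_limsup_lt_top h3
  refine ⟨max C₁ C₂, Cw, le_max_of_le_left hC₁, hCw, ?_⟩
  filter_upwards [hn, hx, hw] with n hn hx hw
  have hw' := integrable_of_lintegral_le ((M n).measurable_importance.pow_const q)
    (fun x => Real.rpow_nonneg ((M n).importance_nonneg x) _) hCw hw
  refine ⟨fun i j => ?_, ?_, hw'.1, hw'.2⟩
  · have hi := measurable_withOne_apply i
    have hj := measurable_withOne_apply j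
    have h := integrable_of_lintegral_le (ν := (M n).inputTe)
      (f := fun x => Real.exp (θ * |withOne x i * withOne x j|)) (by fun_prop)
      (fun x => (Real.exp_pos _).le) hC₂
      ((le_iSup₂ (f := fun i j : Fin (p n + 1) => ∫⁻ x : Fin (p n) → ℝ, ENNReal.ofReal
        (Real.exp (θ * |withOne x i * withOne x j|)) ∂(M n).inputTe) i j).trans hx)
    exact ⟨h.1, h.2.trans (le_max_right _ _)⟩
  · have hl := measurable_linPred (α n) (β n)
    have hm : Measurable fun z : (Fin (p n) → ℝ) × ℝ =>
        Real.exp (θ * |z.2 - linPred (α n) (β n) z.1| ^ η) := by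
      have : Measurable fun z : (Fin (p n) → ℝ) × ℝ => |z.2 - linPred (α n) (β n) z.1| := by
        fun_prop
      exact ((this.pow_const η).const_mul θ).exp
    have h := integrable_of_lintegral_le hm (fun z => (Real.exp_pos _).le) hC₁ hn
    exact ⟨h.1, h.2.trans (le_max_left _ _)⟩

namespace TailBounds

variable {p : ℕ} {M : Population p} {α : ℝ} {β : Fin p → ℝ} {θ η q C Cw : ℝ}

lemma input_lawTe (h : TailBounds M α β θ η q C Cw) (i j : Fin (p + 1)) :
    ExpMoment M.lawTe (fun z => θ * |withOne z.1 i * withOne z.1 j|) C := by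
  have hi := measurable_withOne_apply i
  have hj := measurable_withOne_apply j
  refine ⟨Population.integrable_fst_lawTe (h.input i j).integrable, ?_⟩
  rw [Population.integral_fst_lawTe (f := fun x => Real.exp (θ * |withOne x i * withOne x j|))
    (by fun_prop)]
  exact (h.input i j).integral_le

lemma weight_lawTe (h : TailBounds M α β θ η q C Cw) :
    Integrable (fun z => M.importance z.1 ^ q) M.lawTe ∧
      ∫ z, M.importance z.1 ^ q ∂M.lawTe ≤ Cw := by
  refine ⟨Population.integrable_fst_lawTe h.weight_integrable, ?_⟩
  rw [Population.integral_fst_lawTe (M.measurable_importance.pow_const q)]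
  exact h.weight_le

lemma abs_mul_integrable (h : TailBounds M α β θ η q C Cw) (hθ : 0 < θ) (i j : Fin (p + 1)) :
    Integrable (fun x => |withOne x i * withOne x j|) M.inputTe ∧
      ∫ x, |withOne x i * withOne x j| ∂M.inputTe ≤ 1 / θ * C := by
  have hi := measurable_withOne_apply i
  have hj := measurable_withOne_apply j
  refine (h.input i j).integral_le_of_le (by fun_prop) (fun x => abs_nonneg _) (fun x => ?_)
    (by positivity)
  have := Real.add_one_le_exp (θ * |withOne x i * withOne x j|)
  rw [one_div, inv_mul_eq_div, le_div_iff₀ hθ]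
  linarith

lemma momentBound (h : TailBounds M α β θ η q C Cw) (hθ : 0 < θ) :
    M.MomentBound (1 + C / θ) := by
  have hC := (h.input 0 0).nonneg
  refine ⟨by have : 0 ≤ C / θ := by positivity
             linarith, fun i => ?_, fun i j => ?_⟩
  · rw [memLp_two_iff_integrable_sq (measurable_pi_apply i).aestronglyMeasurable]
    refine (h.abs_mul_integrable hθ i.succ i.succ).1.congr (ae_of_all _ fun x => ?_)
    simp only [withOne_succ]
    rw [abs_mul_self, sq]
  · refine abs_integral_le_integral_abs.trans ((h.abs_mul_integrable hθ i j).2.trans ?_)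
    rw [one_div_mul_eq_div]
    linarith

lemma noise_pow (h : TailBounds M α β θ η q C Cw) (hθ : 0 < θ) (hη : 0 < η) {m : ℕ} (hm : Even m)
    (hm0 : 0 < m) :
    Integrable (fun z => (z.2 - linPred α β z.1) ^ m) M.lawTe ∧
      ∫ z, (z.2 - linPred α β z.1) ^ m ∂M.lawTe ≤ ((m / η) / θ) ^ (m / η) * C := by
  have hl := measurable_linPred α β
  refine h.noise.integral_le_of_le (by fun_prop) (fun z => hm.pow_nonneg _) (fun z => ?_)
    (by positivity)
  have hm0' : (0 : ℝ) < m := by exact_mod_cast hm0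
  have h1 := rpow_le_const_mul_exp (by positivity : 0 < m / η) hθ
    (Real.rpow_nonneg (abs_nonneg (z.2 - linPred α β z.1)) η)
  rw [← Real.rpow_mul (abs_nonneg _), mul_div_cancel₀ _ hη.ne', Real.rpow_natCast,
    hm.pow_abs] at h1
  exact h1

end TailBounds

lemma linPred_add_smul_withOne {p : ℕ} (α : ℝ) (β : Fin p → ℝ) (i : Fin (p + 1)) (t : ℝ) :
    ∃ (a : ℝ) (b : Fin p → ℝ), ∀ x, linPred a b x = linPred α β x + t * withOne x i := by
  refine Fin.cases ⟨α + t, β, fun x => ?_⟩ (fun j => ⟨α, β + Pi.single j t, fun x => ?_⟩) i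
  · simp only [linPred, withOne_zero]; ring
  · simp only [linPred, withOne_succ, add_dotProduct, single_dotProduct]; ring

/-- The error of the best linear predictor is orthogonal to the inputs. -/
lemma IsBestLinearPredictor.integral_withOne_mul_eq_zero {p : ℕ} {M : Population p} {α : ℝ}
    {β : Fin p → ℝ} (hbest : IsBestLinearPredictor M α β)
    (he : MemLp (fun z => z.2 - linPred α β z.1) 2 M.lawTe) (i : Fin (p + 1))
    (hx : MemLp (fun z => withOne z.1 i) 2 M.lawTe) :
    ∫ z, withOne z.1 i * (z.2 - linPred α β z.1) ∂M.lawTe = 0 := by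
  set e : (Fin p → ℝ) × ℝ → ℝ := fun z => z.2 - linPred α β z.1 with hedef
  have hxe : Integrable (fun z => withOne z.1 i * e z) M.lawTe := hx.integrable_mul he
  set a := ∫ z, withOne z.1 i * e z ∂M.lawTe with ha
  set m := ∫ z, withOne z.1 i ^ 2 ∂M.lawTe with hm
  have hm0 : 0 ≤ m := integral_nonneg fun _ => sq_nonneg _
  have hquad : ∀ t : ℝ, 0 ≤ -(2 * t * a) + t ^ 2 * m := by
    intro t
    obtain ⟨a', b', hab⟩ := linPred_add_smul_withOne α β i t
    have h1 := hbest a' b'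
    have h2 : ∀ z : (Fin p → ℝ) × ℝ, (z.2 - linPred a' b' z.1) ^ 2 =
        e z ^ 2 + (-(2 * t) * (withOne z.1 i * e z) + t ^ 2 * withOne z.1 i ^ 2) := by
      intro z
      simp only [hedef, hab]
      ring
    have hint : Integrable (fun z : (Fin p → ℝ) × ℝ =>
        -(2 * t) * (withOne z.1 i * e z) + t ^ 2 * withOne z.1 i ^ 2) M.lawTe :=
      (hxe.const_mul _).add (hx.integrable_sq.const_mul _)
    have hint' : Integrable (fun z : (Fin p → ℝ) × ℝ => (z.2 - linPred a' b' z.1) ^ 2) M.lawTe := by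
      simp only [h2]
      exact he.integrable_sq.add hint
    rw [← ofReal_integral_eq_lintegral_ofReal he.integrable_sq (ae_of_all _ fun _ => sq_nonneg _),
      ← ofReal_integral_eq_lintegral_ofReal hint' (ae_of_all _ fun _ => sq_nonneg _),
      ENNReal.ofReal_le_ofReal_iff (integral_nonneg fun _ => sq_nonneg _)] at h1
    simp only [h2] at h1
    rw [integral_add he.integrable_sq hint, integral_add (hxe.const_mul _)
      (hx.integrable_sq.const_mul _), integral_const_mul, integral_const_mul] at h1
    linarith
  -- The minimizing step would be `a / m`; using `m + 1` avoids a separate case `m = 0` and still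
  -- gives a contradiction unless `a = 0`.
  have h1 := hquad (a / (m + 1))
  have h2 : -(2 * (a / (m + 1)) * a) + (a / (m + 1)) ^ 2 * m =
      -(a ^ 2 * (m + 2) / (m + 1) ^ 2) := by
    field_simp
    ring
  rw [h2] at h1
  by_contra ha0
  have : 0 < a ^ 2 * (m + 2) / (m + 1) ^ 2 := by positivity
  linarith

/-- Independence passes from (error, input) to (input, response) because the response is a fixed
measurable function of the former pair. -/
lemma CondC4.isSample {p : ℕ → ℕ} {M : ∀ n, Population (p n)} {Ω : ℕ → Type*}
    [∀ n, MeasurableSpace (Ω n)] {P : ∀ n, Measure (Ω n)} {X : ∀ n, Fin n → Ω n → (Fin (p n) → ℝ)}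
    {Y : ∀ n, Fin n → Ω n → ℝ} (h4 : CondC4 M P X Y) (n : ℕ) :
    IsSample (P n) (M n).lawTr fun t ω => (X n t ω, Y n t ω) := by
  obtain ⟨hX, hY, hlaw, hind⟩ := h4 n
  have hreg := (M n).measurable_regression
  refine ⟨fun t => (hX t).prodMk (hY t), hlaw, ?_⟩
  have h := hind.comp (fun _ u => (u.2, u.1 + (M n).regression u.2)) fun _ => by fun_prop
  convert h using 2 with t
  funext ω
  simp

/-! ### Samples are good with high probability -/

universe u

/-- Union bound. When no weighted error exceeds `b L`, truncated and untruncated noise products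
agree at every sample point, which is why the noise may be truncated beforehand. -/
lemma IsSample.goodSample_probability {n p : ℕ} {Ω : Type u} [MeasurableSpace Ω] {P : Measure Ω}
    [IsProbabilityMeasure P] {M : Population p} {α : ℝ} {β : Fin p → ℝ}
    {X : Fin n → Ω → (Fin p → ℝ)} {Y : Fin n → Ω → ℝ} {b L a s₀ τ : ℝ} {δ₁ δ₂ δ₃ δ₄ : ℝ}
    (hinput : ∀ i j : Fin (p + 1), P.real {ω | a ≤ |(n : ℝ)⁻¹ * ∑ t,
      min (M.importance (X t ω)) b * (withOne (X t ω) i * withOne (X t ω) j) - M.moment i j|} ≤ δ₁)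
    (hnoise : ∀ i : Fin (p + 1), P.real {ω | a ≤ |(n : ℝ)⁻¹ * ∑ t,
      min (M.importance (X t ω)) b *
        truncNoise (fun z : (Fin p → ℝ) × ℝ => M.importance z.1) (fun z => withOne z.1 i)
          (fun z => z.2 - linPred α β z.1) b L (X t ω, Y t ω)|} ≤ δ₂)
    (htrunc : P.real {ω | ∃ t, b * L <
      min (M.importance (X t ω)) b * |Y t ω - linPred α β (X t ω)|} ≤ δ₃)
    (hsq : P.real {ω | 2 * τ ≤ |(n : ℝ)⁻¹ * ∑ t, min (M.importance (X t ω)) b *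
      (Y t ω - linPred α β (X t ω)) ^ 2 - s₀|} ≤ δ₄) :
    P.real {ω | ¬ GoodSample M α β b (fun t => X t ω) (fun t => Y t ω) a (s₀ - 2 * τ)
      (s₀ + 2 * τ)} ≤ ((p : ℝ) + 1) ^ 2 * δ₁ + ((p : ℝ) + 1) * δ₂ + δ₃ + δ₄ := by
  set E₁ : Fin (p + 1) → Fin (p + 1) → Set Ω := fun i j => {ω | a ≤ |(n : ℝ)⁻¹ * ∑ t,
      min (M.importance (X t ω)) b * (withOne (X t ω) i * withOne (X t ω) j) - M.moment i j|}
    with hE₁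
  set E₂ : Fin (p + 1) → Set Ω := fun i => {ω | a ≤ |(n : ℝ)⁻¹ * ∑ t,
      min (M.importance (X t ω)) b *
        truncNoise (fun z : (Fin p → ℝ) × ℝ => M.importance z.1) (fun z => withOne z.1 i)
          (fun z => z.2 - linPred α β z.1) b L (X t ω, Y t ω)|} with hE₂
  set E₃ : Set Ω := {ω | ∃ t, b * L <
      min (M.importance (X t ω)) b * |Y t ω - linPred α β (X t ω)|} with hE₃
  set E₄ : Set Ω := {ω | 2 * τ ≤ |(n : ℝ)⁻¹ * ∑ t, min (M.importance (X t ω)) b *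
      (Y t ω - linPred α β (X t ω)) ^ 2 - s₀|} with hE₄
  have hsub : {ω | ¬ GoodSample M α β b (fun t => X t ω) (fun t => Y t ω) a (s₀ - 2 * τ)
      (s₀ + 2 * τ)} ⊆ (((⋃ i, ⋃ j, E₁ i j) ∪ ⋃ i, E₂ i) ∪ E₃) ∪ E₄ := by
    intro ω hω
    by_contra hnot
    refine hω ?_
    simp only [Set.mem_union, Set.mem_iUnion, not_or, not_exists] at hnot
    obtain ⟨⟨⟨h1, h2⟩, h3⟩, h4⟩ := hnot
    have h4' : |wAvg (truncWeight M b fun t => X t ω)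
        (fun t => (Y t ω - linPred α β (X t ω)) ^ 2) - s₀| < 2 * τ := not_le.1 h4
    have h4'' := abs_lt.1 h4'
    refine ⟨fun i j => (not_le.1 (h1 i j)).le, fun i => ?_, by linarith, by linarith⟩
    have h5 := h2 i
    simp only [hE₂, Set.mem_ofPred_eq, not_le] at h5
    have h6 : ∀ t, truncNoise (fun z : (Fin p → ℝ) × ℝ => M.importance z.1)
        (fun z => withOne z.1 i) (fun z => z.2 - linPred α β z.1) b L (X t ω, Y t ω) =
        withOne (X t ω) i * (Y t ω - linPred α β (X t ω)) := by
      intro t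
      have h7 : (X t ω, Y t ω) ∈ {z : (Fin p → ℝ) × ℝ |
          min (M.importance z.1) b * |z.2 - linPred α β z.1| ≤ b * L} :=
        not_lt.1 fun h8 => h3 ⟨t, h8⟩
      rw [truncNoise, Set.indicator_of_mem h7]
    simp only [h6] at h5
    exact h5.le
  refine (measureReal_mono hsub).trans ?_
  have h1 : P.real (⋃ i, ⋃ j, E₁ i j) ≤ ((p : ℝ) + 1) ^ 2 * δ₁ := by
    calc P.real (⋃ i, ⋃ j, E₁ i j) ≤ ∑ i, P.real (⋃ j, E₁ i j) := measureReal_iUnion_fintype_le _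
      _ ≤ ∑ i : Fin (p + 1), ∑ j : Fin (p + 1), δ₁ := Finset.sum_le_sum fun i _ =>
          (measureReal_iUnion_fintype_le _).trans (Finset.sum_le_sum fun j _ => hinput i j)
      _ = _ := by simp; ring
  have h2 : P.real (⋃ i, E₂ i) ≤ ((p : ℝ) + 1) * δ₂ := by
    calc P.real (⋃ i, E₂ i) ≤ ∑ i, P.real (E₂ i) := measureReal_iUnion_fintype_le _
      _ ≤ ∑ i : Fin (p + 1), δ₂ := Finset.sum_le_sum fun i _ => hnoise i
      _ = _ := by simp
  calc _ ≤ P.real (⋃ i, ⋃ j, E₁ i j) + P.real (⋃ i, E₂ i) + P.real E₃ + P.real E₄ := by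
        refine (measureReal_union_le _ _).trans ?_
        gcongr
        refine (measureReal_union_le _ _).trans ?_
        gcongr
        exact measureReal_union_le _ _
    _ ≤ _ := by gcongr

/-- A sample is good at the rate `d` except on an event of small probability. -/
theorem exists_goodSample_bound {θ η q C Cw R s : ℝ} (hθ : 0 < θ) (hη : 0 < η) (hη2 : η ≤ 2)
    (hq : 0 < q) (hC : 0 ≤ C) (hCw : 0 ≤ Cw) (hR : 0 ≤ R) (hs : 0 < s) :
    ∃ κ D K : ℝ, 0 < κ ∧ 0 < D ∧ 0 ≤ K ∧ ∀ {n p : ℕ} {Ω : Type u} [MeasurableSpace Ω]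
      (P : Measure Ω) [IsProbabilityMeasure P] (M : Population p) (α : ℝ) (β : Fin p → ℝ)
      (X : Fin n → Ω → (Fin p → ℝ)) (Y : Fin n → Ω → ℝ) (d b l : ℝ),
      IsSample P M.lawTr (fun t ω => (X t ω, Y t ω)) → IsBestLinearPredictor M α β →
      TailBounds M α β θ η q C Cw →
      RateBounds n (Real.log p) d b l (1 / η + 1 / 2) q κ R →
      s ≤ ∫ z, (z.2 - linPred α β z.1) ^ 2 ∂M.lawTe → b ^ (-(q / 2)) * K ≤ s / 4 →
      P.real {ω | ¬ GoodSample M α β b (fun t => X t ω) (fun t => Y t ω) (D * d) (s / 2) K} ≤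
        ((p : ℝ) + 1) ^ 2 * (2 * Real.exp (-(4 * Real.log p))) +
          ((p : ℝ) + 1) * (2 * Real.exp (-(4 * Real.log p))) + K / n + b / n * K := by
  set r := 1 / η + 1 / 2 with hr
  have hr1 : 1 ≤ r := by
    have : 1 / 2 ≤ 1 / η := one_div_le_one_div_of_le hη hη2
    rw [hr]; linarith
  obtain ⟨σ, hσ4, hσq⟩ : ∃ σ : ℝ, 4 ≤ σ ∧ (1 < q → 2 * q / (q - 1) ≤ σ) :=
    ⟨max 4 (2 * q / (q - 1)), le_max_left _ _, fun _ => le_max_right _ _⟩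
  have hσ0 : 0 < σ := by linarith
  obtain ⟨A, hA, hθA⟩ : ∃ A : ℝ, 1 ≤ A ∧ 4 ≤ θ * A := by
    refine ⟨1 + 4 / θ, by have : 0 < 4 / θ := by positivity
                          linarith, ?_⟩
    rw [mul_add, mul_div_cancel₀ _ hθ.ne']
    linarith
  have hA0 : 0 < A := by linarith
  obtain ⟨k, hk0, hk⟩ : ∃ k : ℝ, 0 < k ∧ k * (2 * σ) ≤ θ / 2 :=
    ⟨θ / (4 * σ), by positivity, le_of_eq (by field_simp; norm_num)⟩
  have hAη : 1 ≤ A ^ (1 / η) := Real.one_le_rpow hA (by positivity)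
  -- `κ` scales the Chernoff parameter; it is small enough for the exponential factor to fit into
  -- the envelope both for the inputs and for the truncated noise.
  obtain ⟨κ, hκ, hκk⟩ : ∃ κ : ℝ, 0 < κ ∧ κ * R * A ^ (1 / η) ≤ k := by
    have h0 : 0 ≤ R * A ^ (1 / η) := by positivity
    refine ⟨k / (R * A ^ (1 / η) + 1), by positivity, ?_⟩
    rw [mul_assoc, div_mul_eq_mul_div, div_le_iff₀ (by linarith)]
    nlinarith
  have hκk' : κ * R ≤ k := le_trans (le_mul_of_one_le_right (by positivity) hAη) hκk
  set D₁ := deviationConst (envelopeConst A r k) (((σ / (θ / 2)) ^ σ + 1) * C) Cw κ R with hD₁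
  set D₂ := deviationConst (envelopeConst A r k) (noiseMomentConst θ η σ * C) Cw κ R with hD₂
  set C₂ := (((2 : ℕ) / η) / θ) ^ ((2 : ℕ) / η) * C with hC₂
  set C₄ := (((4 : ℕ) / η) / θ) ^ ((4 : ℕ) / η) * C with hC₄
  set K₃ := (1 / η / (θ / 2)) ^ (1 / η) * C with hK₃
  have hC₂0 : 0 ≤ C₂ := by positivity
  have hC₄0 : 0 ≤ C₄ := by positivity
  have hK₃0 : 0 ≤ K₃ := by positivity
  have hK₄0 : 0 ≤ C₄ / (s / 4) ^ 2 := by positivity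
  refine ⟨κ, max 1 (max D₁ D₂), (Cw + C₄) + C₄ / (s / 4) ^ 2 + K₃ + (C₂ + s / 2), hκ,
    lt_max_of_lt_left one_pos, by positivity, ?_⟩
  intro n p Ω _ P _ M α β X Y d b l hZ hbest htail hrate hvar hbias
  have hlog0 : 0 < Real.log n := by linarith [hrate.one_le_log]
  have hn0 : (0 : ℝ) < n := by exact_mod_cast (by have := hrate.two_le; omega : 0 < n)
  have hb0 : 0 < b := by linarith [hrate.one_le_b]
  have hd0 := hrate.d_pos
  have hW := M.isImportance_lawTe
  have hWq := htail.weight_lawTe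
  have hl := measurable_linPred α β
  have hem : Measurable fun z : (Fin p → ℝ) × ℝ => z.2 - linPred α β z.1 := by fun_prop
  have hxm : ∀ i : Fin (p + 1), Measurable fun z : (Fin p → ℝ) × ℝ => withOne z.1 i :=
    fun i => (measurable_withOne_apply i).comp measurable_fst
  have he2 := htail.noise_pow hθ hη (m := 2) even_two two_pos
  have he4 := htail.noise_pow hθ hη (m := 4) (by decide) (by norm_num)
  have heL : MemLp (fun z : (Fin p → ℝ) × ℝ => z.2 - linPred α β z.1) 2 M.lawTe :=
    (memLp_two_iff_integrable_sq hem.aestronglyMeasurable).2 he2.1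
  have hxL : ∀ i : Fin (p + 1), MemLp (fun z : (Fin p → ℝ) × ℝ => withOne z.1 i) 2 M.lawTe := by
    intro i
    rw [memLp_two_iff_integrable_sq (hxm i).aestronglyMeasurable]
    refine (Population.integrable_fst_lawTe (htail.abs_mul_integrable hθ i i).1).congr
      (ae_of_all _ fun z => ?_)
    simp only
    rw [abs_mul_self, sq]
  have hmean : ∀ i j : Fin (p + 1), ∫ z, withOne z.1 i * withOne z.1 j ∂M.lawTe =
      M.moment i j := fun i j =>
    Population.integral_fst_lawTe (f := fun x => withOne x i * withOne x j)
      ((measurable_withOne_apply i).mul (measurable_withOne_apply j))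
  have hDd : D₁ * d ≤ max 1 (max D₁ D₂) * d ∧ D₂ * d ≤ max 1 (max D₁ D₂) * d := by
    constructor <;> gcongr
    · exact (le_max_left _ _).trans (le_max_right _ _)
    · exact (le_max_right _ _).trans (le_max_right _ _)
  have h1 : ∀ i j : Fin (p + 1), P.real {ω | max 1 (max D₁ D₂) * d ≤ |(n : ℝ)⁻¹ * ∑ t,
      min (M.importance (X t ω)) b * (withOne (X t ω) i * withOne (X t ω) j) - M.moment i j|} ≤
      2 * Real.exp (-(4 * Real.log p)) := by
    intro i j
    refine le_trans (measureReal_mono fun ω hω => ?_)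
      (hZ.deviation_of_expMoment hW hκ hR hCw hrate hθ hσ4 hk0.le (by nlinarith) hκk' hA hθA hr1
        hσq hq hWq.1 hWq.2 (h := fun z => withOne z.1 i * withOne z.1 j) ((hxm i).mul (hxm j))
        (htail.input_lawTe i j))
    rw [Set.mem_ofPred_eq, hmean]
    exact hDd.1.trans hω
  have h2 : ∀ i : Fin (p + 1), P.real {ω | max 1 (max D₁ D₂) * d ≤ |(n : ℝ)⁻¹ * ∑ t,
      min (M.importance (X t ω)) b *
        truncNoise (fun z : (Fin p → ℝ) × ℝ => M.importance z.1) (fun z => withOne z.1 i)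
          (fun z => z.2 - linPred α β z.1) b ((A * Real.log n) ^ (1 / η)) (X t ω, Y t ω)|} ≤
      2 * Real.exp (-(4 * Real.log p)) := by
    intro i
    refine le_trans (measureReal_mono fun ω hω => ?_)
      (hZ.deviation_truncNoise hη hW hκ hR hCw hrate hθ hσ4 hk0.le hk hκk hA hθA
        hσq hq hWq.1 hWq.2 (hxm i) hem (by simpa using htail.input_lawTe 0 i)
        (htail.input_lawTe i i) htail.noise
        (hbest.integral_withOne_mul_eq_zero heL i (hxL i)))
    exact hDd.2.trans hω
  have h3 := hZ.truncation_probability hη hW hθ hA hθA hrate.one_le_b hrate.two_le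
    hrate.one_le_log hem htail.noise
  have h4 := hZ.deviation_sq hW (by have := hrate.two_le; omega) hb0 hq hWq.1 hWq.2 hem he2.1 he4.1
    he4.2 (by positivity : 0 < s / 4) (le_trans
      (mul_le_mul_of_nonneg_left (by linarith) (Real.rpow_nonneg hb0.le _)) hbias)
  have hmain := IsSample.goodSample_probability h1 h2 h3 h4
  refine le_trans ?_ (hmain.trans ?_)
  · have := he2.2
    refine measureReal_mono fun ω hω hgood => hω ?_
    exact ⟨hgood.input, hgood.noise, by linarith [hgood.lower], by linarith [hgood.upper]⟩
  · gcongr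
    · change K₃ ≤ _
      linarith
    · change C₄ / (s / 4) ^ 2 ≤ _
      linarith

/-- There are at most `O(p²)` events of probability `O(p⁻⁴)`, so any bound vanishing as `p → ∞`
would do. -/
lemma exp_neg_four_log_union_le {p : ℕ} (hp : 1 ≤ p) :
    ((p : ℝ) + 1) ^ 2 * (2 * Real.exp (-(4 * Real.log p))) +
      ((p : ℝ) + 1) * (2 * Real.exp (-(4 * Real.log p))) ≤ 12 / p := by
  have hp1 : (1 : ℝ) ≤ p := by exact_mod_cast hp
  have hp0 : (0 : ℝ) < p := by linarith
  have h1 : Real.exp (-(4 * Real.log p)) = 1 / (p : ℝ) ^ 4 := by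
    rw [Real.exp_neg, mul_comm, Real.exp_mul, Real.exp_log hp0, one_div]
    norm_cast
  rw [h1]
  have h2 : ((p : ℝ) + 1) ^ 2 * 2 + ((p : ℝ) + 1) * 2 ≤ 12 * (p : ℝ) ^ 3 := by
    have h3 : (p : ℝ) ≤ (p : ℝ) ^ 3 := le_self_pow₀ hp1 (by norm_num)
    have h4 : (p : ℝ) ^ 2 ≤ (p : ℝ) ^ 3 := pow_le_pow_right₀ hp1 (by norm_num)
    nlinarith
  calc _ = (((p : ℝ) + 1) ^ 2 * 2 + ((p : ℝ) + 1) * 2) / (p : ℝ) ^ 4 := by ring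
    _ ≤ 12 * (p : ℝ) ^ 3 / (p : ℝ) ^ 4 := by gcongr
    _ = 12 / p := by field_simp

lemma MCPE_nonneg {n p : ℕ} (M : Population p) (α : ℝ) (β : Fin p → ℝ) (w : Fin n → ℝ)
    (x : Fin n → Fin p → ℝ) (y : Fin n → ℝ) (J : Finset (Fin p)) : 0 ≤ MCPE M α β w x y J :=
  integral_nonneg fun _ => sq_nonneg _

/-- One bound `B` serves every `ε`, because the exceptional probability tends to zero. -/
lemma IsBigOpOne.of_probability {Ω : ℕ → Type*} [∀ n, MeasurableSpace (Ω n)]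
    {P : ∀ n, Measure (Ω n)} [∀ n, IsProbabilityMeasure (P n)] {Z : ∀ n, Ω n → ℝ}
    {G : ∀ n, Set (Ω n)} {δ : ℕ → ℝ} {B : ℝ} (hδ : Tendsto δ atTop (𝓝 0))
    (hG : ∀ᶠ n in atTop, (P n).real (G n)ᶜ ≤ δ n)
    (hZ : ∀ᶠ n in atTop, ∀ ω ∈ G n, |Z n ω| ≤ B) : IsBigOpOne P Z := by
  intro ε hε
  refine ⟨B, ?_⟩
  filter_upwards [hG, hZ, hδ.eventually_le_const hε] with n hGn hZn hδn
  calc P n {ω | B < |Z n ω|} ≤ P n (G n)ᶜ :=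
        measure_mono fun ω hω hωG => absurd hω (not_lt.2 (hZn ω hωG))
    _ = ENNReal.ofReal ((P n).real (G n)ᶜ) := by rw [ofReal_measureReal]
    _ ≤ ENNReal.ofReal ε := ENNReal.ofReal_le_ofReal (hGn.trans hδn)

end CovShift

/-! ### The main theorem -/

theorem theorem2
    -- the dimensions, the populations and the best linear predictors
    (p : ℕ → ℕ) (M : ∀ n, CovShift.Population (p n))
    (α : ℕ → ℝ) (β : ∀ n, Fin (p n) → ℝ)
    (hBLP : ∀ n, CovShift.IsBestLinearPredictor (M n) (α n) (β n))
    -- the training data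
    {Ω : ℕ → Type*} [∀ n, MeasurableSpace (Ω n)]
    (P : ∀ n, MeasureTheory.Measure (Ω n)) [∀ n, MeasureTheory.IsProbabilityMeasure (P n)]
    (X : ∀ n, Fin n → Ω n → (Fin (p n) → ℝ)) (Y : ∀ n, Fin n → Ω n → ℝ)
    -- the constants
    (θ₀ η q Csig Clam Mw Mη : ℝ)
    (hθ₀ : 0 < θ₀) (hη : 0 < η) (hη2 : η ≤ 2) (hq : 0 < q) (hCsig : 0 < Csig) (hClam : 0 < Clam)
    (hMw : 0 < Mw) (hMη : 1 / η + 1 / 2 ≤ Mη)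
    -- the assumptions
    (h1 : CovShift.CondC1 p)
    (h2 : CovShift.CondC2 M α β θ₀ η)
    (h3 : CovShift.CondC3 M q)
    (h4 : CovShift.CondC4 M P X Y)
    (hEig : ∀ᶠ n in Filter.atTop, CovShift.MinEigenvalueGE (M n).SigmaTe Clam)
    (hNoise : CovShift.NoiseNondegenerate M α β) :
    -- the thresholds for `M_k` and `s_a` do not depend on the sparsity index `ξ`
    ∃ Mk₀ sa₀ : ℝ, 0 < Mk₀ ∧ 0 < sa₀ ∧
      ∀ Mk sa ξ Cξ : ℝ, 0 < Mk → Mk ≤ Mk₀ → sa₀ ≤ sa → 0 ≤ ξ → 0 < Cξ →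
        CovShift.CondC5 α β ξ Cξ →
        (∀ᶠ n in Filter.atTop, CovShift.RegressionBound (M n).SigmaTe
          (CovShift.iterBound p q η Mk n) Csig) →
        -- the selected model attains the rate, for every IWOGA run and every HDIWIC minimizer
        (∀ (Jhat : ∀ n, Ω n → ℕ → Finset (Fin (p n))) (khat : ∀ n, Ω n → ℕ),
          (∀ n ω, CovShift.IsIWOGA
            (CovShift.sampleWeight (M n) (CovShift.trimLevel p q Mw Mη n) (fun t => X n t ω))
            (fun t => X n t ω) (fun t => Y n t ω) (Jhat n ω)) →
          (∀ n ω, 1 ≤ CovShift.iterBound p q η Mk n → CovShift.IsHDIWICMin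
            (CovShift.sampleWeight (M n) (CovShift.trimLevel p q Mw Mη n) (fun t => X n t ω))
            (fun t => X n t ω) (fun t => Y n t ω) sa (CovShift.dRate p q η n)
            (CovShift.iterBound p q η Mk n) (Jhat n ω) (khat n ω)) →
          CovShift.IsBigOpOne P (fun n ω =>
            CovShift.MCPE (M n) (α n) (β n)
              (CovShift.sampleWeight (M n) (CovShift.trimLevel p q Mw Mη n) (fun t => X n t ω))
              (fun t => X n t ω) (fun t => Y n t ω) (Jhat n ω (khat n ω))
              / CovShift.dRate p q η n ^ ((1 + 2 * ξ) / (1 + ξ)))) ∧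
        -- and this rate is the order of the best value of the bound `m^{-(1+2ξ)} + m d_n²`
        (∃ c C : ℝ, 0 < c ∧ 0 < C ∧ ∀ᶠ n in Filter.atTop,
          (∀ m : ℕ, 1 ≤ m → (m : ℝ) ≤ CovShift.iterBound p q η Mk n →
            c * CovShift.dRate p q η n ^ ((1 + 2 * ξ) / (1 + ξ))
              ≤ CovShift.iterRate ξ (CovShift.dRate p q η n) m) ∧
          (∃ m : ℕ, 1 ≤ m ∧ (m : ℝ) ≤ CovShift.iterBound p q η Mk n ∧
            CovShift.iterRate ξ (CovShift.dRate p q η n) m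
              ≤ C * CovShift.dRate p q η n ^ ((1 + 2 * ξ) / (1 + ξ)))) := by
  obtain ⟨C, Cw, hC, hCw, htail⟩ := CovShift.exists_eventually_tailBounds h2 h3
  obtain ⟨s, hs, hnoise⟩ := hNoise
  obtain ⟨κ, D, K, hκ, hD, hK, hgood⟩ := CovShift.exists_goodSample_bound hθ₀ hη hη2 hq hC hCw
    (show 0 ≤ Mw + Mw ^ (1 - q) + Mw ^ (-q) by positivity) hs
  have hA : 1 ≤ 1 + C / θ₀ := by
    have : 0 ≤ C / θ₀ := by positivity
    linarith
  set A := 1 + C / θ₀ with hAdef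
  have hA0 : 0 < A := by linarith
  have hd := h1.tendsto_dRate hη hq
  -- The first threshold keeps `K_n` times the moment error below half the smallest eigenvalue. The
  -- second makes the penalty, with residual variance at least `s / 2 / 4 / 2`, exceed the fitted
  -- noise. All constants are fixed before `ξ` and `Cξ` appear.
  refine ⟨Clam / 2 / (20 * A ^ 2 * D), (2 * (20 * A ^ 2 * D) ^ 2 / Clam + 1) / (s / 2 / 4 / 2),
    by positivity, by positivity, ?_⟩
  intro Mk sa ξ Cξ hMk hMk' hsa hξ hCξ h5 hReg
  have hsa0 : 0 ≤ sa := le_trans (by positivity) hsa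
  rw [le_div_iff₀ (by positivity)] at hMk'
  rw [div_le_iff₀ (by positivity)] at hsa
  refine ⟨fun Jhat khat hJ hk => ?_, ?_⟩
  · obtain ⟨⟨Bβ, hBβ⟩, hsparse⟩ := h5
    obtain ⟨B, hB⟩ := CovShift.exists_risk_bound (Bβ := Bβ) hD hA hClam hCsig.le (half_pos hs) hK hMk
      hMk' hsa0 hsa hξ hCξ.le
    have hb := h1.tendsto_trimLevel (Mη := Mη) hq hMw
    have hδ : Filter.Tendsto (fun n : ℕ => 12 / (p n : ℝ) + K / n +
        CovShift.trimLevel p q Mw Mη n / n * K) Filter.atTop (nhds 0) := by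
      have hp : Filter.Tendsto (fun n => (p n : ℝ)) Filter.atTop Filter.atTop :=
        tendsto_natCast_atTop_atTop.comp h1.2
      simpa using ((hp.const_div_atTop 12).add (tendsto_natCast_atTop_atTop.const_div_atTop K)).add
        ((h1.tendsto_trimLevel_div (Mη := Mη) hq hMw).mul_const K)
    have hbias : Filter.Tendsto (fun n => CovShift.trimLevel p q Mw Mη n ^ (-(q / 2)) * K)
        Filter.atTop (nhds 0) := by
      simpa using ((tendsto_rpow_neg_atTop (half_pos hq)).comp hb).mul_const K
    refine CovShift.IsBigOpOne.of_probability (B := B) (G := fun n => {ω |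
      CovShift.GoodSample (M n) (α n) (β n) (CovShift.trimLevel p q Mw Mη n) (fun t => X n t ω)
        (fun t => Y n t ω) (D * CovShift.dRate p q η n) (s / 2) K}) hδ ?_ ?_
    · filter_upwards [htail, hnoise, h1.eventually_rateBounds hη hq hMw hMη,
        hbias.eventually_le_const (by positivity : 0 < s / 4), h1.2.eventually_ge_atTop 1]
        with n htail hnoise hrate hbias hp
      have he2 := htail.noise_pow hθ₀ hη (m := 2) even_two two_pos
      rw [← MeasureTheory.ofReal_integral_eq_lintegral_ofReal he2.1
        (MeasureTheory.ae_of_all _ fun _ => sq_nonneg _),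
        ENNReal.ofReal_le_ofReal_iff (MeasureTheory.integral_nonneg fun _ => sq_nonneg _)] at hnoise
      refine (hgood (P n) (M n) (α n) (β n) (X n) (Y n) _ _ _ (h4.isSample n) (hBLP n) htail
        (hrate κ hκ) hnoise hbias).trans ?_
      gcongr
      exact CovShift.exp_neg_four_log_union_le hp
    · have hiter : ∀ᶠ n in Filter.atTop, 1 ≤ CovShift.iterBound p q η Mk n :=
        ((tendsto_inv_nhdsGT_zero.comp hd).const_mul_atTop hMk).eventually_ge_atTop 1
      filter_upwards [htail, hEig, hReg, hiter, hd.eventually hB, hb.eventually_ge_atTop 0,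
        Filter.eventually_ge_atTop 1, hd.eventually self_mem_nhdsWithin]
        with n htail hEig hReg hiter hB hb hn hd ω hω
      have hd' : 0 < CovShift.dRate p q η n := hd
      have hpow := Real.rpow_pos_of_pos hd' ((1 + 2 * ξ) / (1 + ξ))
      rw [abs_of_nonneg (div_nonneg (CovShift.MCPE_nonneg _ _ _ _ _ _ _) hpow.le),
        div_le_iff₀ hpow]
      exact hB (M n) (α n) (β n) _ _ _ (Jhat n ω) (khat n ω) hb
        ⟨htail.momentBound hθ₀, hEig, hReg, hBβ n hn, hsparse n hn⟩ hω (hJ n ω) (hk n ω hiter)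
  · obtain ⟨c, C', hc, hC', h⟩ := CovShift.exists_iterRate_bounds hξ hMk
    exact ⟨c, C', hc, hC', hd.eventually h⟩
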